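/- Computations are performed on a word RAM with words of $O(\log n)$ bits, in the addition-comparison model for real numbers (real numbers may only be copied, added and compared); every elementary operation takes unit time, and an algorithm is one fixed program for all input sizes. Let $\omega$ denote the exponent of square matrix multiplication: two $n\times n$ matrices with entries in $\{0,1\}$ can be multiplied over the integers in $O(n^{\omega})$ time, where $\omega\le 3$. For an integer $h\ge 3$ define $$b_1=\max\Big\{b\in\mathbb N:\ \tfrac{b}{4-\omega}\le\Big\lfloor\tfrac{h-b}{2}\Big\rfloor\Big\},\qquad s_1=h-b_1+\frac{b_1}{4-\omega},$$ $$s_2(b)=\max\Big\{h-b+\Big\lfloor\tfrac{h-b}{2}\Big\rfloor,\ h-(3-\omega)\Big\lfloor\tfrac{h-b}{2}\Big\rfloor\Big\},\qquad s_2=\min\Big\{s_2(b):\ \Big\lfloor\tfrac{h-b}{2}\Big\rfloor\le b\le h-2\Big\},$$ $$t(\omega,h)=\min\{s_1,s_2\}.$$ **Theorem.** Let $H$ be a fixed graph with $h\ge 3$ vertices. Given an undirected graph $G=(V,E)$ with $n$ vertices and a weight function $w:V\to\mathbb R$, one can find, for all pairs of vertices $u,v\in V$, an induced $H$-subgraph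 of $G$ that contains $u$ and $v$ and has maximum total vertex weight (or report that there is none), in $O(n^{t(\omega,h)})$ time altogether. In particular, the MAX $H$-subgraph problem (find a maximum-weight $H$-subgraph of $G$, if one exists), both for induced and for not necessarily induced $H$-subgraphs, can be solved in $O(n^{t(\omega,h)})$ time. Here $\omega$ may be any real number at most $3$ for which $n\times n$ matrices with entries in $\{0,1\}$ can be multiplied over the integers in $O(n^{\omega})$ time. If $\omega$ is instead taken to be the infimum of all such exponents, the bounds hold in the form $O(n^{t(\omega,h)+\varepsilon})$ for every $\varepsilon>0$. For example, $t(\omega,3)=2+1/(4-\omega)$. -/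

import Mathlib

noncomputable section

namespace WordRAM

/-! ### The machine

A word RAM in the addition-comparison model for real numbers, programmed in a structured language.
There are finitely many named registers and arrays in any program; natural-number words can be added,
subtracted, multiplied, divided and used as addresses, while real numbers can only be copied, added and
compared. Every elementary operation costs one step. -/

/-- The contents of the machine: word registers, word arrays, real registers, real arrays. -/
structure State where
  nreg : ℕ → ℕ
  narr : ℕ → ℕ → ℕ
  rreg : ℕ → ℝ
  rarr : ℕ → ℕ → ℝ

/-- Word expressions; `get a e` is the entry of array `a` at the address given by `e`. -/
inductive NExp where
  | const (k : ℕ)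
  | reg (x : ℕ)
  | get (a : ℕ) (e : NExp)
  | add (e₁ e₂ : NExp)
  | sub (e₁ e₂ : NExp)
  | mul (e₁ e₂ : NExp)
  | div (e₁ e₂ : NExp)
  | mod (e₁ e₂ : NExp)

namespace NExp

/-- Value of a word expression (subtraction is truncated at zero). -/
def eval (s : State) : NExp → ℕ
  | const k => k
  | reg x => s.nreg x
  | get a e => s.narr a (e.eval s)
  | add e₁ e₂ => e₁.eval s + e₂.eval s
  | sub e₁ e₂ => e₁.eval s - e₂.eval s
  | mul e₁ e₂ => e₁.eval s * e₂.eval s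
  | div e₁ e₂ => e₁.eval s / e₂.eval s
  | mod e₁ e₂ => e₁.eval s % e₂.eval s

/-- Number of elementary operations in an expression. -/
def cost : NExp → ℕ
  | const _ => 1
  | reg _ => 1
  | get _ e => e.cost + 1
  | add e₁ e₂ => e₁.cost + e₂.cost + 1
  | sub e₁ e₂ => e₁.cost + e₂.cost + 1
  | mul e₁ e₂ => e₁.cost + e₂.cost + 1
  | div e₁ e₂ => e₁.cost + e₂.cost + 1
  | mod e₁ e₂ => e₁.cost + e₂.cost + 1

/-- No sum or product formed during the evaluation exceeds the word bound `W`
(the other operations never produce a word larger than those already present). -/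
def Fits (W : ℕ) (s : State) : NExp → Prop
  | const _ => True
  | reg _ => True
  | get _ e => e.Fits W s
  | add e₁ e₂ => e₁.Fits W s ∧ e₂.Fits W s ∧ e₁.eval s + e₂.eval s ≤ W
  | sub e₁ e₂ => e₁.Fits W s ∧ e₂.Fits W s
  | mul e₁ e₂ => e₁.Fits W s ∧ e₂.Fits W s ∧ e₁.eval s * e₂.eval s ≤ W
  | div e₁ e₂ => e₁.Fits W s ∧ e₂.Fits W s
  | mod e₁ e₂ => e₁.Fits W s ∧ e₂.Fits W s

end NExp

/-- Real expressions: addition is the only arithmetic operation, and there are no real constants. -/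
inductive RExp where
  | reg (x : ℕ)
  | get (a : ℕ) (e : NExp)
  | add (r₁ r₂ : RExp)

namespace RExp

def eval (s : State) : RExp → ℝ
  | reg x => s.rreg x
  | get a e => s.rarr a (e.eval s)
  | add r₁ r₂ => r₁.eval s + r₂.eval s

def cost : RExp → ℕ
  | reg _ => 1
  | get _ e => e.cost + 1
  | add r₁ r₂ => r₁.cost + r₂.cost + 1

def Fits (W : ℕ) (s : State) : RExp → Prop
  | reg _ => True
  | get _ e => e.Fits W s
  | add r₁ r₂ => r₁.Fits W s ∧ r₂.Fits W s

end RExp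

/-- Tests: comparison of words, comparison of reals, Boolean combinations. -/
inductive BExp where
  | eq (e₁ e₂ : NExp)
  | lt (e₁ e₂ : NExp)
  | rle (r₁ r₂ : RExp)
  | not (b : BExp)
  | and (b₁ b₂ : BExp)

namespace BExp

def Holds (s : State) : BExp → Prop
  | eq e₁ e₂ => e₁.eval s = e₂.eval s
  | lt e₁ e₂ => e₁.eval s < e₂.eval s
  | rle r₁ r₂ => r₁.eval s ≤ r₂.eval s
  | not b => ¬ b.Holds s
  | and b₁ b₂ => b₁.Holds s ∧ b₂.Holds s

def cost : BExp → ℕ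
  | eq e₁ e₂ => e₁.cost + e₂.cost + 1
  | lt e₁ e₂ => e₁.cost + e₂.cost + 1
  | rle r₁ r₂ => r₁.cost + r₂.cost + 1
  | not b => b.cost + 1
  | and b₁ b₂ => b₁.cost + b₂.cost + 1

def Fits (W : ℕ) (s : State) : BExp → Prop
  | eq e₁ e₂ => e₁.Fits W s ∧ e₂.Fits W s
  | lt e₁ e₂ => e₁.Fits W s ∧ e₂.Fits W s
  | rle r₁ r₂ => r₁.Fits W s ∧ r₂.Fits W s
  | not b => b.Fits W s
  | and b₁ b₂ => b₁.Fits W s ∧ b₂.Fits W s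

end BExp

/-- Programs. -/
inductive Prog where
  | skip
  | setN (x : ℕ) (e : NExp)
  | putN (a : ℕ) (i e : NExp)
  | setR (x : ℕ) (r : RExp)
  | putR (a : ℕ) (i : NExp) (r : RExp)
  | seq (p q : Prog)
  | ite (b : BExp) (p q : Prog)
  | loop (b : BExp) (p : Prog)

/-- Replace one entry of an array. -/
def updArr {α : Type} (f : ℕ → ℕ → α) (a i : ℕ) (v : α) : ℕ → ℕ → α :=
  Function.update f a (Function.update (f a) i v)

/-- `Exec W p s s' k`: with word bound `W`, the program `p` started in state `s` halts in state `s'`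
after `k` steps. A program that would form a word larger than `W` has no execution. -/
inductive Exec (W : ℕ) : Prog → State → State → ℕ → Prop where
  | skip (s : State) : Exec W .skip s s 1
  | setN (s : State) (x : ℕ) (e : NExp) (he : e.Fits W s) :
      Exec W (.setN x e) s { s with nreg := Function.update s.nreg x (e.eval s) } (e.cost + 1)
  | putN (s : State) (a : ℕ) (i e : NExp) (hi : i.Fits W s) (he : e.Fits W s) :
      Exec W (.putN a i e) s { s with narr := updArr s.narr a (i.eval s) (e.eval s) }
        (i.cost + e.cost + 1)
  | setR (s : State) (x : ℕ) (r : RExp) (hr : r.Fits W s) :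
      Exec W (.setR x r) s { s with rreg := Function.update s.rreg x (r.eval s) } (r.cost + 1)
  | putR (s : State) (a : ℕ) (i : NExp) (r : RExp) (hi : i.Fits W s) (hr : r.Fits W s) :
      Exec W (.putR a i r) s { s with rarr := updArr s.rarr a (i.eval s) (r.eval s) }
        (i.cost + r.cost + 1)
  | seq {s₁ s₂ s₃ : State} {p q : Prog} {k l : ℕ} (hp : Exec W p s₁ s₂ k) (hq : Exec W q s₂ s₃ l) :
      Exec W (.seq p q) s₁ s₃ (k + l)
  | iteTrue {s s' : State} {b : BExp} {p q : Prog} {k : ℕ} (hb : b.Fits W s) (ht : b.Holds s)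
      (hp : Exec W p s s' k) : Exec W (.ite b p q) s s' (b.cost + 1 + k)
  | iteFalse {s s' : State} {b : BExp} {p q : Prog} {k : ℕ} (hb : b.Fits W s) (hf : ¬ b.Holds s)
      (hq : Exec W q s s' k) : Exec W (.ite b p q) s s' (b.cost + 1 + k)
  | loopDone {s : State} {b : BExp} {p : Prog} (hb : b.Fits W s) (hf : ¬ b.Holds s) :
      Exec W (.loop b p) s s (b.cost + 1)
  | loopStep {s₁ s₂ s₃ : State} {b : BExp} {p : Prog} {k l : ℕ} (hb : b.Fits W s₁)
      (ht : b.Holds s₁) (hp : Exec W p s₁ s₂ k) (hl : Exec W (.loop b p) s₂ s₃ l) :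
      Exec W (.loop b p) s₁ s₃ (b.cost + 1 + k + l)

/-- A computational problem is given by its instances, their sizes, the relation "the memory holds
the instance" and the relation "the memory holds a correct answer". It is solvable in time
`O(n ^ τ)` if one fixed program, using words of `O(log n)` bits (that is, bounded by a fixed power of
`n + 2`), halts with a correct answer after at most `C * (n + 1) ^ τ` steps, on all instances and
for every content of the memory cells that are not part of the input. -/
def SolvableInTime {I : Type} (size : I → ℕ) (input output : I → State → Prop) (τ : ℝ) : Prop :=
  ∃ (p : Prog) (d : ℕ) (C : ℝ), ∀ (x : I) (s : State), input x s →
    ∃ (s' : State) (k : ℕ), Exec ((size x + 2) ^ d) p s s' k ∧ output x s' ∧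
      (k : ℝ) ≤ C * ((size x : ℝ) + 1) ^ τ

end WordRAM

open WordRAM

/-! ### Matrix multiplication -/

/-- A pair of square 0-1 matrices of order `n`. -/
structure MatPair where
  n : ℕ
  A : Matrix (Fin n) (Fin n) ℕ
  B : Matrix (Fin n) (Fin n) ℕ
  A_le_one : ∀ i j, A i j ≤ 1
  B_le_one : ∀ i j, B i j ≤ 1

/-- The order is in word register 0, the two matrices are in word arrays 0 and 1. -/
def MatPair.Input (x : MatPair) (s : State) : Prop :=
  s.nreg 0 = x.n ∧ (∀ i j : Fin x.n, s.narr 0 (i * x.n + j) = x.A i j) ∧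
    ∀ i j : Fin x.n, s.narr 1 (i * x.n + j) = x.B i j

/-- The integer product is in word array 2. -/
def MatPair.Output (x : MatPair) (s : State) : Prop :=
  ∀ i j : Fin x.n, s.narr 2 (i * x.n + j) = (x.A * x.B) i j

/-- Square 0-1 matrices of order `n` can be multiplied, over the integers, in `O(n ^ τ)` time.
(Every algorithm that multiplies more general matrices in that time does this in particular.) -/
def MatMulInTime (τ : ℝ) : Prop :=
  SolvableInTime MatPair.n MatPair.Input MatPair.Output τ

/-- The exponent of square matrix multiplication. -/
def matMulExponent : ℝ := sInf {τ : ℝ | MatMulInTime τ}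

/-! ### The exponent `t(ω, h)` -/

/-- `⌊(h - b) / 2⌋` -/
def halfRest (h b : ℕ) : ℤ := ⌊((h : ℝ) - b) / 2⌋

/-- The largest natural number `b` with `b / (4 - ω) ≤ ⌊(h - b) / 2⌋`. -/
def bOne (ω : ℝ) (h : ℕ) : ℕ := sSup {b : ℕ | (b : ℝ) / (4 - ω) ≤ halfRest h b}

def sOne (ω : ℝ) (h : ℕ) : ℝ := h - bOne ω h + bOne ω h / (4 - ω)

def sTwoAt (ω : ℝ) (h b : ℕ) : ℝ :=
  max ((h : ℝ) - b + halfRest h b) (h - (3 - ω) * halfRest h b)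

def sTwo (ω : ℝ) (h : ℕ) : ℝ :=
  sInf {x : ℝ | ∃ b : ℕ, halfRest h b ≤ b ∧ (b : ℤ) ≤ (h : ℤ) - 2 ∧ x = sTwoAt ω h b}

def tExp (ω : ℝ) (h : ℕ) : ℝ := min (sOne ω h) (sTwo ω h)

/-! ### Maximum-weight `H`-subgraphs -/

/-- A graph on `n` vertices with real vertex weights. -/
structure WGraph where
  n : ℕ
  G : SimpleGraph (Fin n)
  w : Fin n → ℝ

open Classical in
/-- The number of vertices is in word register 0, the adjacency matrix is in word array 0, and the
weights are in real array 0. -/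
def WGraph.Input (x : WGraph) (s : State) : Prop :=
  s.nreg 0 = x.n ∧
    (∀ u v : Fin x.n, s.narr 0 (u * x.n + v) = if x.G.Adj u v then 1 else 0) ∧
    ∀ u : Fin x.n, s.rarr 0 u = x.w u

/-- `φ` places the vertices of `H` on an induced subgraph of `G` isomorphic to `H`. -/
def IsInducedCopy {h n : ℕ} (H : SimpleGraph (Fin h)) (G : SimpleGraph (Fin n))
    (φ : Fin h → Fin n) : Prop := ∃ f : H ↪g G, ⇑f = φ

/-- `φ` places the vertices of `H` on a not necessarily induced subgraph of `G` isomorphic to `H`. -/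
def IsSubgraphCopy {h n : ℕ} (H : SimpleGraph (Fin h)) (G : SimpleGraph (Fin n))
    (φ : Fin h → Fin n) : Prop := ∃ f : SimpleGraph.Copy H G, ⇑f = φ

/-- The answer consisting of `flag` and `ans 0, …, ans (h - 1)` is correct for the task of finding a
placement of maximum total weight among those that satisfy `P`: either the flag is `1` and the
answer lists the vertices of such a placement, or the flag is `0` and no placement satisfies `P`. -/
def FindsMax {h n : ℕ} (P : (Fin h → Fin n) → Prop) (w : Fin n → ℝ) (flag : ℕ) (ans : ℕ → ℕ) :
    Prop :=
  (flag = 1 ∧ ∃ φ : Fin h → Fin n, P φ ∧ (∀ ψ, P ψ → ∑ i, w (ψ i) ≤ ∑ i, w (φ i)) ∧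
      ∀ i : Fin h, ans i = φ i) ∨
    (flag = 0 ∧ ∀ φ : Fin h → Fin n, ¬ P φ)

/-- All pairs: for all `u`, `v`, a maximum-weight induced `H`-subgraph containing `u` and `v`, if
one exists. The flags are in word array 1, the vertices in word array 2. -/
def AllPairsOutput {h : ℕ} (H : SimpleGraph (Fin h)) (x : WGraph) (s : State) : Prop :=
  ∀ u v : Fin x.n,
    FindsMax (fun φ : Fin h → Fin x.n =>
        IsInducedCopy H x.G φ ∧ u ∈ Set.range φ ∧ v ∈ Set.range φ) x.w
      (s.narr 1 (u * x.n + v)) (fun i => s.narr 2 ((u * x.n + v) * h + i))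

/-- A maximum-weight induced `H`-subgraph, if one exists. -/
def MaxInducedOutput {h : ℕ} (H : SimpleGraph (Fin h)) (x : WGraph) (s : State) : Prop :=
  FindsMax (IsInducedCopy H x.G) x.w (s.narr 1 0) (s.narr 2)

/-- A maximum-weight, not necessarily induced `H`-subgraph, if one exists. -/
def MaxSubgraphOutput {h : ℕ} (H : SimpleGraph (Fin h)) (x : WGraph) (s : State) : Prop :=
  FindsMax (IsSubgraphCopy H x.G) x.w (s.narr 1 0) (s.narr 2)

/-- All-Pairs MAX `H`-subgraph and MAX `H`-subgraph, the latter in its induced and in its not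
necessarily induced version, are solvable in `O(n ^ τ)` time. -/
def MaxHSubgraphInTime {h : ℕ} (H : SimpleGraph (Fin h)) (τ : ℝ) : Prop :=
  SolvableInTime WGraph.n WGraph.Input (AllPairsOutput H) τ ∧
    SolvableInTime WGraph.n WGraph.Input (MaxInducedOutput H) τ ∧
    SolvableInTime WGraph.n WGraph.Input (MaxSubgraphOutput H) τ

end

/-! A placement of `H` is a tuple of `h` vertices, coded as a number in base `n`. Its positions are
split into a row part of length `a`, a column part of length `c = ⌊(h - b) / 2⌋` and an inner part
of length `b`, where `a + c + b = h`. Weight is additive, so for a fixed outer (row and column)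
tuple it suffices to find the heaviest inner tuple that fits. List the `n ^ b` inner tuples by
decreasing weight and cut the list into buckets of size `D`. For one bucket, take the 0-1 matrix
that records which row tuples fit which members of the bucket, and the analogous matrix for column
tuples. Their integer product is positive at a pair exactly if the bucket has a member that fits
both. No tuple of a later bucket is heavier than a member of the first such bucket, so one scan
through `D` tuples per outer tuple finishes the search. The compatibility of row with column is not
part of the product; it is tested on the whole tuple during the scan. This is the content of
`exists_better`.

If `D` is at most `(n + 1) ^ min b c`, there are `O(n ^ h / D ^ 3)` products of `D × D` blocks, each
taking `O(D ^ ω)` time, and the scan takes `O(n ^ (h - b) * D)`. For `D = n ^ μ` the larger exponent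
is `planExp`. The choice `μ = b / (4 - ω)` balances the two terms and yields `sOne`; the largest
admissible `μ = ⌊(h - b) / 2⌋` yields `sTwo`. Sorting takes `O(n ^ (b + 1))` and is dominated
because `2 ≤ ω`, which follows from the size of the output (`two_le_of_matMulInTime`).

The real number `μ` is not given to the program, which therefore finds the block size by doubling.
The multiplication routine is instrumented with a counter of loop passes (`Exec.counted`), and an
attempt with size `D` is given up when its measured time exceeds the budget `(n + 1) ^ (a + c) * D`,
as long as `D` can still be doubled. Budgets grow geometrically, so the failed attempts are paid for
by the last one. An accepted size is within a constant factor of the best trade-off: the rejection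
of `D / 2` bounds its budget by a multiplication time (`GoodSize.le_rpow`).

For the all-pairs problem, every ordered pair of distinct vertices of `H` is in turn moved to the
positions `0` and `1`. These are outer positions since `a + c ≥ 2`, so the table slot of a tuple
depends on its outer part only, and keeping the best inner tuple for each outer one loses nothing.
Relations `R` and `N` of required and forbidden adjacencies treat induced and non-induced copies
alike.

For the infimum of the exponents, a plan is fixed for `matMulExponent` and executed with an exponent
slightly above it; `planExp` depends on `ω` in a Lipschitz way. -/

namespace WordRAM

/-! ### State updates -/

/-- Replace the contents of a word register. -/
def State.setReg (s : State) (x v : ℕ) : State :=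
  { s with nreg := Function.update s.nreg x v }

/-- Replace one entry of a word array. -/
def State.setCell (s : State) (a i v : ℕ) : State :=
  { s with narr := updArr s.narr a i v }

theorem updArr_apply {α : Type} (f : ℕ → ℕ → α) (a i : ℕ) (v : α) (b j : ℕ) :
    updArr f a i v b j = if b = a ∧ j = i then v else f b j := by
  unfold updArr
  by_cases hb : b = a
  · subst hb
    by_cases hj : j = i <;> simp [hj]
  · simp [hb]

namespace State

@[simp] theorem nreg_setReg (s : State) (x v y : ℕ) :
    (s.setReg x v).nreg y = if y = x then v else s.nreg y := by
  simp [setReg, Function.update_apply]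

@[simp] theorem narr_setReg (s : State) (x v : ℕ) : (s.setReg x v).narr = s.narr := rfl

@[simp] theorem rarr_setReg (s : State) (x v : ℕ) : (s.setReg x v).rarr = s.rarr := rfl

@[simp] theorem nreg_setCell (s : State) (a i v : ℕ) : (s.setCell a i v).nreg = s.nreg := rfl

@[simp] theorem rarr_setCell (s : State) (a i v : ℕ) : (s.setCell a i v).rarr = s.rarr := rfl

@[simp] theorem narr_setCell (s : State) (a i v b j : ℕ) :
    (s.setCell a i v).narr b j = if b = a ∧ j = i then v else s.narr b j :=
  updArr_apply ..

end State

/-! ### A program logic with running times -/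

/-- With word bound `W`, the program `p` started in `s` halts, and its final state and its running
time satisfy `Q`. -/
def Runs (W : ℕ) (p : Prog) (s : State) (Q : State → ℕ → Prop) : Prop :=
  ∃ s' k, Exec W p s s' k ∧ Q s' k

section rules

variable {W : ℕ} {s : State} {Q : State → ℕ → Prop}

/-- The rules for straight-line programs are equivalences, so that rewriting with them computes the
weakest precondition of a loop-free program. -/
theorem runs_skip : Runs W .skip s Q ↔ Q s 1 := by
  constructor
  · rintro ⟨s', k, h, hQ⟩
    cases h
    exact hQ
  · exact fun h => ⟨_, _, .skip s, h⟩

theorem runs_setN {x : ℕ} {e : NExp} :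
    Runs W (.setN x e) s Q ↔ e.Fits W s ∧ Q (s.setReg x (e.eval s)) (e.cost + 1) := by
  constructor
  · rintro ⟨s', k, h, hQ⟩
    cases h with
    | setN _ _ _ he => exact ⟨he, hQ⟩
  · exact fun h => ⟨_, _, .setN s x e h.1, h.2⟩

theorem runs_putN {a : ℕ} {i e : NExp} :
    Runs W (.putN a i e) s Q ↔
      i.Fits W s ∧ e.Fits W s ∧ Q (s.setCell a (i.eval s) (e.eval s)) (i.cost + e.cost + 1) := by
  constructor
  · rintro ⟨s', k, h, hQ⟩
    cases h with
    | putN _ _ _ _ hi he => exact ⟨hi, he, hQ⟩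
  · exact fun h => ⟨_, _, .putN s a i e h.1 h.2.1, h.2.2⟩

theorem runs_seq {p q : Prog} :
    Runs W (.seq p q) s Q ↔
      Runs W p s fun s₁ k₁ => Runs W q s₁ fun s₂ k₂ => Q s₂ (k₁ + k₂) := by
  constructor
  · rintro ⟨s', k, h, hQ⟩
    cases h with
    | seq hp hq => exact ⟨_, _, hp, _, _, hq, hQ⟩
  · rintro ⟨s₁, k₁, hp, s₂, k₂, hq, hQ⟩
    exact ⟨_, _, .seq hp hq, hQ⟩

theorem runs_ite {b : BExp} {p q : Prog} :
    Runs W (.ite b p q) s Q ↔ b.Fits W s ∧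
      (b.Holds s → Runs W p s fun s' k => Q s' (b.cost + 1 + k)) ∧
      (¬ b.Holds s → Runs W q s fun s' k => Q s' (b.cost + 1 + k)) := by
  constructor
  · rintro ⟨s', k, h, hQ⟩
    cases h with
    | iteTrue hb ht hp => exact ⟨hb, fun _ => ⟨_, _, hp, hQ⟩, fun h => absurd ht h⟩
    | iteFalse hb hf hp => exact ⟨hb, fun h => absurd h hf, fun _ => ⟨_, _, hp, hQ⟩⟩
  · rintro ⟨hb, ht, hf⟩
    by_cases h : b.Holds s
    · obtain ⟨s', k, hp, hQ⟩ := ht h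
      exact ⟨_, _, .iteTrue hb h hp, hQ⟩
    · obtain ⟨s', k, hp, hQ⟩ := hf h
      exact ⟨_, _, .iteFalse hb h hp, hQ⟩

theorem Runs.mono {p : Prog} {Q' : State → ℕ → Prop} (h : Runs W p s Q)
    (hQ : ∀ s' k, Q s' k → Q' s' k) : Runs W p s Q' := by
  obtain ⟨s', k, he, hq⟩ := h
  exact ⟨s', k, he, hQ _ _ hq⟩

/-- Loops with an invariant that may refer to the elapsed time. -/
theorem runs_loop {b : BExp} {p : Prog} (I : State → ℕ → Prop) (measure : State → ℕ)
    (hstep : ∀ s e, I s e → b.Fits W s ∧ (b.Holds s → Runs W p s fun s' k =>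
      I s' (e + (b.cost + 1) + k) ∧ measure s' < measure s))
    {e : ℕ} (hI : I s e) :
    Runs W (.loop b p) s fun s' k =>
      ∃ e', I s' e' ∧ ¬ b.Holds s' ∧ e + k = e' + (b.cost + 1) := by
  induction hm : measure s using Nat.strong_induction_on generalizing s e with
  | _ m ih =>
    obtain ⟨hfit, hbody⟩ := hstep s e hI
    by_cases hb : b.Holds s
    · obtain ⟨s₁, k₁, hp, hI₁, hlt⟩ := hbody hb
      obtain ⟨s₂, k₂, hl, e', hI', hnot, hk⟩ := ih _ (hm ▸ hlt) hI₁ rfl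
      exact ⟨s₂, _, .loopStep hfit hb hp hl, e', hI', hnot, by omega⟩
    · exact ⟨s, _, .loopDone hfit hb, e, hI, hb, rfl⟩

end rules

/-! ### Cells that a program may modify -/

namespace Prog

/-- `p` contains an assignment to word register `x`. -/
def ModN : Prog → ℕ → Prop
  | skip, _ => False
  | setN y _, x => x = y
  | putN _ _ _, _ => False
  | setR _ _, _ => False
  | putR _ _ _, _ => False
  | seq p q, x => p.ModN x ∨ q.ModN x
  | ite _ p q, x => p.ModN x ∨ q.ModN x
  | loop _ p, x => p.ModN x

/-- `p` contains an assignment to word array `a`. -/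
def ModA : Prog → ℕ → Prop
  | skip, _ => False
  | setN _ _, _ => False
  | putN b _ _, a => a = b
  | setR _ _, _ => False
  | putR _ _ _, _ => False
  | seq p q, a => p.ModA a ∨ q.ModA a
  | ite _ p q, a => p.ModA a ∨ q.ModA a
  | loop _ p, a => p.ModA a

/-- `p` contains an assignment to real array `a`. -/
def ModR : Prog → ℕ → Prop
  | skip, _ => False
  | setN _ _, _ => False
  | putN _ _ _, _ => False
  | setR _ _, _ => False
  | putR b _ _, a => a = b
  | seq p q, a => p.ModR a ∨ q.ModR a
  | ite _ p q, a => p.ModR a ∨ q.ModR a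
  | loop _ p, a => p.ModR a

/-- An upper bound for the time of one pass through the program, each loop body being run once. -/
def passCost : Prog → ℕ
  | skip => 1
  | setN _ e => e.cost + 1
  | putN _ i e => i.cost + e.cost + 1
  | setR _ r => r.cost + 1
  | putR _ i r => i.cost + r.cost + 1
  | seq p q => p.passCost + q.passCost
  | ite b p q => b.cost + 1 + (p.passCost + q.passCost)
  | loop b p => b.cost + 5 + p.passCost

/-- The program contains no loop. -/
def LoopFree : Prog → Prop
  | seq p q => p.LoopFree ∧ q.LoopFree
  | ite _ p q => p.LoopFree ∧ q.LoopFree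
  | loop _ _ => False
  | _ => True

end Prog

/-- `s` and `s'` agree on all word registers and arrays that `p` does not assign to. -/
structure Unch (p : Prog) (s s' : State) : Prop where
  nreg : ∀ x, ¬ p.ModN x → s'.nreg x = s.nreg x
  narr : ∀ a, ¬ p.ModA a → s'.narr a = s.narr a
  rarr : ∀ a, ¬ p.ModR a → s'.rarr a = s.rarr a

theorem Unch.refl (p : Prog) (s : State) : Unch p s s :=
  ⟨fun _ _ => rfl, fun _ _ => rfl, fun _ _ => rfl⟩

theorem Unch.trans {p : Prog} {s s' s'' : State} (h : Unch p s s') (h' : Unch p s' s'') :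
    Unch p s s'' :=
  ⟨fun x hx => (h'.nreg x hx).trans (h.nreg x hx), fun x hx => (h'.narr x hx).trans (h.narr x hx),
    fun x hx => (h'.rarr x hx).trans (h.rarr x hx)⟩

theorem Unch.mono {p q : Prog} {s s' : State} (h : Unch p s s')
    (hN : ∀ x, p.ModN x → q.ModN x) (hA : ∀ x, p.ModA x → q.ModA x)
    (hR : ∀ x, p.ModR x → q.ModR x) : Unch q s s' :=
  ⟨fun x hx => h.nreg x (mt (hN x) hx), fun x hx => h.narr x (mt (hA x) hx),
    fun x hx => h.rarr x (mt (hR x) hx)⟩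

theorem Exec.unch {W : ℕ} {p : Prog} {s s' : State} {k : ℕ} (h : Exec W p s s' k) :
    Unch p s s' := by
  induction h with
  | skip s => exact .refl _ _
  | setN s x e he =>
    refine ⟨fun y hy => ?_, fun _ _ => rfl, fun _ _ => rfl⟩
    exact Function.update_of_ne hy _ _
  | putN s a i e hi he =>
    refine ⟨fun _ _ => rfl, fun y hy => ?_, fun _ _ => rfl⟩
    exact Function.update_of_ne hy _ _
  | setR s x r hr => exact ⟨fun _ _ => rfl, fun _ _ => rfl, fun _ _ => rfl⟩
  | putR s a i r hi hr =>
    refine ⟨fun _ _ => rfl, fun _ _ => rfl, fun y hy => ?_⟩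
    exact Function.update_of_ne hy _ _
  | seq _ _ ihp ihq =>
    exact (ihp.mono (fun _ => Or.inl) (fun _ => Or.inl) fun _ => Or.inl).trans
      (ihq.mono (fun _ => Or.inr) (fun _ => Or.inr) fun _ => Or.inr)
  | iteTrue _ _ _ ih => exact ih.mono (fun _ => Or.inl) (fun _ => Or.inl) fun _ => Or.inl
  | iteFalse _ _ _ ih => exact ih.mono (fun _ => Or.inr) (fun _ => Or.inr) fun _ => Or.inr
  | loopDone _ _ => exact .refl _ _
  | loopStep _ _ _ _ ihp ihl =>
    exact Unch.trans (ihp.mono (q := .loop _ _) (fun _ => id) (fun _ => id) fun _ => id) ihl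

theorem Exec.le_passCost {W : ℕ} {p : Prog} {s s' : State} {k : ℕ} (h : Exec W p s s' k)
    (hp : p.LoopFree) : k ≤ p.passCost := by
  induction h with
  | seq _ _ ihp ihq => exact add_le_add (ihp hp.1) (ihq hp.2)
  | iteTrue _ _ _ ih =>
    have := ih hp.1
    simp only [Prog.passCost]
    omega
  | iteFalse _ _ _ ih =>
    have := ih hp.2
    simp only [Prog.passCost]
    omega
  | loopDone _ _ => exact hp.elim
  | loopStep _ _ _ _ _ _ => exact hp.elim
  | _ => exact le_rfl

/-- The rule of consequence, with the frame condition. -/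
theorem Runs.conseq {W : ℕ} {p : Prog} {s : State} {Q Q' : State → ℕ → Prop} (h : Runs W p s Q)
    (hQ : ∀ s' k, Unch p s s' → Q s' k → Q' s' k) : Runs W p s Q' := by
  obtain ⟨s', k, he, hq⟩ := h
  exact ⟨s', k, he, hQ _ _ he.unch hq⟩

/-- Without loops every instruction is executed at most once, so the time bound is syntactic and
loop bodies can be verified with time ignored. -/
theorem Runs.timed {W : ℕ} {p : Prog} {s : State} {Q : State → Prop} (hp : p.LoopFree)
    (h : Runs W p s fun s' _ => Q s') : Runs W p s fun s' k => k ≤ p.passCost ∧ Q s' := by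
  obtain ⟨s', k, he, hq⟩ := h
  exact ⟨s', k, he, he.le_passCost hp, hq⟩

/-! ### Counting loops -/

/-- For `i = 0, 1, …`, up to the value of register `l` (exclusive), run `p`. -/
def forLoop (i l : ℕ) (p : Prog) : Prog :=
  .seq (.setN i (.const 0))
    (.loop (.lt (.reg i) (.reg l)) (.seq p (.setN i (.add (.reg i) (.const 1)))))

theorem modN_forLoop {i l x : ℕ} {p : Prog} : (forLoop i l p).ModN x ↔ x = i ∨ p.ModN x := by
  simp only [forLoop, Prog.ModN]
  tauto

theorem modA_forLoop {i l x : ℕ} {p : Prog} : (forLoop i l p).ModA x ↔ p.ModA x := by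
  simp [forLoop, Prog.ModA]

theorem modR_forLoop {i l x : ℕ} {p : Prog} : (forLoop i l p).ModR x ↔ p.ModR x := by
  simp [forLoop, Prog.ModR]

/-- The `8` consists of 4 steps for the test and 4 for the increment of the loop variable; the extra
pass in `L + 1` pays for the initialization and for the last test. Handing `Unch` to the body spares
the invariant `I` all frame conditions. -/
theorem runs_forLoop {W i l : ℕ} {p : Prog} {s : State} (I : ℕ → State → Prop) (t : ℕ) {L : ℕ}
    (hL : s.nreg l = L) (hLW : L ≤ W) (hil : l ≠ i) (hi : ¬ p.ModN i) (hl : ¬ p.ModN l)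
    (h0 : I 0 (s.setReg i 0))
    (hstep : ∀ j s', j < L → s'.nreg i = j → Unch (forLoop i l p) s s' → I j s' →
      Runs W p s' fun s'' k => k ≤ t ∧ I (j + 1) (s''.setReg i (j + 1))) :
    Runs W (forLoop i l p) s fun s' k => k ≤ (L + 1) * (t + 8) ∧ I L s' := by
  have hnl : ¬ (forLoop i l p).ModN l := by
    rw [modN_forLoop]
    tauto
  unfold forLoop
  rw [runs_seq, runs_setN]
  refine ⟨trivial, ?_⟩
  have hu0 : Unch (forLoop i l p) s (s.setReg i 0) := by
    refine ⟨fun x hx => ?_, fun _ _ => rfl, fun _ _ => rfl⟩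
    rw [modN_forLoop] at hx
    simp only [State.nreg_setReg]
    exact if_neg (by tauto)
  have key := runs_loop (W := W) (b := .lt (.reg i) (.reg l))
    (p := .seq p (.setN i (.add (.reg i) (.const 1)))) (s := s.setReg i 0)
    (fun s' e => s'.nreg i ≤ L ∧ Unch (forLoop i l p) s s' ∧ I (s'.nreg i) s' ∧
      e ≤ s'.nreg i * (t + 8)) (fun s' => L - s'.nreg i) (e := 0) ?_ ?_
  · refine key.mono ?_
    rintro s' k ⟨e', ⟨h1, hu, h2, h3⟩, h4, h5⟩
    have h6 : s'.nreg l = L := by rw [hu.nreg l hnl, hL]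
    simp only [BExp.Holds, NExp.eval, h6, not_lt, BExp.cost, NExp.cost] at h4 h5 ⊢
    have h7 : s'.nreg i = L := le_antisymm h1 h4
    rw [h7] at h2 h3
    refine ⟨?_, h2⟩
    rw [add_mul]
    omega
  · rintro s' e ⟨h1, hu, h2, h3⟩
    have h6 : s'.nreg l = L := by rw [hu.nreg l hnl, hL]
    refine ⟨⟨trivial, trivial⟩, fun hb => ?_⟩
    simp only [BExp.Holds, NExp.eval, h6] at hb
    rw [runs_seq]
    refine (hstep _ s' hb rfl hu h2).conseq ?_
    rintro s'' k hu'' ⟨hk, hI⟩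
    have h7 : s''.nreg i = s'.nreg i := hu''.nreg i hi
    rw [runs_setN]
    simp only [NExp.Fits, NExp.eval, NExp.cost, h7, BExp.cost, State.nreg_setReg, if_true, true_and]
    refine ⟨by omega, ⟨by omega, ?_, hI, ?_⟩, by omega⟩
    · refine hu.trans ⟨fun x hx => ?_, fun x hx => ?_, fun x hx => ?_⟩
      · rw [modN_forLoop] at hx
        simp only [State.nreg_setReg]
        rw [if_neg (by tauto), hu''.nreg x (by tauto)]
      · rw [modA_forLoop] at hx
        exact hu''.narr x hx
      · rw [modR_forLoop] at hx
        exact hu''.rarr x hx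
    · rw [add_mul]
      omega
  · simp only [State.nreg_setReg, if_true]
    exact ⟨Nat.zero_le _, hu0, h0, by omega⟩

/-! ### Bounds for words -/

theorem NExp.Fits.mono {W W' : ℕ} (hW : W ≤ W') {s : State} {e : NExp} (h : e.Fits W s) :
    e.Fits W' s := by
  induction e with
  | const | reg => trivial
  | get a e ih => exact ih h
  | add e₁ e₂ ih₁ ih₂ => exact ⟨ih₁ h.1, ih₂ h.2.1, h.2.2.trans hW⟩
  | mul e₁ e₂ ih₁ ih₂ => exact ⟨ih₁ h.1, ih₂ h.2.1, h.2.2.trans hW⟩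
  | sub e₁ e₂ ih₁ ih₂ => exact ⟨ih₁ h.1, ih₂ h.2⟩
  | div e₁ e₂ ih₁ ih₂ => exact ⟨ih₁ h.1, ih₂ h.2⟩
  | mod e₁ e₂ ih₁ ih₂ => exact ⟨ih₁ h.1, ih₂ h.2⟩


/-! ### Subroutines

A program is made into a subroutine by shifting all its registers and arrays by `K`, and by counting
the passes through its loops in a register. -/

/-- The memory with cells below `K` taken from `l` and the cells from `K` on taken from `s`. -/
def State.join (K : ℕ) (l s : State) : State where
  nreg x := if x < K then l.nreg x else s.nreg (x - K)
  narr x := if x < K then l.narr x else s.narr (x - K)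
  rreg x := if x < K then l.rreg x else s.rreg (x - K)
  rarr x := if x < K then l.rarr x else s.rarr (x - K)

/-- The memory from `K` on. -/
def State.drop (K : ℕ) (s : State) : State where
  nreg x := s.nreg (x + K)
  narr x := s.narr (x + K)
  rreg x := s.rreg (x + K)
  rarr x := s.rarr (x + K)

theorem State.join_drop (K : ℕ) (s : State) : s.join K (s.drop K) = s := by
  obtain ⟨f, g, u, v⟩ := s
  simp only [join, drop, State.mk.injEq]
  refine ⟨?_, ?_, ?_, ?_⟩ <;>
  · funext x
    split_ifs with h
    · rfl
    · rw [Nat.sub_add_cancel (not_lt.1 h)]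

namespace NExp

def shift (K : ℕ) : NExp → NExp
  | const k => const k
  | reg x => reg (x + K)
  | get a e => get (a + K) (e.shift K)
  | add e₁ e₂ => add (e₁.shift K) (e₂.shift K)
  | sub e₁ e₂ => sub (e₁.shift K) (e₂.shift K)
  | mul e₁ e₂ => mul (e₁.shift K) (e₂.shift K)
  | div e₁ e₂ => div (e₁.shift K) (e₂.shift K)
  | mod e₁ e₂ => mod (e₁.shift K) (e₂.shift K)

theorem eval_shift (K : ℕ) (l s : State) (e : NExp) : (e.shift K).eval (l.join K s) = e.eval s := by
  induction e <;> simp_all [shift, eval, State.join]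

theorem cost_shift (K : ℕ) (e : NExp) : (e.shift K).cost = e.cost := by
  induction e <;> simp_all [shift, cost]

theorem fits_shift (K : ℕ) {W : ℕ} (l s : State) (e : NExp) :
    (e.shift K).Fits W (l.join K s) ↔ e.Fits W s := by
  induction e <;> simp_all [shift, Fits, eval_shift]

end NExp

namespace RExp

def shift (K : ℕ) : RExp → RExp
  | reg x => reg (x + K)
  | get a e => get (a + K) (e.shift K)
  | add r₁ r₂ => add (r₁.shift K) (r₂.shift K)

theorem eval_shift (K : ℕ) (l s : State) (r : RExp) : (r.shift K).eval (l.join K s) = r.eval s := by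
  induction r with
  | get a e => simp [shift, eval, NExp.eval_shift]; simp [State.join]
  | _ => simp_all [shift, eval, State.join]

theorem cost_shift (K : ℕ) (r : RExp) : (r.shift K).cost = r.cost := by
  induction r <;> simp_all [shift, cost, NExp.cost_shift]

theorem fits_shift (K : ℕ) {W : ℕ} (l s : State) (r : RExp) :
    (r.shift K).Fits W (l.join K s) ↔ r.Fits W s := by
  induction r <;> simp_all [shift, Fits, NExp.fits_shift]

theorem Fits.mono {W W' : ℕ} (hW : W ≤ W') {s : State} {r : RExp} (h : r.Fits W s) :
    r.Fits W' s := by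
  induction r with
  | reg => trivial
  | get a e => exact NExp.Fits.mono hW h
  | add r₁ r₂ ih₁ ih₂ => exact ⟨ih₁ h.1, ih₂ h.2⟩

end RExp

namespace BExp

def shift (K : ℕ) : BExp → BExp
  | eq e₁ e₂ => eq (e₁.shift K) (e₂.shift K)
  | lt e₁ e₂ => lt (e₁.shift K) (e₂.shift K)
  | rle r₁ r₂ => rle (r₁.shift K) (r₂.shift K)
  | not b => not (b.shift K)
  | and b₁ b₂ => and (b₁.shift K) (b₂.shift K)

theorem holds_shift (K : ℕ) (l s : State) (b : BExp) :
    (b.shift K).Holds (l.join K s) ↔ b.Holds s := by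
  induction b <;> simp_all [shift, Holds, NExp.eval_shift, RExp.eval_shift]

theorem cost_shift (K : ℕ) (b : BExp) : (b.shift K).cost = b.cost := by
  induction b <;> simp_all [shift, cost, NExp.cost_shift, RExp.cost_shift]

theorem fits_shift (K : ℕ) {W : ℕ} (l s : State) (b : BExp) :
    (b.shift K).Fits W (l.join K s) ↔ b.Fits W s := by
  induction b <;> simp_all [shift, Fits, NExp.fits_shift, RExp.fits_shift]

theorem Fits.mono {W W' : ℕ} (hW : W ≤ W') {s : State} {b : BExp} (h : b.Fits W s) :
    b.Fits W' s := by
  induction b with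
  | eq e₁ e₂ => exact ⟨NExp.Fits.mono hW h.1, NExp.Fits.mono hW h.2⟩
  | lt e₁ e₂ => exact ⟨NExp.Fits.mono hW h.1, NExp.Fits.mono hW h.2⟩
  | rle e₁ e₂ => exact ⟨RExp.Fits.mono hW h.1, RExp.Fits.mono hW h.2⟩
  | not b ih => exact ih h
  | and b₁ b₂ ih₁ ih₂ => exact ⟨ih₁ h.1, ih₂ h.2⟩

end BExp

namespace Prog

/-- `p`, with all cells shifted by `K`, and with register `T` counting the passes through loops. -/
def counted (K T : ℕ) : Prog → Prog
  | skip => skip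
  | setN x e => setN (x + K) (e.shift K)
  | putN a i e => putN (a + K) (i.shift K) (e.shift K)
  | setR x r => setR (x + K) (r.shift K)
  | putR a i r => putR (a + K) (i.shift K) (r.shift K)
  | seq p q => seq (p.counted K T) (q.counted K T)
  | ite b p q => ite (b.shift K) (p.counted K T) (q.counted K T)
  | loop b p => loop (b.shift K) (seq (setN T (.add (.reg T) (.const 1))) (p.counted K T))

theorem modN_counted {K T : ℕ} {p : Prog} {x : ℕ} (h : (p.counted K T).ModN x) :
    x = T ∨ K ≤ x := by
  induction p with
  | setN y e =>
    simp only [counted, ModN] at h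
    omega
  | seq p q ihp ihq => exact h.elim ihp ihq
  | ite b p q ihp ihq => exact h.elim ihp ihq
  | loop b p ih => exact h.elim .inl ih
  | _ => exact h.elim

theorem modA_counted {K T : ℕ} {p : Prog} {x : ℕ} (h : (p.counted K T).ModA x) : K ≤ x := by
  induction p with
  | putN y e =>
    simp only [counted, ModA] at h
    omega
  | seq p q ihp ihq => exact h.elim ihp ihq
  | ite b p q ihp ihq => exact h.elim ihp ihq
  | loop b p ih => exact h.elim False.elim ih
  | _ => exact h.elim

theorem modR_counted {K T : ℕ} {p : Prog} {x : ℕ} (h : (p.counted K T).ModR x) : K ≤ x := by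
  induction p with
  | putR y e =>
    simp only [counted, ModR] at h
    omega
  | seq p q ihp ihq => exact h.elim ihp ihq
  | ite b p q ihp ihq => exact h.elim ihp ihq
  | loop b p ih => exact h.elim False.elim ih
  | _ => exact h.elim

end Prog

theorem update_join {α : Type} (K x : ℕ) (f g : ℕ → α) (v : α) :
    Function.update (fun y => if y < K then f y else g (y - K)) (x + K) v =
      fun y => if y < K then f y else Function.update g x v (y - K) := by
  funext y
  simp only [Function.update_apply]
  by_cases h : y < K
  · rw [if_neg (by omega), if_pos h, if_pos h]
  · by_cases h' : y = x + K
    · rw [if_pos h', if_neg h, if_pos (by omega)]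
    · rw [if_neg h', if_neg h, if_neg h, if_neg (by omega)]

theorem updArr_join {α : Type} (K a i : ℕ) (f g : ℕ → ℕ → α) (v : α) :
    updArr (fun y => if y < K then f y else g (y - K)) (a + K) i v =
      fun y => if y < K then f y else updArr g a i v (y - K) := by
  simp only [updArr, update_join]
  simp

/-- The counted program simulates the original one, and the counter yields its running time up to a
constant factor. -/
theorem Exec.counted {W W' K T : ℕ} (hT : T < K) (hW : W ≤ W') {p : Prog} {s s' : State} {k : ℕ}
    (h : Exec W p s s' k) : ∀ l : State, l.nreg T + k ≤ W' → 1 ≤ W' →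
      ∃ m k', Exec W' (p.counted K T) (l.join K s)
        ((l.setReg T (l.nreg T + m)).join K s') k' ∧ m ≤ k ∧ k' ≤ p.passCost * (m + 1) := by
  have hset : ∀ l : State, l.setReg T (l.nreg T + 0) = l := fun l => by
    simp [State.setReg]
  induction h with
  | skip s =>
    intro l hl _
    exact ⟨0, 1, by rw [hset]; exact .skip _, by simp, by simp [Prog.passCost]⟩
  | setN s x e he =>
    intro l hl _
    refine ⟨0, e.cost + 1, ?_, by simp, by simp [Prog.passCost]⟩
    rw [hset]
    have := Exec.setN (W := W') (l.join K s) (x + K) (e.shift K)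
      (((NExp.fits_shift ..).2 he).mono hW)
    rw [NExp.eval_shift, NExp.cost_shift] at this
    convert this using 1
    · rfl
    simp only [State.join, update_join]
  | putN s a i e hi he =>
    intro l hl _
    refine ⟨0, i.cost + e.cost + 1, ?_, by simp, by simp [Prog.passCost]⟩
    rw [hset]
    have := Exec.putN (W := W') (l.join K s) (a + K) (i.shift K) (e.shift K)
      (((NExp.fits_shift ..).2 hi).mono hW) (((NExp.fits_shift ..).2 he).mono hW)
    simp only [NExp.eval_shift, NExp.cost_shift] at this
    convert this using 1
    · rfl
    simp only [State.join, updArr_join]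
  | setR s x r hr =>
    intro l hl _
    refine ⟨0, r.cost + 1, ?_, by simp, by simp [Prog.passCost]⟩
    rw [hset]
    have := Exec.setR (W := W') (l.join K s) (x + K) (r.shift K)
      (((RExp.fits_shift ..).2 hr).mono hW)
    rw [RExp.eval_shift, RExp.cost_shift] at this
    convert this using 1
    · rfl
    simp only [State.join, update_join]
  | putR s a i r hi hr =>
    intro l hl _
    refine ⟨0, i.cost + r.cost + 1, ?_, by simp, by simp [Prog.passCost]⟩
    rw [hset]
    have := Exec.putR (W := W') (l.join K s) (a + K) (i.shift K) (r.shift K)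
      (((NExp.fits_shift ..).2 hi).mono hW) (((RExp.fits_shift ..).2 hr).mono hW)
    simp only [NExp.eval_shift, NExp.cost_shift, RExp.eval_shift, RExp.cost_shift] at this
    convert this using 1
    · rfl
    simp only [State.join, updArr_join]
  | @seq s₁ s₂ s₃ p q k₁ k₂ _ _ ihp ihq =>
    intro l hl h1
    obtain ⟨m₁, k₁', e₁, hm₁, hk₁⟩ := ihp l (by omega) h1
    obtain ⟨m₂, k₂', e₂, hm₂, hk₂⟩ := ihq (l.setReg T (l.nreg T + m₁))
      (by simp only [State.nreg_setReg, if_true]; omega) h1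
    refine ⟨m₁ + m₂, k₁' + k₂', .seq e₁ ?_, by omega, ?_⟩
    · convert e₂ using 2
      simp [State.setReg, add_assoc]
    · simp only [Prog.passCost]
      nlinarith [Nat.zero_le (p.passCost * m₂), Nat.zero_le (q.passCost * m₁)]
  | @iteTrue s s' b p q k hb ht _ ih =>
    intro l hl h1
    obtain ⟨m, k', e, hm, hk⟩ := ih l (by omega) h1
    refine ⟨m, b.cost + 1 + k', ?_, by omega, ?_⟩
    · have := Exec.iteTrue (q := q.counted K T) (((BExp.fits_shift K l s b).2 hb).mono hW)
        ((BExp.holds_shift K l s b).2 ht) e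
      rwa [BExp.cost_shift] at this
    · simp only [Prog.passCost]
      nlinarith [Nat.zero_le (q.passCost * (m + 1)), Nat.zero_le ((b.cost + 1) * m)]
  | @iteFalse s s' b p q k hb hf _ ih =>
    intro l hl h1
    obtain ⟨m, k', e, hm, hk⟩ := ih l (by omega) h1
    refine ⟨m, b.cost + 1 + k', ?_, by omega, ?_⟩
    · have := Exec.iteFalse (p := p.counted K T) (((BExp.fits_shift K l s b).2 hb).mono hW)
        (mt (BExp.holds_shift K l s b).1 hf) e
      rwa [BExp.cost_shift] at this
    · simp only [Prog.passCost]
      nlinarith [Nat.zero_le (p.passCost * (m + 1)), Nat.zero_le ((b.cost + 1) * m)]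
  | @loopDone s b p hb hf =>
    intro l hl h1
    refine ⟨0, b.cost + 1, ?_, by omega, ?_⟩
    · rw [hset]
      have := Exec.loopDone (p := .seq (.setN T (.add (.reg T) (.const 1))) (p.counted K T))
        (((BExp.fits_shift K l s b).2 hb).mono hW) (mt (BExp.holds_shift K l s b).1 hf)
      rwa [BExp.cost_shift] at this
    · simp only [Prog.passCost]
      omega
  | @loopStep s₁ s₂ s₃ b p k₁ k₂ hb ht _ _ ihp ihl =>
    intro l hl h1
    obtain ⟨m₁, k₁', e₁, hm₁, hk₁⟩ := ihp (l.setReg T (l.nreg T + 1))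
      (by simp only [State.nreg_setReg, if_true]; omega) h1
    obtain ⟨m₂, k₂', e₂, hm₂, hk₂⟩ := ihl (l.setReg T (l.nreg T + 1 + m₁))
      (by simp only [State.nreg_setReg, if_true]; omega) h1
    have hl' : (l.join K s₁).nreg T = l.nreg T := by simp [State.join, hT]
    -- Incrementing the counter takes 4 steps; together with the 1 for branching on the test this is
    -- the 5 in the `loop` case of `passCost`.
    have e₀ : Exec W' (.setN T (.add (.reg T) (.const 1))) (l.join K s₁)
        ((l.setReg T (l.nreg T + 1)).join K s₁) 4 := by
      have := Exec.setN (W := W') (l.join K s₁) T (.add (.reg T) (.const 1))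
        (by refine ⟨trivial, trivial, ?_⟩; simp only [NExp.eval, hl']; omega)
      simp only [NExp.eval, NExp.cost, hl'] at this
      convert this using 1
      simp only [State.join, State.setReg, State.mk.injEq, and_true]
      funext y
      simp only [Function.update_apply]
      by_cases hy : y = T
      · simp [hy, hT]
      · simp [hy]
    refine ⟨1 + m₁ + m₂, b.cost + 1 + (4 + k₁') + k₂', ?_, by omega, ?_⟩
    · have e₁' : Exec W' (p.counted K T) ((l.setReg T (l.nreg T + 1)).join K s₁)
          ((l.setReg T (l.nreg T + 1 + m₁)).join K s₂) k₁' := by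
        convert e₁ using 2
        simp [State.setReg]
      have e₂' : Exec W' (Prog.counted K T (.loop b p)) ((l.setReg T (l.nreg T + 1 + m₁)).join K s₂)
          ((l.setReg T (l.nreg T + (1 + m₁ + m₂))).join K s₃) k₂' := by
        convert e₂ using 2
        simp [State.setReg, add_assoc]
      have := Exec.loopStep (((BExp.fits_shift K l s₁ b).2 hb).mono hW)
        ((BExp.holds_shift K l s₁ b).2 ht) (Exec.seq e₀ e₁') e₂'
      rwa [BExp.cost_shift] at this
    · simp only [Prog.passCost] at hk₂ ⊢
      nlinarith [Nat.zero_le (b.cost * m₁), Nat.zero_le (p.passCost * m₂)]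


/-! ### Tuples of vertices, coded as numbers in base `n` -/

/-- Digit `i` of `x` in base `n`. -/
def dig (n x i : ℕ) : ℕ := x / n ^ i % n

theorem dig_lt {n : ℕ} (hn : 0 < n) (x i : ℕ) : dig n x i < n := Nat.mod_lt _ hn

theorem dig_add_mul_of_lt {n a y z i : ℕ} (hi : i < a) :
    dig n (y + n ^ a * z) i = dig n y i := by
  rcases Nat.eq_zero_or_pos n with rfl | hn
  · simp [Nat.zero_pow (by omega : 0 < a)]
  unfold dig
  obtain ⟨d, rfl⟩ := Nat.exists_eq_add_of_lt hi
  have : y + n ^ (i + d + 1) * z = y + n ^ i * (n * (n ^ d * z)) := by ring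
  rw [this, Nat.add_mul_div_left _ _ (Nat.pow_pos hn), Nat.add_mul_mod_self_left]

theorem dig_add_mul_add {n a y z i : ℕ} (hy : y < n ^ a) :
    dig n (y + n ^ a * z) (a + i) = dig n z i := by
  unfold dig
  rw [pow_add, ← Nat.div_div_eq_div_mul, Nat.add_mul_div_left _ _ (by omega),
    Nat.div_eq_of_lt hy, zero_add]

theorem dig_add_mul_of_le {n a y z i : ℕ} (hy : y < n ^ a) (hi : a ≤ i) :
    dig n (y + n ^ a * z) i = dig n z (i - a) := by
  obtain ⟨j, rfl⟩ := Nat.exists_eq_add_of_le hi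
  rw [dig_add_mul_add hy, Nat.add_sub_cancel_left]

theorem add_mul_lt_pow {n a b y z : ℕ} (hy : y < n ^ a) (hz : z < n ^ b) :
    y + n ^ a * z < n ^ (a + b) := by
  rw [pow_add]
  calc y + n ^ a * z < n ^ a * (z + 1) := by rw [mul_add]; omega
    _ ≤ n ^ a * n ^ b := Nat.mul_le_mul_left _ hz

/-- Every tuple of vertices has a code. -/
theorem exists_code {n : ℕ} (f : ℕ → ℕ) (hf : ∀ i, f i < n) (k : ℕ) :
    ∃ x < n ^ k, ∀ i < k, dig n x i = f i := by
  induction k with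
  | zero => exact ⟨0, by simp, by simp⟩
  | succ k ih =>
    obtain ⟨x, hx, hd⟩ := ih
    have hlt : f k < n ^ 1 := by simpa using hf k
    refine ⟨x + n ^ k * f k, add_mul_lt_pow hx hlt, fun i hi => ?_⟩
    rcases Nat.lt_succ_iff_lt_or_eq.1 hi with h | rfl
    · rw [dig_add_mul_of_lt h, hd i h]
    · have := dig_add_mul_add (i := 0) (z := f i) hx
      rw [add_zero] at this
      rw [this]
      simp [dig, Nat.mod_eq_of_lt (hf i)]

/-- The total weight of the first `k` digits of `x`. -/
def wt (w : ℕ → ℝ) (n k x : ℕ) : ℝ := ∑ i ∈ Finset.range k, w (dig n x i)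

/-- Additivity over concatenation is used twice: putting one fixed digit in front preserves the
order of a sorted list, and for a fixed outer tuple only the weight of the inner tuple matters. -/
theorem wt_add_mul {w : ℕ → ℝ} {n a b y z : ℕ} (hy : y < n ^ a) :
    wt w n (a + b) (y + n ^ a * z) = wt w n a y + wt w n b z := by
  unfold wt
  rw [Finset.sum_range_add]
  congr 1
  · exact Finset.sum_congr rfl fun i hi => by rw [dig_add_mul_of_lt (Finset.mem_range.1 hi)]
  · exact Finset.sum_congr rfl fun i _ => by rw [dig_add_mul_add hy]

/-- The condition on the pair `(u, v)` of vertices at positions `i` and `j`: they are distinct,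
adjacent if `R i j`, and not adjacent if `N i j`. -/
def Compat (A : ℕ → ℕ) (n : ℕ) (R N : ℕ → ℕ → Prop) (i j u v : ℕ) : Prop :=
  u ≠ v ∧ (R i j → A (u * n + v) = 1) ∧ (N i j → A (u * n + v) ≠ 1)

/-- The tuple coded by `x` satisfies all conditions on pairs of positions in `S`. -/
def Valid (A : ℕ → ℕ) (n : ℕ) (R N : ℕ → ℕ → Prop) (h : ℕ) (S : ℕ → Prop) (x : ℕ) : Prop :=
  ∀ i < h, ∀ j < h, S i → S j → i ≠ j → Compat A n R N i j (dig n x i) (dig n x j)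

theorem Valid.congr {A : ℕ → ℕ} {n : ℕ} {R N : ℕ → ℕ → Prop} {h : ℕ} {S S' : ℕ → Prop} {x y : ℕ}
    (hx : Valid A n R N h S x) (hS : ∀ i < h, S' i → S i)
    (hxy : ∀ i < h, S' i → dig n x i = dig n y i) : Valid A n R N h S' y := by
  intro i hi j hj hSi hSj hij
  rw [← hxy i hi hSi, ← hxy j hj hSj]
  exact hx i hi j hj (hS i hi hSi) (hS j hj hSj) hij

/-! ### Expressions for digits, weights and conditions -/

/-- The `k`-th power of the number in register `0`. -/
def powE : ℕ → NExp
  | 0 => .const 1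
  | k + 1 => .mul (powE k) (.reg 0)

theorem eval_powE (s : State) (k : ℕ) : (powE k).eval s = s.nreg 0 ^ k := by
  induction k with
  | zero => rfl
  | succ k ih => simp [powE, NExp.eval, ih, pow_succ]

theorem fits_powE {W : ℕ} {s : State} {n k : ℕ} (hn : s.nreg 0 = n) (h : (n + 1) ^ k ≤ W) :
    (powE k).Fits W s := by
  induction k with
  | zero => trivial
  | succ k ih =>
    refine ⟨ih (le_trans (Nat.pow_le_pow_right (by omega) (by omega)) h), trivial, ?_⟩
    rw [eval_powE]
    simp only [NExp.eval, hn]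
    rw [← pow_succ]
    exact le_trans (Nat.pow_le_pow_left (by omega) _) h

/-- Digit `i` of the value of `e`. -/
def digE (i : ℕ) (e : NExp) : NExp := .mod (.div e (powE i)) (.reg 0)

theorem eval_digE (s : State) (i : ℕ) (e : NExp) :
    (digE i e).eval s = dig (s.nreg 0) (e.eval s) i := by
  simp [digE, NExp.eval, eval_powE, dig]

theorem fits_digE {W : ℕ} {s : State} {n i : ℕ} {e : NExp} (hn : s.nreg 0 = n)
    (h : (n + 1) ^ i ≤ W) (he : e.Fits W s) : (digE i e).Fits W s :=
  ⟨⟨he, fits_powE hn h⟩, trivial⟩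

/-- The weight of the first `k + 1` digits of the value of `e`. -/
def wtE : ℕ → NExp → RExp
  | 0, e => .get 0 (digE 0 e)
  | k + 1, e => .add (wtE k e) (.get 0 (digE (k + 1) e))

theorem eval_wtE (s : State) (k : ℕ) (e : NExp) :
    (wtE k e).eval s = wt (s.rarr 0) (s.nreg 0) (k + 1) (e.eval s) := by
  induction k with
  | zero => simp [wtE, RExp.eval, eval_digE, wt]
  | succ k ih => simp [wtE, RExp.eval, eval_digE, wt, Finset.sum_range_succ _ (k + 1)] at ih ⊢; exact ih

theorem fits_wtE {W : ℕ} {s : State} {n k : ℕ} {e : NExp} (hn : s.nreg 0 = n)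
    (h : (n + 1) ^ k ≤ W) (he : e.Fits W s) : (wtE k e).Fits W s := by
  induction k with
  | zero => exact fits_digE hn h he
  | succ k ih =>
    exact ⟨ih (le_trans (Nat.pow_le_pow_right (by omega) (by omega)) h), fits_digE hn h he⟩

/-- Conjunction of the tests `f i` for `i < k`. -/
def allB (f : ℕ → BExp) : ℕ → BExp
  | 0 => .eq (.const 0) (.const 0)
  | k + 1 => .and (allB f k) (f k)

theorem holds_allB {s : State} {f : ℕ → BExp} {k : ℕ} :
    (allB f k).Holds s ↔ ∀ i < k, (f i).Holds s := by
  induction k with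
  | zero => simp [allB, BExp.Holds]
  | succ k ih =>
    simp only [allB, BExp.Holds, ih]
    constructor
    · rintro ⟨h1, h2⟩ i hi
      rcases Nat.lt_succ_iff_lt_or_eq.1 hi with h | rfl
      · exact h1 i h
      · exact h2
    · exact fun h => ⟨fun i hi => h i (by omega), h k (by omega)⟩

theorem fits_allB {W : ℕ} {s : State} {f : ℕ → BExp} {k : ℕ} (h : ∀ i < k, (f i).Fits W s) :
    (allB f k).Fits W s := by
  induction k with
  | zero => exact ⟨trivial, trivial⟩
  | succ k ih => exact ⟨ih fun i hi => h i (by omega), h k (by omega)⟩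

open Classical in
/-- `b` if `p` holds, and a test that always succeeds otherwise. -/
noncomputable def onlyIf (p : Prop) (b : BExp) : BExp :=
  if p then b else .eq (.const 0) (.const 0)

theorem holds_onlyIf {s : State} {p : Prop} {b : BExp} :
    (onlyIf p b).Holds s ↔ (p → b.Holds s) := by
  unfold onlyIf
  split_ifs with h
  · simp [h]
  · simp [h, BExp.Holds]

theorem fits_onlyIf {W : ℕ} {s : State} {p : Prop} {b : BExp} (h : b.Fits W s) :
    (onlyIf p b).Fits W s := by
  unfold onlyIf
  split_ifs
  · exact h
  · exact ⟨trivial, trivial⟩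

/-- The entry of the adjacency matrix for the vertices at positions `i` and `j`. -/
def adjE (i j : ℕ) (e : NExp) : NExp :=
  .get 0 (.add (.mul (digE i e) (.reg 0)) (digE j e))

/-- The test for the validity of the tuple coded by the value of `e`. -/
noncomputable def validE (R N : ℕ → ℕ → Prop) (h : ℕ) (S : ℕ → Prop) (e : NExp) : BExp :=
  allB (fun i => allB (fun j => onlyIf (S i ∧ S j ∧ i ≠ j)
    (.and (.not (.eq (digE i e) (digE j e)))
      (.and (onlyIf (R i j) (.eq (adjE i j e) (.const 1)))
        (onlyIf (N i j) (.not (.eq (adjE i j e) (.const 1))))))) h) h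

theorem holds_validE {s : State} {R N : ℕ → ℕ → Prop} {h : ℕ} {S : ℕ → Prop} {e : NExp} :
    (validE R N h S e).Holds s ↔ Valid (s.narr 0) (s.nreg 0) R N h S (e.eval s) := by
  simp only [validE, holds_allB, holds_onlyIf, BExp.Holds, adjE, NExp.eval, eval_digE, Valid, Compat]
  constructor
  · exact fun H i hi j hj h1 h2 h3 => H i hi j hj ⟨h1, h2, h3⟩
  · exact fun H i hi j hj ⟨h1, h2, h3⟩ => H i hi j hj h1 h2 h3

theorem fits_validE {W : ℕ} {s : State} {n : ℕ} {R N : ℕ → ℕ → Prop} {h : ℕ} {S : ℕ → Prop}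
    {e : NExp} (hn : s.nreg 0 = n) (hn0 : 0 < n) (hh : 2 ≤ h) (hW : (n + 1) ^ h ≤ W)
    (he : e.Fits W s) : (validE R N h S e).Fits W s := by
  have hd : ∀ i < h, (digE i e).Fits W s := fun i hi =>
    fits_digE hn (le_trans (Nat.pow_le_pow_right (by omega) hi.le) hW) he
  have hadj : ∀ i < h, ∀ j < h, (adjE i j e).Fits W s := by
    intro i hi j hj
    have h1 : dig n (e.eval s) i < n := dig_lt hn0 _ _
    have h2 : dig n (e.eval s) j < n := dig_lt hn0 _ _
    have h3 : (n + 1) ^ 2 ≤ W := le_trans (Nat.pow_le_pow_right (by omega) hh) hW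
    refine ⟨⟨hd i hi, trivial, ?_⟩, hd j hj, ?_⟩ <;> simp only [NExp.eval, eval_digE, hn] <;>
      nlinarith
  refine fits_allB fun i hi => fits_allB fun j hj => fits_onlyIf ⟨⟨hd i hi, hd j hj⟩, ?_, ?_⟩
  · exact fits_onlyIf ⟨hadj i hi j hj, trivial⟩
  · exact fits_onlyIf ⟨hadj i hi j hj, trivial⟩


/-! ### Sorting tuples by weight -/

/-- `f` lists all numbers below `L`, by decreasing values of `g`. -/
structure SortedList (f : ℕ → ℕ) (g : ℕ → ℝ) (L : ℕ) : Prop where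
  lt : ∀ p < L, f p < L
  cover : ∀ z < L, ∃ p < L, f p = z
  sorted : ∀ p q, p < q → q < L → g (f q) ≤ g (f p)

/-- In-place merging of the list `f 0, …, f (m - 1)` with the list `r 0, …, r (M - 1)` into `f`,
from the right: `f 0, …, f (i - 1)` and `r 0, …, r (j - 1)` have not been merged yet. -/
structure MergeInv (f r : ℕ → ℕ) (g : ℕ → ℝ) (m M i j : ℕ) : Prop where
  hi : i ≤ m
  hj : j ≤ M
  lt : ∀ p < m + M, p < i ∨ i + j ≤ p → f p < m + M
  cover : ∀ z < m + M,
    (∃ p < m + M, (p < i ∨ i + j ≤ p) ∧ f p = z) ∨ ∃ p < j, r p = z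
  sorted : ∀ p q, p < q → q < m + M → (p < i ∨ i + j ≤ p) → (q < i ∨ i + j ≤ q) →
    g (f q) ≤ g (f p)
  le : ∀ p < j, ∀ q < m + M, i + j ≤ q → g (f q) ≤ g (r p)

section merge

variable {f f' r : ℕ → ℕ} {g : ℕ → ℝ} {m M i j : ℕ}

theorem MergeInv.init (hf : SortedList f g m) (hr : ∀ z < M, ∃ p < M, r p = m + z) :
    MergeInv f r g m M m M where
  hi := le_rfl
  hj := le_rfl
  lt p hp h := by
    have := hf.lt p (by omega)
    omega
  cover z hz := by
    by_cases h : z < m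
    · obtain ⟨p, hp, h⟩ := hf.cover z h
      exact .inl ⟨p, by omega, .inl hp, h⟩
    · obtain ⟨p, hp, h⟩ := hr (z - m) (by omega)
      exact .inr ⟨p, hp, by omega⟩
  sorted p q hpq hq _ _ := hf.sorted p q hpq (by omega)
  le p hp q hq h := by omega

/-- Nothing left in the old list is lighter than `r j`, so `r j` belongs in the last free cell,
number `i + j`. It is at least as heavy as all that is already merged by `MergeInv.le`. -/
theorem MergeInv.take_new (h : MergeInv f r g m M i (j + 1))
    (hr : ∀ p < M, r p < m + M) (hrs : ∀ p q, p < q → q < M → g (r q) ≤ g (r p))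
    (hle : i = 0 ∨ g (r j) ≤ g (f (i - 1)))
    (hf : ∀ p, f' p = if p = i + j then r j else f p) : MergeInv f' r g m M i j := by
  have hj := h.hj
  have hi := h.hi
  have hri : ∀ p < i, g (r j) ≤ g (f p) := by
    intro p hp
    rcases Nat.lt_or_ge p (i - 1) with h1 | h1
    · exact (hle.resolve_left (by omega)).trans
        (h.sorted p (i - 1) h1 (by omega) (.inl hp) (.inl (by omega)))
    · obtain rfl : p = i - 1 := by omega
      exact hle.resolve_left (by omega)
  refine ⟨h.hi, by omega, fun p hp h' => ?_, fun z hz => ?_, fun p q hpq hq hp hq' => ?_,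
    fun p hp q hq h' => ?_⟩
  · rw [hf]
    split_ifs with h1
    · exact hr j (by omega)
    · exact h.lt p hp (by omega)
  · rcases h.cover z hz with ⟨p, hp, h1, h2⟩ | ⟨p, hp, h2⟩
    · refine .inl ⟨p, hp, by omega, ?_⟩
      rw [hf, if_neg (by omega), h2]
    · by_cases h3 : p = j
      · refine .inl ⟨i + j, by omega, by omega, ?_⟩
        rw [hf, if_pos rfl, ← h3, h2]
      · exact .inr ⟨p, by omega, h2⟩
  · rw [hf, hf]
    split_ifs with h1 h2 h2
    · omega
    · exact hri p (by omega)
    · exact h.le j (by omega) q hq (by omega)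
    · exact h.sorted p q hpq hq (by omega) (by omega)
  · rw [hf]
    split_ifs with h1
    · exact hrs p j hp (by omega)
    · exact h.le p (by omega) q hq (by omega)

/-- The last old entry weighs at most as much as the last new one, hence as all remaining entries of
either list, and moves to the last free cell. Its old cell joins the gap. -/
theorem MergeInv.take_old (h : MergeInv f r g m M (i + 1) (j + 1))
    (hrs : ∀ p q, p < q → q < M → g (r q) ≤ g (r p)) (hle : g (f i) ≤ g (r j))
    (hf : ∀ p, f' p = if p = i + (j + 1) then f i else f p) : MergeInv f' r g m M i (j + 1) := by
  have hj := h.hj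
  have hi := h.hi
  refine ⟨by omega, h.hj, fun p hp h' => ?_, fun z hz => ?_, fun p q hpq hq hp hq' => ?_,
    fun p hp q hq h' => ?_⟩
  · rw [hf]
    split_ifs with h1
    · exact h.lt i (by omega) (by omega)
    · exact h.lt p hp (by omega)
  · rcases h.cover z hz with ⟨p, hp, h1, h2⟩ | ⟨p, hp, h2⟩
    · by_cases h3 : p = i
      · refine .inl ⟨i + (j + 1), by omega, by omega, ?_⟩
        rw [hf, if_pos rfl, ← h3, h2]
      · refine .inl ⟨p, hp, by omega, ?_⟩
        rw [hf, if_neg (by omega), h2]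
    · exact .inr ⟨p, by omega, h2⟩
  · rw [hf, hf]
    split_ifs with h1 h2 h2
    · omega
    · exact h.sorted p i (by omega) (by omega) (by omega) (by omega)
    · exact h.sorted i q (by omega) hq (by omega) (by omega)
    · exact h.sorted p q hpq hq (by omega) (by omega)
  · have hrp : g (r j) ≤ g (r p) := by
      rcases Nat.lt_or_ge p j with h1 | h1
      · exact hrs p j h1 (by omega)
      · rw [show p = j by omega]
    rw [hf]
    split_ifs with h1
    · exact hle.trans hrp
    · exact h.le p hp q hq (by omega)

/-- Once the new list is used up the gap is empty, and the remaining old entries already stand in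
their final cells. -/
theorem MergeInv.done (h : MergeInv f r g m M i 0) : SortedList f g (m + M) where
  lt p hp := h.lt p hp (by omega)
  cover z hz := by
    rcases h.cover z hz with ⟨p, hp, h1, h2⟩ | ⟨p, hp, _⟩
    · exact ⟨p, hp, h2⟩
    · omega
  sorted p q hpq hq := h.sorted p q hpq hq (by omega) (by omega)

end merge

/-- One step of merging, for codes with `k + 1` digits; array `a` lists the codes with `k` digits, the
digit in register `1` is put in front of them, and the result goes into array `a'`. -/
def mergeStep (k a a' : ℕ) : Prog :=
  .seq (.setN 5 (.add (.get a (.sub (.reg 3) (.const 1))) (.mul (powE k) (.reg 1))))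
    (.ite (.and (.lt (.const 0) (.reg 2))
        (.not (.rle (wtE k (.reg 5)) (wtE k (.get a' (.sub (.reg 2) (.const 1)))))))
      (.seq (.putN a' (.sub (.add (.reg 2) (.reg 3)) (.const 1)) (.get a' (.sub (.reg 2) (.const 1))))
        (.setN 2 (.sub (.reg 2) (.const 1))))
      (.seq (.putN a' (.sub (.add (.reg 2) (.reg 3)) (.const 1)) (.reg 5))
        (.setN 3 (.sub (.reg 3) (.const 1)))))

def mergeRun (k a a' : ℕ) : Prog :=
  .seq (.setN 2 (.mul (powE k) (.reg 1)))
    (.seq (.setN 3 (powE k)) (.loop (.lt (.const 0) (.reg 3)) (mergeStep k a a')))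

/-- The codes with leading digit `x` are those with `k` digits shifted by `n ^ k * x`, in the same
order by weight, so they form a sorted list that is merged with the codes of smaller leading digit.
-/
theorem runs_mergeRun {k a a' : ℕ} (ha : a ≠ a') {W n x : ℕ} {s : State} (hn : s.nreg 0 = n)
    (hW : (n + 1) ^ (k + 1) ≤ W) (hx : s.nreg 1 = x) (hxn : x < n)
    (hsrc : SortedList (s.narr a) (wt (s.rarr 0) n k) (n ^ k))
    (hdst : SortedList (s.narr a') (wt (s.rarr 0) n (k + 1)) (n ^ k * x)) :
    Runs W (mergeRun k a a') s fun s' t => t ≤ (n ^ (k + 1) + 1) * ((mergeRun k a a').passCost + 10) ∧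
      SortedList (s'.narr a') (wt (s.rarr 0) n (k + 1)) (n ^ k * (x + 1)) := by
  set M := n ^ k with hM
  set w := s.rarr 0 with hw
  set r : ℕ → ℕ := fun p => s.narr a p + M * x with hr
  set c := (mergeStep k a a').passCost + 4 with hc
  have hMx : M * (x + 1) ≤ n ^ (k + 1) := by
    rw [pow_succ]
    exact Nat.mul_le_mul_left _ hxn
  have hnW : n ^ (k + 1) ≤ W := le_trans (Nat.pow_le_pow_left (by omega) _) hW
  have hMx' : M * (x + 1) = M * x + M := by ring
  have hk1 : (n + 1) ^ k ≤ W := le_trans (Nat.pow_le_pow_right (by omega) (by omega)) hW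
  have hrlt : ∀ p < M, r p < M * x + M := fun p hp => by
    have := hsrc.lt p hp
    simp only [hr]
    omega
  have hn1 : 0 < n := by omega
  have hrw : ∀ p < M, wt w n (k + 1) (r p) = wt w n k (s.narr a p) + w x := by
    intro p hp
    have h1 := wt_add_mul (w := w) (b := 1) (z := x) (hsrc.lt p hp)
    simp only [hr]
    rw [h1]
    simp [wt, dig, Nat.mod_eq_of_lt hxn]
  have hrs : ∀ p q, p < q → q < M → wt w n (k + 1) (r q) ≤ wt w n (k + 1) (r p) := by
    intro p q hpq hq
    rw [hrw p (by omega), hrw q hq]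
    have := hsrc.sorted p q hpq hq
    linarith
  unfold mergeRun
  simp only [runs_seq, runs_setN, NExp.Fits, NExp.eval, eval_powE, hn, hx, State.nreg_setReg,
    fits_powE hn hk1, true_and, OfNat.zero_ne_ofNat, if_false, ← hM]
  refine ⟨by omega, fits_powE (by simpa using hn) hk1, ?_⟩
  have key := runs_loop (W := W) (b := .lt (.const 0) (.reg 3)) (p := mergeStep k a a')
    (s := (s.setReg 2 (M * x)).setReg 3 M)
    -- Amortized time: every step decreases the total number of unmerged entries by one and costs at
    -- most `c`.
    (fun s' e => Unch (mergeRun k a a') s s' ∧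
      MergeInv (s'.narr a') r (wt w n (k + 1)) (M * x) M (s'.nreg 2) (s'.nreg 3) ∧
      e + (s'.nreg 2 + s'.nreg 3) * c ≤ (M * x + M) * c)
    (fun s' => s'.nreg 2 + s'.nreg 3) (e := 0) ?_ ?_
  · refine key.mono ?_
    rintro s' t ⟨e', ⟨hu, hinv, he⟩, hb, ht⟩
    simp only [BExp.Holds, NExp.eval, not_lt, Nat.le_zero, BExp.cost, NExp.cost] at hb ht ⊢
    rw [hb] at hinv
    refine ⟨?_, hMx' ▸ hinv.done⟩
    have h1 : (M * x + M) * c ≤ n ^ (k + 1) * c := Nat.mul_le_mul_right _ (by omega)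
    simp only [Prog.passCost, NExp.cost, BExp.cost]
    set u := (powE k).cost
    have h2 : n ^ (k + 1) * c ≤ n ^ (k + 1) * (u + 1 + 1 + 1 + (u + 1 + (1 + 1 + 1 + 5 + (mergeStep k a a').passCost)) + 10) :=
      Nat.mul_le_mul_left _ (by omega)
    rw [add_mul, one_mul]
    omega
  · rintro s' e ⟨hu, hinv, he⟩
    refine ⟨⟨trivial, trivial⟩, fun hb => ?_⟩
    simp only [BExp.Holds, NExp.eval] at hb
    have hu0 : s'.nreg 0 = n := by
      rw [hu.nreg 0 (by simp [mergeRun, mergeStep, Prog.ModN]), hn]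
    have hu1 : s'.nreg 1 = x := by
      rw [hu.nreg 1 (by simp [mergeRun, mergeStep, Prog.ModN]), hx]
    have hua : s'.narr a = s.narr a := hu.narr a (by simp [mergeRun, mergeStep, Prog.ModA, ha])
    have huw : s'.rarr 0 = w := hu.rarr 0 (by simp [mergeRun, mergeStep, Prog.ModR])
    have hj := hinv.hj
    have hi := hinv.hi
    have hlf : (mergeStep k a a').LoopFree := by simp [mergeStep, Prog.LoopFree]
    obtain ⟨j, hj1⟩ : ∃ j, s'.nreg 3 = j + 1 := ⟨s'.nreg 3 - 1, by omega⟩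
    have hrj := hrlt j (by omega)
    simp only [hr] at hrj
    refine (Runs.timed (Q := fun s'' =>
      MergeInv (s''.narr a') r (wt w n (k + 1)) (M * x) M (s''.nreg 2) (s''.nreg 3) ∧
      s''.nreg 2 + s''.nreg 3 + 1 = s'.nreg 2 + s'.nreg 3) hlf ?_).conseq ?_
    · unfold mergeStep
      simp only [runs_seq, runs_setN, runs_ite, runs_putN, NExp.Fits, NExp.eval, eval_powE, hu0, hu1,
        hua, State.nreg_setReg, BExp.Fits, BExp.Holds, eval_wtE, State.rarr_setReg,
        true_and, and_true, State.narr_setReg, State.nreg_setCell, ← hM, huw,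
        if_true, OfNat.zero_ne_ofNat, if_false, Nat.reduceEqDiff]
      simp only [hj1, Nat.add_sub_cancel]
      refine ⟨⟨⟨fits_powE hu0 hk1, by omega⟩, by omega⟩, ⟨fits_wtE (by simpa using hu0) hk1 trivial,
        fits_wtE (by simpa using hu0) hk1 ⟨trivial, trivial⟩⟩, ?_, ?_⟩
      · rintro ⟨h1, h2⟩
        obtain ⟨i, hi1⟩ : ∃ i, s'.nreg 2 = i + 1 := ⟨s'.nreg 2 - 1, by omega⟩
        simp only [hi1, Nat.add_sub_cancel] at h2 hinv ⊢
        rw [hj1] at hinv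
        refine ⟨by omega, hinv.take_old hrs (not_le.1 h2).le fun p => ?_, by omega⟩
        rw [State.narr_setCell, State.narr_setReg, show i + 1 + (j + 1) - 1 = i + (j + 1) by omega]
        simp
      · intro h1
        rw [hj1] at hinv
        refine ⟨by omega, hinv.take_new hrlt hrs ?_ fun p => ?_, by omega⟩
        · rw [not_and_or, not_not] at h1
          refine h1.imp (by omega) id
        · rw [State.narr_setCell, State.narr_setReg,
            show s'.nreg 2 + (j + 1) - 1 = s'.nreg 2 + j by omega]
          simp [hr]
    · rintro s'' t hu'' ⟨ht, hinv', hs⟩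
      refine ⟨⟨hu.trans (hu''.mono ?_ ?_ ?_), hinv', ?_⟩, by omega⟩
      · exact fun y hy => .inr (.inr hy)
      · exact fun y hy => .inr (.inr hy)
      · exact fun y hy => .inr (.inr hy)
      · simp only [BExp.cost, NExp.cost]
        have : (s'.nreg 2 + s'.nreg 3) * c = (s''.nreg 2 + s''.nreg 3) * c + c := by
          rw [← hs]
          ring
        omega
  · refine ⟨⟨fun y hy => ?_, fun _ _ => rfl, fun _ _ => rfl⟩, ?_, ?_⟩
    · simp only [mergeRun, mergeStep, Prog.ModN] at hy
      simp only [State.nreg_setReg]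
      rw [if_neg (by tauto), if_neg (by tauto)]
    · refine MergeInv.init hdst fun z hz => ?_
      obtain ⟨p, hp, h⟩ := hsrc.cover z hz
      exact ⟨p, hp, by simp only [hr, h]; omega⟩
    · simp

theorem modN_mergeRun {k a a' x : ℕ} :
    (mergeRun k a a').ModN x ↔ x = 2 ∨ x = 3 ∨ x = 5 := by
  simp only [mergeRun, mergeStep, Prog.ModN]
  tauto

theorem modA_mergeRun {k a a' x : ℕ} : (mergeRun k a a').ModA x ↔ x = a' := by
  simp [mergeRun, mergeStep, Prog.ModA]

theorem modR_mergeRun {k a a' x : ℕ} : ¬ (mergeRun k a a').ModR x := by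
  simp [mergeRun, mergeStep, Prog.ModR]

/-- List all codes with `k` digits in array `10 + k`, by decreasing weight. -/
def sortProg : ℕ → Prog
  | 0 => .putN 10 (.const 0) (.const 0)
  | k + 1 => .seq (sortProg k) (forLoop 1 0 (mergeRun k (10 + k) (10 + (k + 1))))

theorem modN_sortProg {k x : ℕ} (h : (sortProg k).ModN x) : x = 1 ∨ x = 2 ∨ x = 3 ∨ x = 5 := by
  induction k with
  | zero => exact h.elim
  | succ k ih =>
    rcases h with h | h
    · exact ih h
    · rwa [modN_forLoop, modN_mergeRun] at h

theorem modA_sortProg {k x : ℕ} (h : (sortProg k).ModA x) : 10 ≤ x := by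
  induction k with
  | zero => exact Eq.ge h
  | succ k ih =>
    rcases h with h | h
    · exact ih h
    · rw [modA_forLoop, modA_mergeRun] at h
      omega

theorem modR_sortProg {k x : ℕ} : ¬ (sortProg k).ModR x := by
  induction k with
  | zero => exact id
  | succ k ih =>
    rintro (h | h)
    · exact ih h
    · rw [modR_forLoop] at h
      exact modR_mergeRun h

/-- Each further digit requires `n` merges of linear time. This costs `n ^ (b + 1)` in total, a
bound without logarithms that stays below the time for the products. -/
theorem runs_sortProg (b : ℕ) : ∃ C : ℕ, ∀ {W n : ℕ} {s : State}, s.nreg 0 = n →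
    (n + 1) ^ (b + 1) ≤ W → Runs W (sortProg b) s fun s' t => t ≤ C * (n + 1) ^ (b + 1) ∧
      SortedList (s'.narr (10 + b)) (wt (s.rarr 0) n b) (n ^ b) := by
  induction b with
  | zero =>
    refine ⟨3, fun {W n s} hn hW => ?_⟩
    simp only [sortProg, runs_putN, NExp.Fits, NExp.eval, NExp.cost, true_and]
    refine ⟨by simp, ⟨fun p hp => ?_, fun z hz => ⟨0, by simp, ?_⟩, fun p q hpq hq => ?_⟩⟩
    · simp at hp
      simp [hp]
    · simp at hz
      simp [hz]
    · simp at hq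
      omega
  | succ b ih =>
    obtain ⟨C, ih⟩ := ih
    refine ⟨C + (2 * ((mergeRun b (10 + b) (10 + (b + 1))).passCost + 10) + 8),
      fun {W n s} hn hW => ?_⟩
    have hW' : (n + 1) ^ (b + 1) ≤ W := le_trans (Nat.pow_le_pow_right (by omega) (by omega)) hW
    have hnW : n ≤ W := by
      have : (n + 1) ^ 1 ≤ (n + 1) ^ (b + 1) := Nat.pow_le_pow_right (by omega) (by omega)
      rw [pow_one] at this
      omega
    rw [sortProg, runs_seq]
    refine (ih hn hW').conseq ?_
    rintro s₁ t₁ hu₁ ⟨ht₁, hs₁⟩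
    have hn₁ : s₁.nreg 0 = n := by
      rw [hu₁.nreg 0 fun h => by simpa using modN_sortProg h, hn]
    have hr₁ : s₁.rarr 0 = s.rarr 0 := hu₁.rarr 0 modR_sortProg
    refine (runs_forLoop
      (fun x s' => SortedList (s'.narr (10 + (b + 1))) (wt (s.rarr 0) n (b + 1)) (n ^ b * x))
      ((n ^ (b + 1) + 1) * ((mergeRun b (10 + b) (10 + (b + 1))).passCost + 10))
      hn₁ hnW (by omega) ?_ ?_ ?_ ?_).mono ?_
    · simp [modN_mergeRun]
    · simp [modN_mergeRun]
    · simp only [mul_zero]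
      exact ⟨by omega, by omega, by omega⟩
    · intro x s₂ hx hx₂ hu₂ hs₂
      have hn₂ : s₂.nreg 0 = n := by
        rw [hu₂.nreg 0 (by simp [modN_forLoop, modN_mergeRun]), hn₁]
      have ha₂ : s₂.narr (10 + b) = s₁.narr (10 + b) := hu₂.narr _ (by
        rw [modA_forLoop, modA_mergeRun]
        omega)
      have hr₂ : s₂.rarr 0 = s.rarr 0 := by
        rw [hu₂.rarr 0 (by rw [modR_forLoop]; exact modR_mergeRun), hr₁]
      have := runs_mergeRun (k := b) (a := 10 + b) (a' := 10 + (b + 1)) (by omega) hn₂ hW' hx₂ hx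
        (by rwa [hr₂, ha₂]) (by rwa [hr₂])
      rw [hr₂] at this
      exact this
    · rintro s₂ t₂ ⟨ht₂, hs₂⟩
      refine ⟨?_, by rwa [pow_succ]⟩
      set c := (mergeRun b (10 + b) (10 + (b + 1))).passCost + 10
      have h1 : n ^ (b + 1) + 1 ≤ 2 * (n + 1) ^ (b + 1) := by
        have : n ^ (b + 1) ≤ (n + 1) ^ (b + 1) := Nat.pow_le_pow_left (by omega) _
        have : 1 ≤ (n + 1) ^ (b + 1) := Nat.one_le_pow _ _ (by omega)
        omega
      have h3 : 1 ≤ (n + 1) ^ (b + 1) := Nat.one_le_pow _ _ (by omega)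
      have h2 : (n + 1) ^ (b + 1 + 1) = (n + 1) * (n + 1) ^ (b + 1) := by ring
      rw [h2]
      set m := (n + 1) ^ (b + 1)
      have h4 : (n ^ (b + 1) + 1) * c + 8 ≤ m * (2 * c + 8) := by nlinarith
      calc t₁ + t₂ ≤ C * m + (n + 1) * (m * (2 * c + 8)) :=
            add_le_add ht₁ (ht₂.trans (Nat.mul_le_mul_left _ h4))
        _ ≤ (C + (2 * c + 8)) * ((n + 1) * m) := by nlinarith [Nat.zero_le (C * (n * m))]


/-! ### The table of best solutions

Word array `1` holds a flag for every slot, and word array `2` holds the `h` vertices of the best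
placement found so far for that slot. -/

/-- How tuples of vertices are entered into the table: vertex `i` of `H` is at position `σ i` of the
tuple, `R` and `N` are the pairs of positions that have to be adjacent and not adjacent, and the
tuple whose code is in register `6` goes into the given slots. -/
structure Task where
  h : ℕ
  σ : ℕ → ℕ
  R : ℕ → ℕ → Prop
  N : ℕ → ℕ → Prop
  slots : List NExp

/-- The task is consistent: a valid tuple satisfies the predicate `P` that belongs to the slots,
of which there are `m`, and the slots are computed correctly. -/
structure Task.Correct (K : Task) (W n m : ℕ) (A : ℕ → ℕ) (P : ℕ → (ℕ → ℕ) → Prop)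
    (slot : NExp → ℕ → ℕ) : Prop where
  two_le : 2 ≤ K.h
  sum : ∀ g : ℕ → ℝ, ∑ i ∈ Finset.range K.h, g (K.σ i) = ∑ i ∈ Finset.range K.h, g i
  lt : ∀ i < K.h, K.σ i < K.h
  congr : ∀ I f g, (∀ i < K.h, f i = g i) → P I f → P I g
  word : m * K.h ≤ W
  pow : (n + 1) ^ K.h ≤ W
  eval : ∀ e ∈ K.slots, ∀ x s, x < n ^ K.h → s.nreg 0 = n → s.nreg 6 = x →
    e.Fits W s ∧ e.eval s = slot e x
  mem : ∀ e ∈ K.slots, ∀ x < n ^ K.h, Valid A n K.R K.N K.h (fun _ => True) x →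
    slot e x < m ∧ P (slot e x) (fun i => dig n x (K.σ i))

/-- All entries of the table are correct solutions. -/
def TableInv (h m : ℕ) (P : ℕ → (ℕ → ℕ) → Prop) (s : State) : Prop :=
  ∀ I < m, s.narr 1 I = 0 ∨ s.narr 1 I = 1 ∧ P I fun i => s.narr 2 (I * h + i)

/-- The table has an entry of weight at least `v` in slot `I`. -/
def Beats (h : ℕ) (w : ℕ → ℝ) (s : State) (I : ℕ) (v : ℝ) : Prop :=
  s.narr 1 I = 1 ∧ v ≤ ∑ i ∈ Finset.range h, w (s.narr 2 (I * h + i))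

theorem Beats.congr {h : ℕ} {w : ℕ → ℝ} {s s' : State} {I : ℕ} {v : ℝ} (hb : Beats h w s I v)
    (h1 : s'.narr 1 = s.narr 1) (h2 : s'.narr 2 = s.narr 2) : Beats h w s' I v := by
  unfold Beats at *
  rwa [h1, h2]

theorem TableInv.congr {h m : ℕ} {P : ℕ → (ℕ → ℕ) → Prop} {s s' : State} (ht : TableInv h m P s)
    (h1 : s'.narr 1 = s.narr 1) (h2 : s'.narr 2 = s.narr 2) : TableInv h m P s' := by
  unfold TableInv at *
  rwa [h1, h2]

/-- Address of the `i`-th vertex in the slot given by register `7`. -/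
def cellE (h i : ℕ) : NExp := .add (.mul (.reg 7) (.const h)) (.const i)

/-- Weight of the first `k + 1` vertices in the slot given by register `7`. -/
def entryE (h : ℕ) : ℕ → RExp
  | 0 => .get 0 (.get 2 (cellE h 0))
  | k + 1 => .add (entryE h k) (.get 0 (.get 2 (cellE h (k + 1))))

theorem eval_entryE (s : State) (h k : ℕ) : (entryE h k).eval s =
    ∑ i ∈ Finset.range (k + 1), s.rarr 0 (s.narr 2 (s.nreg 7 * h + i)) := by
  induction k with
  | zero => simp [entryE, RExp.eval, NExp.eval, cellE]
  | succ k ih =>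
    rw [entryE, RExp.eval, ih, Finset.sum_range_succ _ (k + 1)]
    rfl

theorem fits_cellE {W h i m : ℕ} {s : State} (hI : s.nreg 7 < m) (hi : i < h) (hW : m * h ≤ W) :
    (cellE h i).Fits W s := by
  have h1 : (s.nreg 7 + 1) * h ≤ m * h := Nat.mul_le_mul_right _ hI
  rw [add_mul, one_mul] at h1
  refine ⟨⟨trivial, trivial, ?_⟩, trivial, ?_⟩ <;> simp only [NExp.eval] <;> omega

theorem fits_entryE {W h k m : ℕ} {s : State} (hI : s.nreg 7 < m) (hk : k < h) (hW : m * h ≤ W) :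
    (entryE h k).Fits W s := by
  induction k with
  | zero => exact fits_cellE hI hk hW
  | succ k ih => exact ⟨ih (by omega), fits_cellE hI hk hW⟩

/-- Write the first `k` vertices of the tuple into the slot. -/
def writeEntry (h : ℕ) (σ : ℕ → ℕ) : ℕ → Prog
  | 0 => .skip
  | k + 1 => .seq (writeEntry h σ k) (.putN 2 (cellE h k) (digE (σ k) (.reg 6)))

theorem loopFree_writeEntry {h k : ℕ} {σ : ℕ → ℕ} : (writeEntry h σ k).LoopFree := by
  induction k with
  | zero => trivial
  | succ k ih => exact ⟨ih, trivial⟩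

theorem modN_writeEntry {h k x : ℕ} {σ : ℕ → ℕ} : ¬ (writeEntry h σ k).ModN x := by
  induction k with
  | zero => exact id
  | succ k ih => simpa [writeEntry, Prog.ModN] using ih

theorem modA_writeEntry {h k x : ℕ} {σ : ℕ → ℕ} (hx : (writeEntry h σ k).ModA x) : x = 2 := by
  induction k with
  | zero => exact hx.elim
  | succ k ih => exact hx.elim ih id

theorem modR_writeEntry {h k x : ℕ} {σ : ℕ → ℕ} : ¬ (writeEntry h σ k).ModR x := by
  induction k with
  | zero => exact id
  | succ k ih => simpa [writeEntry, Prog.ModR] using ih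

theorem runs_writeEntry {h k W n m : ℕ} {σ : ℕ → ℕ} {s : State} (hn : s.nreg 0 = n)
    (hI : s.nreg 7 < m) (hk : k ≤ h) (hW : m * h ≤ W) (hp : (n + 1) ^ h ≤ W)
    (hσ : ∀ i < h, σ i < h) :
    Runs W (writeEntry h σ k) s fun s' _ =>
      (∀ i < k, s'.narr 2 (s.nreg 7 * h + i) = dig n (s.nreg 6) (σ i)) ∧
      ∀ J i, J ≠ s.nreg 7 → i < h → s'.narr 2 (J * h + i) = s.narr 2 (J * h + i) := by
  induction k with
  | zero => exact runs_skip.2 ⟨by simp, by simp⟩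
  | succ k ih =>
    rw [writeEntry, runs_seq]
    refine (ih (by omega)).conseq ?_
    rintro s₁ t₁ hu₁ ⟨h1, h2⟩
    have hn₁ : s₁.nreg 0 = n := by rw [hu₁.nreg 0 modN_writeEntry, hn]
    have h6 : s₁.nreg 6 = s.nreg 6 := hu₁.nreg 6 modN_writeEntry
    have h7 : s₁.nreg 7 = s.nreg 7 := hu₁.nreg 7 modN_writeEntry
    rw [runs_putN]
    refine ⟨fits_cellE (by rwa [h7]) (by omega) hW, fits_digE hn₁
      (le_trans (Nat.pow_le_pow_right (by omega) (hσ k (by omega)).le) hp) trivial, ?_, ?_⟩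
    · intro i hi
      simp only [State.narr_setCell, cellE, NExp.eval, eval_digE, h6, h7, hn₁, true_and]
      by_cases hik : i = k
      · rw [if_pos (by rw [hik]), hik]
      · rw [if_neg (by omega), h1 i (by omega)]
    · intro J i hJ hi
      simp only [State.narr_setCell, cellE, NExp.eval, h7, true_and]
      rw [if_neg, h2 J i hJ hi]
      -- Distinct slots occupy disjoint intervals of length `h`: dividing the address by `h`
      -- recovers the slot.
      intro he
      apply hJ
      have h3 := congrArg (· / h) he
      simpa [Nat.mul_add_div, Nat.add_div_of_dvd_right, Nat.mul_comm _ h,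
        Nat.mul_add_div (by omega : 0 < h), Nat.div_eq_of_lt hi,
        Nat.div_eq_of_lt (by omega : k < h)] using h3

/-- Enter the tuple with code in register `6` into the slot given by `e`, if it is better. -/
def updateSlot (K : Task) (e : NExp) : Prog :=
  .seq (.setN 7 e)
    (.ite (.and (.eq (.get 1 (.reg 7)) (.const 1))
        (.rle (wtE (K.h - 1) (.reg 6)) (entryE K.h (K.h - 1))))
      .skip
      (.seq (.putN 1 (.reg 7) (.const 1)) (writeEntry K.h K.σ K.h)))

theorem modN_updateSlot {K : Task} {e : NExp} {x : ℕ} :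
    (updateSlot K e).ModN x ↔ x = 7 := by
  simp [updateSlot, Prog.ModN, modN_writeEntry]

theorem modA_updateSlot {K : Task} {e : NExp} {x : ℕ} (h : (updateSlot K e).ModA x) :
    x = 1 ∨ x = 2 := by
  simp only [updateSlot, Prog.ModA, false_or] at h
  exact h.imp id modA_writeEntry

theorem modR_updateSlot {K : Task} {e : NExp} {x : ℕ} : ¬ (updateSlot K e).ModR x := by
  simp [updateSlot, Prog.ModR, modR_writeEntry]

theorem loopFree_updateSlot {K : Task} {e : NExp} : (updateSlot K e).LoopFree := by
  simp [updateSlot, Prog.LoopFree, loopFree_writeEntry]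

section update

variable {K : Task} {W n m : ℕ} {A : ℕ → ℕ} {P : ℕ → (ℕ → ℕ) → Prop} {slot : NExp → ℕ → ℕ}
  {w : ℕ → ℝ}

theorem runs_updateSlot (hK : K.Correct W n m A P slot) {s : State} {x : ℕ} {e : NExp}
    (he : e ∈ K.slots) (hn : s.nreg 0 = n) (h6 : s.nreg 6 = x) (hx : x < n ^ K.h)
    (hv : Valid A n K.R K.N K.h (fun _ => True) x) (hw : s.rarr 0 = w)
    (ht : TableInv K.h m P s) :
    Runs W (updateSlot K e) s fun s' _ => TableInv K.h m P s' ∧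
      (∀ J v, Beats K.h w s J v → Beats K.h w s' J v) ∧
      Beats K.h w s' (slot e x) (wt w n K.h x) := by
  obtain ⟨hef, hev⟩ := hK.eval e he x s hx hn h6
  obtain ⟨hI, hP⟩ := hK.mem e he x hx hv
  have h2 := hK.two_le
  have hp1 : (n + 1) ^ (K.h - 1) ≤ W :=
    le_trans (Nat.pow_le_pow_right (by omega) (by omega)) hK.pow
  have hk1 : K.h - 1 + 1 = K.h := by omega
  rw [updateSlot, runs_seq, runs_setN, hev]
  refine ⟨hef, ?_⟩
  rw [runs_ite]
  have hn₁ : (s.setReg 7 (slot e x)).nreg 0 = n := by simpa using hn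
  have h7 : (s.setReg 7 (slot e x)).nreg 7 = slot e x := by simp
  have h61 : (s.setReg 7 (slot e x)).nreg 6 = x := by simpa using h6
  set s₁ := s.setReg 7 (slot e x) with hs₁
  have ha1 : s₁.narr 1 = s.narr 1 := rfl
  have ha2 : s₁.narr 2 = s.narr 2 := rfl
  have hr : s₁.rarr 0 = w := hw
  clear_value s₁
  refine ⟨⟨⟨trivial, trivial⟩, fits_wtE hn₁ hp1 trivial,
    fits_entryE (by rwa [h7]) (by omega) hK.word⟩, ?_, ?_⟩
  · intro hb
    simp only [BExp.Holds, NExp.eval, eval_wtE, eval_entryE, h7, h61, hr, hn₁, hk1] at hb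
    exact runs_skip.2 ⟨ht.congr ha1 ha2, fun J v hJ => hJ.congr ha1 ha2, hb⟩
  · intro hb
    simp only [BExp.Holds, NExp.eval, eval_wtE, eval_entryE, h7, h61, hr, hn₁, hk1] at hb
    rw [runs_seq, runs_putN]
    refine ⟨trivial, trivial, ?_⟩
    refine (runs_writeEntry (k := K.h) (m := m) (by simpa using hn₁)
      (by simpa [NExp.eval, h7] using hI) le_rfl hK.word hK.pow hK.lt).conseq ?_
    simp only [NExp.eval, h7, State.nreg_setCell, h61]
    rintro s₂ t₂ hu₂ ⟨h3, h4⟩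
    have hf : ∀ J, s₂.narr 1 J = if J = slot e x then 1 else s.narr 1 J := by
      intro J
      rw [hu₂.narr 1 fun h => by simpa using modA_writeEntry h]
      simp [ha1]
    have hsame : ∀ J ≠ slot e x, ∀ i < K.h, s₂.narr 2 (J * K.h + i) = s.narr 2 (J * K.h + i) := by
      intro J hJ i hi
      rw [h4 J i hJ hi]
      simp [ha2]
    have hbest : Beats K.h w s₂ (slot e x) (wt w n K.h x) := by
      refine ⟨by simp [hf], le_of_eq ?_⟩
      rw [Finset.sum_congr rfl fun i hi => by rw [h3 i (Finset.mem_range.1 hi)],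
        hK.sum fun i => w (dig n x i)]
      rfl
    refine ⟨fun J hJ => ?_, fun J v hJ => ?_, hbest⟩
    · by_cases hJe : J = slot e x
      · refine .inr ⟨by simp [hf, hJe], hK.congr _ _ _ (fun i hi => ?_) (hJe ▸ hP)⟩
        rw [hJe, h3 i hi]
      · rw [hf, if_neg hJe]
        refine (ht J hJ).imp id fun h => ⟨h.1, hK.congr _ _ _ (fun i hi => ?_) h.2⟩
        rw [hsame J hJe i hi]
    · by_cases hJe : J = slot e x
      · subst hJe
        refine ⟨hbest.1, le_trans ?_ hbest.2⟩
        -- If the new tuple were lighter than `v`, the old entry, of weight at least `v`, would have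
        -- passed the test, and nothing would have been written.
        by_contra hlt
        have hJ' := hJ.congr ha1 ha2
        exact hb ⟨hJ'.1, (not_le.1 hlt).le.trans hJ'.2⟩
      · refine ⟨by rw [hf, if_neg hJe]; exact hJ.1, hJ.2.trans (le_of_eq ?_)⟩
        exact Finset.sum_congr rfl fun i hi => by rw [hsame J hJe i (Finset.mem_range.1 hi)]

/-- Enter the tuple with code in register `6` into all slots of a list. -/
def updateList (K : Task) : List NExp → Prog
  | [] => .skip
  | e :: l => .seq (updateSlot K e) (updateList K l)

theorem modN_updateList {l : List NExp} {x : ℕ} (h : (updateList K l).ModN x) : x = 7 := by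
  induction l with
  | nil => exact h.elim
  | cons e l ih => exact h.elim modN_updateSlot.1 ih

theorem modA_updateList {l : List NExp} {x : ℕ} (h : (updateList K l).ModA x) :
    x = 1 ∨ x = 2 := by
  induction l with
  | nil => exact h.elim
  | cons e l ih => exact h.elim modA_updateSlot ih

theorem modR_updateList {l : List NExp} {x : ℕ} : ¬ (updateList K l).ModR x := by
  induction l with
  | nil => exact id
  | cons e l ih => exact fun h => h.elim modR_updateSlot ih

theorem loopFree_updateList {l : List NExp} : (updateList K l).LoopFree := by
  induction l with
  | nil => trivial
  | cons e l ih => exact ⟨loopFree_updateSlot, ih⟩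

theorem runs_updateList (hK : K.Correct W n m A P slot) {x : ℕ} (hx : x < n ^ K.h)
    (hv : Valid A n K.R K.N K.h (fun _ => True) x) {l : List NExp} (hl : ∀ e ∈ l, e ∈ K.slots)
    {s : State} (hn : s.nreg 0 = n) (h6 : s.nreg 6 = x) (hw : s.rarr 0 = w)
    (ht : TableInv K.h m P s) :
    Runs W (updateList K l) s fun s' _ => TableInv K.h m P s' ∧
      (∀ J v, Beats K.h w s J v → Beats K.h w s' J v) ∧
      ∀ e ∈ l, Beats K.h w s' (slot e x) (wt w n K.h x) := by
  induction l generalizing s with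
  | nil => exact runs_skip.2 ⟨ht, fun _ _ => id, by simp⟩
  | cons e l ih =>
    rw [updateList, runs_seq]
    refine (runs_updateSlot hK (hl e (by simp)) hn h6 hx hv hw ht).conseq ?_
    rintro s₁ t₁ hu₁ ⟨ht₁, hm₁, hb₁⟩
    refine (ih (fun e he => hl e (by simp [he])) (by rw [hu₁.nreg 0 (by simp [modN_updateSlot]), hn])
      (by rw [hu₁.nreg 6 (by simp [modN_updateSlot]), h6])
      (by rw [hu₁.rarr 0 modR_updateSlot, hw]) ht₁).mono ?_
    rintro s₂ t₂ ⟨ht₂, hm₂, hb₂⟩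
    refine ⟨ht₂, fun J v h => hm₂ J v (hm₁ J v h), fun e' he' => ?_⟩
    rcases List.mem_cons.1 he' with rfl | he'
    · exact hm₂ _ _ hb₁
    · exact hb₂ e' he'

end update


/-! ### Trying all inner tuples of one bucket for every outer tuple -/

/-- Register `8` holds an outer tuple, register `12` gets a position in the sorted list of inner
tuples; the position lies in the bucket that array `3` holds for the outer tuple. -/
noncomputable def scanOne (K : Task) (b : ℕ) : Prog :=
  .seq (.setN 12 (.add (.mul (.sub (.get 3 (.reg 8)) (.const 1)) (.reg 11)) (.reg 10)))
    (.ite (.lt (.reg 12) (.reg 13))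
      (.seq (.setN 6 (.add (.reg 8) (.mul (.reg 9) (.get (10 + b) (.reg 12)))))
        (.ite (validE K.R K.N K.h (fun _ => True) (.reg 6)) (updateList K K.slots) .skip))
      .skip)

noncomputable def scanProg (K : Task) (ac b : ℕ) : Prog :=
  .seq (.setN 9 (powE ac)) (.seq (.setN 13 (powE b))
    (forLoop 8 9 (.ite (.lt (.const 0) (.get 3 (.reg 8))) (forLoop 10 11 (scanOne K b)) .skip)))

section scan

variable {K : Task} {W n m : ℕ} {A : ℕ → ℕ} {P : ℕ → (ℕ → ℕ) → Prop} {slot : NExp → ℕ → ℕ}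
  {w : ℕ → ℝ} {ac b : ℕ}

theorem modN_scanOne {x : ℕ} (h : (scanOne K b).ModN x) : x = 12 ∨ x = 6 ∨ x = 7 := by
  simp only [scanOne, Prog.ModN, or_false] at h
  exact h.imp id (Or.imp id modN_updateList)

theorem modA_scanOne {x : ℕ} (h : (scanOne K b).ModA x) : x = 1 ∨ x = 2 := by
  simp only [scanOne, Prog.ModA, or_false, false_or] at h
  exact modA_updateList h

theorem modR_scanOne {x : ℕ} : ¬ (scanOne K b).ModR x := by
  simp [scanOne, Prog.ModR, modR_updateList]

theorem loopFree_scanOne : (scanOne K b).LoopFree := by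
  simp [scanOne, Prog.LoopFree, loopFree_updateList]

theorem modN_scanProg {x : ℕ} (h : (scanProg K ac b).ModN x) : 6 ≤ x ∧ x ≤ 13 := by
  simp only [scanProg, Prog.ModN, modN_forLoop, or_false] at h
  rcases h with h | h | h | h | h
  iterate 4 omega
  · have := modN_scanOne h
    omega

theorem modA_scanProg {x : ℕ} (h : (scanProg K ac b).ModA x) : x = 1 ∨ x = 2 := by
  simp only [scanProg, Prog.ModA, modA_forLoop, or_false, false_or] at h
  exact modA_scanOne h

theorem modR_scanProg {x : ℕ} : ¬ (scanProg K ac b).ModR x := by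
  simp [scanProg, Prog.ModR, modR_forLoop, modR_scanOne]

/-- The tuple coded by `x`, if valid, has been entered into the table. -/
def Entered (K : Task) (n : ℕ) (A : ℕ → ℕ) (w : ℕ → ℝ) (slot : NExp → ℕ → ℕ) (s : State)
    (x : ℕ) : Prop :=
  Valid A n K.R K.N K.h (fun _ => True) x → ∀ e ∈ K.slots, Beats K.h w s (slot e x) (wt w n K.h x)

/-- Every table entry of `s` is at most as good as that of `s'`. -/
def Improves (h : ℕ) (w : ℕ → ℝ) (s s' : State) : Prop :=
  ∀ J v, Beats h w s J v → Beats h w s' J v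

theorem Improves.of_eq {h : ℕ} {s s' : State} (h1 : s'.narr 1 = s.narr 1)
    (h2 : s'.narr 2 = s.narr 2) : Improves h w s s' :=
  fun _ _ hb => hb.congr h1 h2

theorem Improves.trans {h : ℕ} {s s' s'' : State} (h1 : Improves h w s s')
    (h2 : Improves h w s' s'') : Improves h w s s'' :=
  fun J v hb => h2 J v (h1 J v hb)

theorem Entered.mono {s s' : State} {x : ℕ} (h : Entered K n A w slot s x)
    (hs : Improves K.h w s s') : Entered K n A w slot s' x :=
  fun hv e he => hs _ _ (h hv e he)

theorem runs_scanOne (hK : K.Correct W n m A P slot) (hac : ac + b = K.h) (hn0 : 0 < n) {s : State}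
    {y z D : ℕ}     (hn : s.nreg 0 = n) (h8 : s.nreg 8 = y) (h9 : s.nreg 9 = n ^ ac) (h10 : s.nreg 10 = z)
    (h11 : s.nreg 11 = D) (h13 : s.nreg 13 = n ^ b) (hy : y < n ^ ac)
    (hW : (s.narr 3 y - 1) * D + z ≤ W) (hA : s.narr 0 = A) (hw : s.rarr 0 = w)
    (hS : ∀ p < n ^ b, s.narr (10 + b) p < n ^ b) (ht : TableInv K.h m P s) :
    Runs W (scanOne K b) s fun s' t => t ≤ (scanOne K b).passCost ∧ TableInv K.h m P s' ∧
      Improves K.h w s s' ∧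
      ((s.narr 3 y - 1) * D + z < n ^ b → Entered K n A w slot s'
        (y + n ^ ac * s.narr (10 + b) ((s.narr 3 y - 1) * D + z))) := by
  refine Runs.timed loopFree_scanOne ?_
  set p := (s.narr 3 y - 1) * D + z with hp
  have h2 := hK.two_le
  unfold scanOne
  simp only [runs_seq, runs_setN, NExp.Fits, NExp.eval, h8, h10, h11, true_and]
  refine ⟨⟨by omega, hW⟩, ?_⟩
  rw [runs_ite]
  refine ⟨⟨trivial, trivial⟩, fun hb => ?_, fun hb => ?_⟩
  · simp only [BExp.Holds, NExp.eval, State.nreg_setReg, reduceIte, Nat.reduceEqDiff, h13, ← hp] at hb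
    have hSp := hS p hb
    have hx : y + n ^ ac * s.narr (10 + b) p < n ^ K.h := by
      rw [← hac]
      exact add_mul_lt_pow hy hSp
    have hnW : n ^ K.h ≤ W := le_trans (Nat.pow_le_pow_left (by omega) _) hK.pow
    simp only [runs_seq, runs_setN, NExp.Fits, NExp.eval, State.nreg_setReg, State.narr_setReg,
      reduceIte, Nat.reduceEqDiff, h8, h9, ← hp, true_and]
    refine ⟨⟨by omega, by omega⟩, ?_⟩
    set s₁ := (s.setReg 12 p).setReg 6 (y + n ^ ac * s.narr (10 + b) p) with hs₁
    have hn₁ : s₁.nreg 0 = n := by simpa [hs₁] using hn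
    have h6 : s₁.nreg 6 = y + n ^ ac * s.narr (10 + b) p := by simp [hs₁]
    have ha : s₁.narr = s.narr := rfl
    have hr : s₁.rarr = s.rarr := rfl
    clear_value s₁
    rw [runs_ite]
    refine ⟨fits_validE hn₁ hn0 h2 hK.pow trivial, fun hv => ?_, fun hv => ?_⟩
    · rw [holds_validE, ha, hA, hn₁, NExp.eval, h6] at hv
      refine (runs_updateList hK hx hv (fun _ h => h) hn₁ h6 (by rw [hr, hw])
        (ht.congr (by rw [ha]) (by rw [ha]))).mono ?_
      rintro s₂ t₂ ⟨h3, h4, h5⟩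
      exact ⟨h3, (Improves.of_eq (by rw [ha]) (by rw [ha])).trans h4, fun _ _ => h5⟩
    · rw [holds_validE, ha, hA, hn₁, NExp.eval, h6] at hv
      exact runs_skip.2 ⟨ht.congr (by rw [ha]) (by rw [ha]), .of_eq (by rw [ha]) (by rw [ha]),
        fun _ h => absurd h hv⟩
  · simp only [BExp.Holds, NExp.eval, State.nreg_setReg, reduceIte, Nat.reduceEqDiff, h13, ← hp] at hb
    exact runs_skip.2 ⟨ht.congr rfl rfl, .of_eq rfl rfl, fun h => absurd h hb⟩

/-- Only one bucket is scanned per outer tuple, which gives the term `n ^ ac * D`. Each tuple is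
tested in full before it is entered, so a pair of incompatible row and column tuples does no harm.
-/
theorem runs_scanProg (K : Task) (ac b : ℕ) : ∃ C : ℕ, ∀ {W n m : ℕ} {A : ℕ → ℕ}
    {P : ℕ → (ℕ → ℕ) → Prop} {slot : NExp → ℕ → ℕ} {w : ℕ → ℝ} {D : ℕ} {s : State},
    K.Correct W n m A P slot → ac + b = K.h → 0 < n → s.nreg 0 = n → s.nreg 11 = D →
    s.narr 0 = A → s.rarr 0 = w → n ^ b + D ≤ W →
    (∀ y < n ^ ac, s.narr 3 y ≠ 0 → (s.narr 3 y - 1) * D < n ^ b) →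
    (∀ p < n ^ b, s.narr (10 + b) p < n ^ b) → TableInv K.h m P s →
    Runs W (scanProg K ac b) s fun s' t => t ≤ C * ((n ^ ac + 1) * (D + 1)) ∧ TableInv K.h m P s' ∧
      Improves K.h w s s' ∧
      ∀ y < n ^ ac, s.narr 3 y ≠ 0 → ∀ z < D, (s.narr 3 y - 1) * D + z < n ^ b →
        Entered K n A w slot s' (y + n ^ ac * s.narr (10 + b) ((s.narr 3 y - 1) * D + z)) := by
  refine ⟨(scanProg K ac b).passCost + 2 * ((scanOne K b).passCost + 8) + 20, ?_⟩
  intro W n m A P slot w D s hK hac hn0 hn h11 hA hw hDW hbest hS ht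
  have hacW : (n + 1) ^ ac ≤ W := le_trans (Nat.pow_le_pow_right (by omega) (by omega)) hK.pow
  have hbW : (n + 1) ^ b ≤ W := le_trans (Nat.pow_le_pow_right (by omega) (by omega)) hK.pow
  have hacW' : n ^ ac ≤ W := le_trans (Nat.pow_le_pow_left (by omega) _) hacW
  rw [scanProg]
  simp only [runs_seq, runs_setN]
  refine ⟨fits_powE hn hacW, fits_powE (by simpa using hn) hbW, ?_⟩
  simp only [eval_powE, State.nreg_setReg, OfNat.zero_ne_ofNat, if_false, hn]
  set s₁ := (s.setReg 9 (n ^ ac)).setReg 13 (n ^ b) with hs₁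
  have h0₁ : s₁.nreg 0 = n := by simpa [hs₁] using hn
  have h9₁ : s₁.nreg 9 = n ^ ac := by simp [hs₁]
  have h11₁ : s₁.nreg 11 = D := by simpa [hs₁] using h11
  have h13₁ : s₁.nreg 13 = n ^ b := by simp [hs₁]
  have ha₁ : s₁.narr = s.narr := rfl
  have hr₁ : s₁.rarr = s.rarr := rfl
  clear_value s₁
  set c := (scanOne K b).passCost with hc
  refine (runs_forLoop (i := 8) (l := 9)
    (fun y s' => TableInv K.h m P s' ∧ Improves K.h w s s' ∧ ∀ y' < y, s.narr 3 y' ≠ 0 → ∀ z < D,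
      (s.narr 3 y' - 1) * D + z < n ^ b →
        Entered K n A w slot s' (y' + n ^ ac * s.narr (10 + b) ((s.narr 3 y' - 1) * D + z)))
    ((D + 1) * (c + 8) + 10) h9₁ hacW' (by omega) ?_ ?_ ?_ ?_).mono ?_
  · simp only [Prog.ModN, modN_forLoop, or_false, not_or]
    exact ⟨by omega, fun h => by simpa using modN_scanOne h⟩
  · simp only [Prog.ModN, modN_forLoop, or_false, not_or]
    exact ⟨by omega, fun h => by simpa using modN_scanOne h⟩
  · exact ⟨ht.congr (by simp [ha₁]) (by simp [ha₁]), .of_eq (by simp [ha₁]) (by simp [ha₁]), by simp⟩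
  · rintro y s₂ hy h8₂ hu₂ ⟨ht₂, hm₂, he₂⟩
    have hreg : ∀ x, x ≠ 8 → x ≠ 10 → x ≠ 12 → x ≠ 6 → x ≠ 7 → s₂.nreg x = s₁.nreg x := by
      intro x h8 h10 h12 h6 h7
      refine hu₂.nreg x ?_
      simp only [Prog.ModN, modN_forLoop, or_false, not_or]
      exact ⟨h8, h10, fun h => by have := modN_scanOne h; omega⟩
    have harr : ∀ a, a ≠ 1 → a ≠ 2 → s₂.narr a = s.narr a := by
      intro a h1 h2
      rw [hu₂.narr a, ha₁]
      simp only [modA_forLoop, Prog.ModA, or_false]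
      exact fun h => by have := modA_scanOne h; omega
    have hr₂ : s₂.rarr 0 = w := by
      rw [hu₂.rarr 0, hr₁, hw]
      simp [modR_forLoop, Prog.ModR, modR_scanOne]
    rw [runs_ite]
    simp only [BExp.Holds, NExp.eval, h8₂, harr 3 (by omega) (by omega), BExp.cost, NExp.cost]
    refine ⟨⟨trivial, trivial⟩, fun hb => ?_, fun hb => ?_⟩
    · have hbD := hbest y hy (by omega)
      refine (runs_forLoop (i := 10) (l := 11)
        (fun z s' => TableInv K.h m P s' ∧ Improves K.h w s₂ s' ∧ ∀ z' < z,
          (s.narr 3 y - 1) * D + z' < n ^ b →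
            Entered K n A w slot s' (y + n ^ ac * s.narr (10 + b) ((s.narr 3 y - 1) * D + z')))
        c ((hreg 11 (by omega) (by omega) (by omega) (by omega) (by omega)).trans h11₁) (by omega)
        (by omega) (fun h => by simpa using modN_scanOne h) (fun h => by simpa using modN_scanOne h)
        ⟨ht₂.congr rfl rfl, .of_eq rfl rfl, by simp⟩ ?_).mono ?_
      · rintro z s₃ hz h10₃ hu₃ ⟨ht₃, hm₃, he₃⟩
        have hreg₃ : ∀ x, x ≠ 10 → x ≠ 12 → x ≠ 6 → x ≠ 7 → s₃.nreg x = s₂.nreg x := by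
          intro x h10 h12 h6 h7
          refine hu₃.nreg x ?_
          simp only [modN_forLoop, not_or]
          exact ⟨h10, fun h => by have := modN_scanOne h; omega⟩
        have harr₃ : ∀ a, a ≠ 1 → a ≠ 2 → s₃.narr a = s.narr a := by
          intro a h1 h2
          rw [hu₃.narr a, harr a h1 h2]
          simp only [modA_forLoop]
          exact fun h => by have := modA_scanOne h; omega
        have hr₃ : s₃.rarr 0 = w := by
          rw [hu₃.rarr 0, hr₂]
          simp [modR_forLoop, modR_scanOne]
        have hb₃ := harr₃ 3 (by omega) (by omega)
        have hl₃ := harr₃ (10 + b) (by omega) (by omega)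
        refine (runs_scanOne (D := D) (z := z) hK hac hn0 ?_ ?_ ?_ h10₃ ?_ ?_ hy ?_ ?_ hr₃ ?_
          ht₃).mono ?_
        · rw [hreg₃ 0, hreg 0, h0₁] <;> omega
        · rw [hreg₃ 8, h8₂] <;> omega
        · rw [hreg₃ 9, hreg 9, h9₁] <;> omega
        · rw [hreg₃ 11, hreg 11, h11₁] <;> omega
        · rw [hreg₃ 13, hreg 13, h13₁] <;> omega
        · rw [hb₃]
          omega
        · rw [harr₃ 0, hA] <;> omega
        · rwa [hl₃]
        · rintro s₄ t₄ ⟨h4, ht₄, hm₄, he₄⟩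
          rw [hb₃, hl₃] at he₄
          have hst : Improves K.h w s₄ (s₄.setReg 10 (z + 1)) := .of_eq rfl rfl
          refine ⟨h4, ht₄.congr rfl rfl, (hm₃.trans hm₄).trans hst, fun z' hz' hlt => ?_⟩
          rcases Nat.lt_succ_iff_lt_or_eq.1 hz' with h | rfl
          · exact ((he₃ z' h hlt).mono hm₄).mono hst
          · exact (he₄ hlt).mono hst
      · rintro s₃ t₃ ⟨h3, ht₃, hm₃, he₃⟩
        have hst : Improves K.h w s₃ (s₃.setReg 8 (y + 1)) := .of_eq rfl rfl
        refine ⟨by omega, ht₃.congr rfl rfl, (hm₂.trans hm₃).trans hst, fun y' hy' hne z hz hlt => ?_⟩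
        rcases Nat.lt_succ_iff_lt_or_eq.1 hy' with h | rfl
        · exact ((he₂ y' h hne z hz hlt).mono hm₃).mono hst
        · exact (he₃ z hz hlt).mono hst
    · have hst : Improves K.h w s₂ (s₂.setReg 8 (y + 1)) := .of_eq rfl rfl
      refine runs_skip.2 ⟨by omega, ht₂.congr rfl rfl, hm₂.trans hst, fun y' hy' hne z hz hlt => ?_⟩
      rcases Nat.lt_succ_iff_lt_or_eq.1 hy' with h | rfl
      · exact (he₂ y' h hne z hz hlt).mono hst
      · omega
  · rintro s₂ t₂ ⟨h2, h3, h4, h5⟩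
    refine ⟨?_, h3, h4, h5⟩
    simp only [Prog.passCost]
    have h6 : 1 ≤ (n ^ ac + 1) * (D + 1) := Nat.mul_pos (by omega) (by omega)
    have h7 : (n ^ ac + 1) * ((D + 1) * (c + 8) + 10 + 8) ≤
        (c + 26) * ((n ^ ac + 1) * (D + 1)) := by
      have h8 : (D + 1) * (c + 8) + 10 + 8 ≤ (c + 26) * (D + 1) := by ring_nf; omega
      calc _ ≤ (n ^ ac + 1) * ((c + 26) * (D + 1)) := Nat.mul_le_mul_left _ h8
        _ = _ := by ring
    have h9 : ((powE ac).cost + 1 + ((powE b).cost + 1)) * 1 ≤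
        ((powE ac).cost + 1 + ((powE b).cost + 1)) * ((n ^ ac + 1) * (D + 1)) :=
      Nat.mul_le_mul_left _ h6
    generalize (n ^ ac + 1) * (D + 1) = X at *
    generalize (powE ac).cost = u at *
    generalize (powE b).cost = v at *
    nlinarith [Nat.zero_le ((forLoop 8 9
      (.ite (.lt (.const 0) (.get 3 (.reg 8))) (forLoop 10 11 (scanOne K b)) .skip)).passCost * X),
      Nat.zero_le (c * X)]

end scan


/-! ### Filling the matrices

Registers: `11` block size `D`, `21` number of the block, `22`, `23`, `24` numbers of blocks, `25`
holds `D * D`, `26`, `27`, `28` bucket, row block and column block, `29` loop counter, `30`–`33` the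
numbers of row, column, inner and outer tuples, `34` budget, `35` bound for `D`. -/

/-- Write one entry of a matrix into array `t`: whether the tuple formed by the outer index `rowE`
(with weight in register `u`) and by the inner tuple at position `posE` is valid on `S`. -/
noncomputable def fillStep (K : Task) (b t u l : ℕ) (S : ℕ → Prop) (rowE posE : NExp) : Prog :=
  .seq (.setN 36 rowE) (.seq (.setN 37 posE)
    (.ite (.and (.lt (.reg 36) (.reg l)) (.lt (.reg 37) (.reg 32)))
      (.seq (.setN 6 (.add (.mul (.reg u) (.reg 36)) (.mul (.reg 33) (.get (10 + b) (.reg 37)))))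
        (.ite (validE K.R K.N K.h S (.reg 6)) (.putN t (.reg 29) (.const 1))
          (.putN t (.reg 29) (.const 0))))
      (.putN t (.reg 29) (.const 0))))

noncomputable def fillProg (K : Task) (b t u l : ℕ) (S : ℕ → Prop) (rowE posE : NExp) : Prog :=
  forLoop 29 25 (fillStep K b t u l S rowE posE)

section fill

variable {K : Task} {b t u l : ℕ} {S : ℕ → Prop} {rowE posE : NExp}

theorem modN_fillStep {x : ℕ} :
    (fillStep K b t u l S rowE posE).ModN x ↔ x = 36 ∨ x = 37 ∨ x = 6 := by
  simp [fillStep, Prog.ModN]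

theorem modA_fillStep {x : ℕ} : (fillStep K b t u l S rowE posE).ModA x ↔ x = t := by
  simp [fillStep, Prog.ModA]

theorem modR_fillStep {x : ℕ} : ¬ (fillStep K b t u l S rowE posE).ModR x := by
  simp [fillStep, Prog.ModR]

theorem modN_fillProg {x : ℕ} :
    (fillProg K b t u l S rowE posE).ModN x ↔ x = 29 ∨ x = 36 ∨ x = 37 ∨ x = 6 := by
  rw [fillProg, modN_forLoop, modN_fillStep]

theorem modA_fillProg {x : ℕ} : (fillProg K b t u l S rowE posE).ModA x ↔ x = t := by
  rw [fillProg, modA_forLoop, modA_fillStep]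

theorem modR_fillProg {x : ℕ} : ¬ (fillProg K b t u l S rowE posE).ModR x := by
  rw [fillProg, modR_forLoop]
  exact modR_fillStep

open Classical in
-- One statement serves both factors. The multiplier `uv` is `1` for row tuples and `n ^ a` for
-- column tuples; the digits of the other outer part are zero and lie outside `S`. Indices past the
-- end, which occur in the last blocks, are padded with zeros.
theorem runs_fillProg {W n ac uv lv Q : ℕ} {s : State} {row pos : ℕ → ℕ} (hac : ac + b = K.h)
    (h2 : 2 ≤ K.h) (hn0 : 0 < n) (hW : (n + 1) ^ K.h ≤ W) (hn : s.nreg 0 = n)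
    (h25 : s.nreg 25 = Q) (hQ : Q ≤ W) (hu : s.nreg u = uv) (hl : s.nreg l = lv)
    (h32 : s.nreg 32 = n ^ b) (h33 : s.nreg 33 = n ^ ac)
    (hu' : u ≠ 6 ∧ u ≠ 29 ∧ u ≠ 36 ∧ u ≠ 37) (hl' : l ≠ 6 ∧ l ≠ 29 ∧ l ≠ 36 ∧ l ≠ 37)
    (ht : 50 + b ≤ t) (hlt : ∀ r < lv, uv * r < n ^ ac)
    (hS : ∀ p < n ^ b, s.narr (10 + b) p < n ^ b)
    (hrow : ∀ e < Q, ∀ s', (∀ x, x ≠ 29 → x ≠ 36 → x ≠ 37 → x ≠ 6 → s'.nreg x = s.nreg x) →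
      s'.nreg 29 = e → rowE.Fits W s' ∧ rowE.eval s' = row e)
    (hpos : ∀ e < Q, ∀ s', (∀ x, x ≠ 29 → x ≠ 36 → x ≠ 37 → x ≠ 6 → s'.nreg x = s.nreg x) →
      s'.nreg 29 = e → posE.Fits W s' ∧ posE.eval s' = pos e) :
    Runs W (fillProg K b t u l S rowE posE) s fun s' k =>
      k ≤ (Q + 1) * ((fillStep K b t u l S rowE posE).passCost + 8) ∧
      ∀ e < Q, s'.narr t e = if row e < lv ∧ pos e < n ^ b ∧ Valid (s.narr 0) n K.R K.N K.h S
        (uv * row e + n ^ ac * s.narr (10 + b) (pos e)) then 1 else 0 := by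
  refine runs_forLoop (i := 29) (l := 25) (fun e s' => ∀ e' < e, s'.narr t e' =
    if row e' < lv ∧ pos e' < n ^ b ∧ Valid (s.narr 0) n K.R K.N K.h S
        (uv * row e' + n ^ ac * s.narr (10 + b) (pos e')) then 1 else 0)
    _ h25 hQ (by omega) (by simp [modN_fillStep]) (by simp [modN_fillStep]) (by simp) ?_
  intro e s₁ he h29 hu₁ ih
  have hreg : ∀ x, x ≠ 29 → x ≠ 36 → x ≠ 37 → x ≠ 6 → s₁.nreg x = s.nreg x := by
    intro x h1 h2 h3 h4
    refine hu₁.nreg x ?_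
    rw [modN_forLoop, modN_fillStep]
    tauto
  have harr : ∀ a, a ≠ t → s₁.narr a = s.narr a := by
    intro a ha
    refine hu₁.narr a ?_
    rwa [modA_forLoop, modA_fillStep]
  refine Runs.timed (by simp [fillStep, Prog.LoopFree]) ?_
  obtain ⟨hrf, hre⟩ := hrow e he s₁ hreg h29
  obtain ⟨hpf, hpe⟩ := hpos e he (s₁.setReg 36 (row e)) (fun x h1 h2 h3 h4 => by
    rw [State.nreg_setReg, if_neg h2, hreg x h1 h2 h3 h4]) (by simpa using h29)
  have key : ∀ s₂ v, s₂.narr = s₁.narr → s₂.nreg 29 = e →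
      v = (if row e < lv ∧ pos e < n ^ b ∧ Valid (s.narr 0) n K.R K.N K.h S
        (uv * row e + n ^ ac * s.narr (10 + b) (pos e)) then 1 else 0) →
      Runs W (.putN t (.reg 29) (.const v)) s₂ fun s' _ => ∀ e' < e + 1,
        (s'.setReg 29 (e + 1)).narr t e' =
        if row e' < lv ∧ pos e' < n ^ b ∧ Valid (s.narr 0) n K.R K.N K.h S
        (uv * row e' + n ^ ac * s.narr (10 + b) (pos e')) then 1 else 0 := by
    intro s₂ v ha h29' hv
    rw [runs_putN]
    refine ⟨trivial, trivial, fun e' he' => ?_⟩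
    simp only [State.narr_setReg, State.narr_setCell, NExp.eval, h29', true_and, ha]
    by_cases h : e' = e
    · rw [if_pos h, hv, h]
    · rw [if_neg h, ih e' (by omega)]
  unfold fillStep
  rw [runs_seq, runs_setN, hre, runs_seq, runs_setN, hpe, runs_ite]
  refine ⟨hrf, hpf, ⟨⟨trivial, trivial⟩, trivial, trivial⟩, fun hb => ?_, fun hb => ?_⟩ <;>
    simp only [BExp.Holds, NExp.eval, State.nreg_setReg, Nat.reduceEqDiff, if_true, if_false,
      if_neg hl'.2.2.1, if_neg hl'.2.2.2, hreg l hl'.2.1 hl'.2.2.1 hl'.2.2.2 hl'.1, hl,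
      hreg 32 (by omega) (by omega) (by omega) (by omega), h32] at hb
  · have hSp := hS _ hb.2
    have hx := add_mul_lt_pow (hlt _ hb.1) hSp
    rw [hac] at hx
    have hnW : n ^ K.h ≤ W := le_trans (Nat.pow_le_pow_left (by omega) _) hW
    rw [runs_seq, runs_setN]
    simp only [NExp.Fits, NExp.eval, State.nreg_setReg, State.narr_setReg, Nat.reduceEqDiff,
      if_true, if_false, if_neg hu'.2.2.1, if_neg hu'.2.2.2,
      hreg u hu'.2.1 hu'.2.2.1 hu'.2.2.2 hu'.1, hu, true_and,
      hreg 33 (by omega) (by omega) (by omega) (by omega), h33, harr (10 + b) (by omega)]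
    refine ⟨⟨by omega, by omega, by omega⟩, ?_⟩
    set s₂ := ((s₁.setReg 36 (row e)).setReg 37 (pos e)).setReg 6
      (uv * row e + n ^ ac * s.narr (10 + b) (pos e)) with hs₂
    have hn₂ : s₂.nreg 0 = n := by
      simp [hs₂, hreg 0 (by omega) (by omega) (by omega) (by omega), hn]
    have h6₂ : s₂.nreg 6 = uv * row e + n ^ ac * s.narr (10 + b) (pos e) := by simp [hs₂]
    have h29₂ : s₂.nreg 29 = e := by simp [hs₂, h29]
    have ha₂ : s₂.narr = s₁.narr := rfl
    clear_value s₂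
    rw [runs_ite, holds_validE, ha₂, harr 0 (by omega), hn₂, NExp.eval, h6₂]
    refine ⟨fits_validE hn₂ hn0 h2 hW trivial, fun hv => key s₂ 1 ha₂ h29₂ ?_,
      fun hv => key s₂ 0 ha₂ h29₂ ?_⟩
    · rw [if_pos ⟨hb.1, hb.2, hv⟩]
    · rw [if_neg fun h => hv h.2.2]
  · refine key _ 0 rfl (by simp [h29]) ?_
    rw [if_neg fun h => hb ⟨h.1, h.2.1⟩]

end fill

/-! ### Calling the matrix multiplication -/

/-- `p` multiplies 0-1 matrices with words bounded by `(D + 2) ^ d` in time `τ D`. -/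
def Multiplies (p : Prog) (d : ℕ) (τ : ℕ → ℕ) : Prop :=
  ∀ (x : MatPair) (s : State), x.Input s →
    ∃ s' k, Exec ((x.n + 2) ^ d) p s s' k ∧ x.Output s' ∧ k ≤ τ x.n

/-- The subroutine lives on the cells from `q` on, with `T` below `q`, so it cannot disturb the
caller's other data. The time is bounded by the measured `m`, not merely by `τ D`: this lets the
caller control the time without knowing `τ`. -/
theorem runs_multiply {p : Prog} {d : ℕ} {τ : ℕ → ℕ} (hp : Multiplies p d τ) {W q T D : ℕ}
    (hT : T < q) {s : State} (hW : (D + 2) ^ d ≤ W) (hTW : s.nreg T + τ D ≤ W) (hW1 : 1 ≤ W)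
    (hD : s.nreg q = D) (hA : ∀ x < D, ∀ y < D, s.narr q (x * D + y) ≤ 1)
    (hB : ∀ x < D, ∀ y < D, s.narr (q + 1) (x * D + y) ≤ 1) :
    Runs W (p.counted q T) s fun s' k => ∃ m ≤ τ D, s'.nreg T = s.nreg T + m ∧
      k ≤ p.passCost * (m + 1) ∧ ∀ x < D, ∀ y < D, s'.narr (q + 2) (x * D + y) =
        ∑ z ∈ Finset.range D, s.narr q (x * D + z) * s.narr (q + 1) (z * D + y) := by
  let x : MatPair :=
    { n := D
      A := fun i j => s.narr q (i * D + j)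
      B := fun i j => s.narr (q + 1) (i * D + j)
      A_le_one := fun i j => hA i i.2 j j.2
      B_le_one := fun i j => hB i i.2 j j.2 }
  obtain ⟨s', k, he, ho, hk⟩ := hp x (s.drop q) ⟨by simp [State.drop, hD, x],
    fun i j => by simp [State.drop, x], fun i j => by simp [State.drop, x, add_comm]⟩
  obtain ⟨m, k', he', hm, hk'⟩ := he.counted (W' := W) (K := q) (T := T) hT hW s
    (by have : k ≤ τ D := hk; omega) hW1
  rw [State.join_drop] at he'
  refine ⟨_, k', he', m, hm.trans hk, ?_, hk', fun i hi j hj => ?_⟩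
  · simp [State.join, hT]
  · have := ho ⟨i, hi⟩ ⟨j, hj⟩
    simp only [State.join]
    rw [if_neg (by omega), Nat.add_sub_cancel_left]
    refine this.trans ?_
    simp only [x]
    exact Fin.sum_univ_eq_sum_range (fun z => s.narr q (i * D + z) * s.narr (q + 1) (z * D + j)) D


/-! ### Harvesting a block product -/

/-- Enter bucket `k` (register `26`) for the pair of outer tuples whose entry in the product, which is
in array `t`, is at the position in register `29`, unless there is an earlier bucket. -/
def harvestStep (t : ℕ) : Prog :=
  .seq (.setN 36 (.add (.mul (.reg 27) (.reg 11)) (.div (.reg 29) (.reg 11))))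
    (.seq (.setN 39 (.add (.mul (.reg 28) (.reg 11)) (.mod (.reg 29) (.reg 11))))
      (.ite (.and (.lt (.const 0) (.get t (.reg 29)))
          (.and (.lt (.reg 36) (.reg 30)) (.lt (.reg 39) (.reg 31))))
        (.seq (.setN 37 (.add (.reg 36) (.mul (.reg 30) (.reg 39))))
          (.ite (.eq (.get 3 (.reg 37)) (.const 0))
            (.putN 3 (.reg 37) (.add (.reg 26) (.const 1))) .skip))
        .skip))

def harvestProg (t : ℕ) : Prog := forLoop 29 25 (harvestStep t)

theorem modN_harvestProg {t x : ℕ} :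
    (harvestProg t).ModN x ↔ x = 29 ∨ x = 36 ∨ x = 39 ∨ x = 37 := by
  simp [harvestProg, modN_forLoop, harvestStep, Prog.ModN]

theorem modA_harvestProg {t x : ℕ} : (harvestProg t).ModA x ↔ x = 3 := by
  simp [harvestProg, modA_forLoop, harvestStep, Prog.ModA]

theorem modR_harvestProg {t x : ℕ} : ¬ (harvestProg t).ModR x := by
  simp [harvestProg, modR_forLoop, harvestStep, Prog.ModR]

theorem add_mul_injective {u r c r' c' : ℕ} (hr : r < u) (hr' : r' < u)
    (h : r + u * c = r' + u * c') : r = r' ∧ c = c' := by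
  have h1 := congrArg (· % u) h
  have h2 := congrArg (· / u) h
  simp only [Nat.add_mul_mod_self_left, Nat.mod_eq_of_lt hr, Nat.mod_eq_of_lt hr'] at h1
  simp only [Nat.add_mul_div_left _ _ (by omega : 0 < u), Nat.div_eq_of_lt hr,
    Nat.div_eq_of_lt hr', zero_add] at h2
  exact ⟨h1, h2⟩

open Classical in
-- The stored value is `k + 1` because `0` means that no bucket has been found. An entry that is not
-- zero is never overwritten, so the earliest bucket survives.
theorem runs_harvestProg {t W D I J k NA NC : ℕ} {s : State} (ht : t ≠ 3) (h11 : s.nreg 11 = D)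
    (hD : 0 < D) (h25 : s.nreg 25 = D * D) (hDW : D * D ≤ W) (h26 : s.nreg 26 = k)
    (h27 : s.nreg 27 = I) (h28 : s.nreg 28 = J) (h30 : s.nreg 30 = NA) (h31 : s.nreg 31 = NC)
    (hI : I * D + D ≤ W) (hJ : J * D + D ≤ W) (hW : NA * NC ≤ W) (hk : k + 1 ≤ W) :
    Runs W (harvestProg t) s fun s' u => u ≤ (D * D + 1) * ((harvestStep t).passCost + 8) ∧
      ∀ r < NA, ∀ c < NC, s'.narr 3 (r + NA * c) =
        if r / D = I ∧ c / D = J ∧ 0 < s.narr t (r % D * D + c % D) ∧ s.narr 3 (r + NA * c) = 0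
        then k + 1 else s.narr 3 (r + NA * c) := by
  -- The pair `(r, c)` has number `r % D * D + c % D` inside its block, so the condition that this
  -- is below `e` says that it has been visited.
  refine (runs_forLoop (i := 29) (l := 25) (fun e s' => ∀ r < NA, ∀ c < NC, s'.narr 3 (r + NA * c) =
        if r / D = I ∧ c / D = J ∧ r % D * D + c % D < e ∧ 0 < s.narr t (r % D * D + c % D) ∧
          s.narr 3 (r + NA * c) = 0
        then k + 1 else s.narr 3 (r + NA * c))
    (harvestStep t).passCost h25 hDW (by omega) (by simp [harvestStep, Prog.ModN])
    (by simp [harvestStep, Prog.ModN]) (by simp) ?_).mono ?_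
  · intro e s₁ he h29 hu₁ ih
    have hreg : ∀ x, x ≠ 29 → x ≠ 36 → x ≠ 37 → x ≠ 39 → s₁.nreg x = s.nreg x := by
      intro x h1 h2 h3 h4
      exact hu₁.nreg x fun h => by have := modN_harvestProg.1 h; omega
    have hat : s₁.narr t = s.narr t := hu₁.narr t fun h => ht (modA_harvestProg.1 h)
    have h11' : s₁.nreg 11 = D := by rw [hreg 11, h11] <;> omega
    have h26' : s₁.nreg 26 = k := by rw [hreg 26, h26] <;> omega
    have h27' : s₁.nreg 27 = I := by rw [hreg 27, h27] <;> omega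
    have h28' : s₁.nreg 28 = J := by rw [hreg 28, h28] <;> omega
    have h30' : s₁.nreg 30 = NA := by rw [hreg 30, h30] <;> omega
    have h31' : s₁.nreg 31 = NC := by rw [hreg 31, h31] <;> omega
    have hed : e / D < D := Nat.div_lt_of_lt_mul he
    have hem : e % D < D := Nat.mod_lt _ hD
    refine Runs.timed (by simp [harvestStep, Prog.LoopFree]) ?_
    unfold harvestStep
    simp only [runs_seq, runs_setN, runs_ite, runs_putN, runs_skip, NExp.Fits, NExp.eval, BExp.Fits,
      BExp.Holds, State.nreg_setReg, State.narr_setReg, Nat.reduceEqDiff, if_true, if_false, h11',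
      h27', h28', h29, hat, h26', h30', h31', true_and, and_true, State.narr_setCell]
    refine ⟨by constructor <;> omega, by constructor <;> omega, fun hb => ?_, fun hb => ?_⟩
    · obtain ⟨h1, h2, h3⟩ := hb
      have h4 : I * D + e / D + NA * (J * D + e % D) < NA * NC := by
        calc _ < NA * (J * D + e % D + 1) := by rw [mul_add_one]; omega
          _ ≤ NA * NC := Nat.mul_le_mul_left _ h3
      have h5 : (I * D + e / D) / D = I ∧ (I * D + e / D) % D = e / D := by
        rw [mul_comm, Nat.mul_add_div hD, Nat.mul_add_mod, Nat.div_eq_of_lt hed,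
          Nat.mod_eq_of_lt hed]
        exact ⟨rfl, rfl⟩
      have h6 : (J * D + e % D) / D = J ∧ (J * D + e % D) % D = e % D := by
        rw [mul_comm, Nat.mul_add_div hD, Nat.mul_add_mod, Nat.div_eq_of_lt hem,
          Nat.mod_eq_of_lt hem]
        exact ⟨rfl, rfl⟩
      have h7 : e / D * D + e % D = e := Nat.div_add_mod' e D
      have hpos := ih _ h2 _ h3
      rw [h5.1, h5.2, h6.1, h6.2, h7, if_neg (by omega)] at hpos
      refine ⟨⟨by omega, by omega⟩, fun h0 => ⟨hk, fun r hr c hc => ?_⟩, fun h0 r hr c hc => ?_⟩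
      · by_cases heq : r + NA * c = I * D + e / D + NA * (J * D + e % D)
        · obtain ⟨rfl, rfl⟩ := add_mul_injective hr h2 heq
          rw [if_pos rfl, if_pos ⟨h5.1, h6.1, by rw [h5.2, h6.2]; omega, by rwa [h5.2, h6.2, h7],
            by rw [← hpos, h0]⟩]
        · rw [if_neg heq, ih r hr c hc]
          congr 1
          refine propext ⟨fun h => ⟨h.1, h.2.1, by omega, h.2.2.2⟩, fun h => ⟨h.1, h.2.1, ?_, h.2.2.2⟩⟩
          refine lt_of_le_of_ne (by omega) fun h8 => heq ?_
          have h9 : r % D = e / D ∧ c % D = e % D := by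
            rw [← h8, mul_comm, Nat.mul_add_div hD, Nat.mul_add_mod,
              Nat.div_eq_of_lt (Nat.mod_lt c hD), Nat.mod_mod]
            exact ⟨rfl, rfl⟩
          rw [← Nat.div_add_mod' r D, ← Nat.div_add_mod' c D, h.1, h.2.1, h9.1, h9.2]
      · rw [ih r hr c hc]
        congr 1
        refine propext ⟨fun h => ⟨h.1, h.2.1, by omega, h.2.2.2⟩, fun h => ⟨h.1, h.2.1, ?_, h.2.2.2⟩⟩
        refine lt_of_le_of_ne (by omega) fun h8 => h0 ?_
        have h9 : r % D = e / D ∧ c % D = e % D := by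
          rw [← h8, mul_comm, Nat.mul_add_div hD, Nat.mul_add_mod,
            Nat.div_eq_of_lt (Nat.mod_lt c hD), Nat.mod_mod]
          exact ⟨rfl, rfl⟩
        rw [hpos]
        have h10 : r = I * D + e / D := by rw [← h9.1, ← h.1, Nat.div_add_mod']
        have h11 : c = J * D + e % D := by rw [← h9.2, ← h.2.1, Nat.div_add_mod']
        rw [← h10, ← h11]
        exact h.2.2.2.2
    · intro r hr c hc
      rw [ih r hr c hc]
      congr 1
      refine propext ⟨fun h => ⟨h.1, h.2.1, by omega, h.2.2.2⟩, fun h => ⟨h.1, h.2.1, ?_, h.2.2.2⟩⟩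
      refine lt_of_le_of_ne (by omega) fun h8 => hb ?_
      have h9 : r % D = e / D ∧ c % D = e % D := by
        rw [← h8, mul_comm, Nat.mul_add_div hD, Nat.mul_add_mod,
          Nat.div_eq_of_lt (Nat.mod_lt c hD), Nat.mod_mod]
        exact ⟨rfl, rfl⟩
      have h10 : r = I * D + e / D := by rw [← h9.1, ← h.1, Nat.div_add_mod']
      have h11 : c = J * D + e % D := by rw [← h9.2, ← h.2.1, Nat.div_add_mod']
      exact ⟨h8 ▸ h.2.2.2.1, h10 ▸ hr, h11 ▸ hc⟩
  · rintro s' u ⟨hu, h⟩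
    refine ⟨hu, fun r hr c hc => ?_⟩
    rw [h r hr c hc]
    congr 1
    refine propext ⟨fun h => ⟨h.1, h.2.1, h.2.2.2⟩, fun h => ⟨h.1, h.2.1, ?_, h.2.2⟩⟩
    -- After the last pass every number inside the block lies below `D * D`, and the condition on
    -- visited pairs disappears.
    have h1 : c % D < D := Nat.mod_lt _ hD
    calc r % D * D + c % D < (r % D + 1) * D := by rw [add_mul]; omega
      _ ≤ D * D := Nat.mul_le_mul_right _ (Nat.mod_lt _ hD)


/-! ### Processing one block -/

/-- Positions of the row part and of the inner part of a tuple. -/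
def rowSet (a c : ℕ) (i : ℕ) : Prop := i < a ∨ a + c ≤ i

/-- Positions of the column part and of the inner part of a tuple. -/
def colSet (a : ℕ) (i : ℕ) : Prop := a ≤ i

/-- The offset `x * D + o` in register `x`'s block. -/
def offE (x : ℕ) (o : NExp) : NExp := .add (.mul (.reg x) (.reg 11)) o

noncomputable def fillRows (K : Task) (a c b : ℕ) : Prog :=
  fillProg K b (50 + b) 40 30 (rowSet a c) (offE 27 (.div (.reg 29) (.reg 11)))
    (offE 26 (.mod (.reg 29) (.reg 11)))

noncomputable def fillCols (K : Task) (a b : ℕ) : Prog :=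
  fillProg K b (50 + b + 1) 30 31 (colSet a) (offE 28 (.mod (.reg 29) (.reg 11)))
    (offE 26 (.div (.reg 29) (.reg 11)))

/-- The bucket is the most significant part of the block number, so buckets are treated in order of
decreasing weight. The counter in register `20` receives `D * D` in addition to the loop passes of
`p`, since filling and harvesting are not counted by `p`. -/
noncomputable def blockProg (K : Task) (a c b : ℕ) (p : Prog) : Prog :=
  .seq (.setN 26 (.div (.reg 21) (.mul (.reg 23) (.reg 24))))
    (.seq (.setN 27 (.mod (.div (.reg 21) (.reg 24)) (.reg 23)))
      (.seq (.setN 28 (.mod (.reg 21) (.reg 24)))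
        (.seq (fillRows K a c b)
          (.seq (fillCols K a b)
            (.seq (.setN (50 + b) (.reg 11))
              (.seq (p.counted (50 + b) 20)
                (.seq (harvestProg (50 + b + 2))
                  (.seq (.setN 20 (.add (.reg 20) (.reg 25)))
                    (.setN 21 (.add (.reg 21) (.const 1)))))))))))

/-- Bucket `k` has an inner tuple that fits to the row tuple `r` and to the column tuple `q`. -/
def Wit (K : Task) (n a c b : ℕ) (A L : ℕ → ℕ) (D k r q : ℕ) : Prop :=
  ∃ p, p / D = k ∧ p < n ^ b ∧ Valid A n K.R K.N K.h (rowSet a c) (r + n ^ (a + c) * L p) ∧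
    Valid A n K.R K.N K.h (colSet a) (n ^ a * q + n ^ (a + c) * L p)

/-- The registers that do not depend on the block size. -/
structure Ready (a c b n : ℕ) (A L : ℕ → ℕ) (w : ℕ → ℝ) (cap : ℕ) (s : State) : Prop where
  h0 : s.nreg 0 = n
  h30 : s.nreg 30 = n ^ a
  h31 : s.nreg 31 = n ^ c
  h32 : s.nreg 32 = n ^ b
  h33 : s.nreg 33 = n ^ (a + c)
  h35 : s.nreg 35 = cap
  h40 : s.nreg 40 = 1
  hA : s.narr 0 = A
  hL : s.narr (10 + b) = L
  hw : s.rarr 0 = w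

theorem Ready.congr {a c b n : ℕ} {A L : ℕ → ℕ} {w : ℕ → ℝ} {cap : ℕ} {s s' : State}
    (h : Ready a c b n A L w cap s)
    (hreg : ∀ x, x = 0 ∨ 30 ≤ x ∧ x ≤ 35 ∨ x = 40 → s'.nreg x = s.nreg x)
    (hA : s'.narr 0 = s.narr 0) (hL : s'.narr (10 + b) = s.narr (10 + b))
    (hw : s'.rarr 0 = s.rarr 0) : Ready a c b n A L w cap s' where
  h0 := by rw [hreg 0 (by omega), h.h0]
  h30 := by rw [hreg 30 (by omega), h.h30]
  h31 := by rw [hreg 31 (by omega), h.h31]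
  h32 := by rw [hreg 32 (by omega), h.h32]
  h33 := by rw [hreg 33 (by omega), h.h33]
  h35 := by rw [hreg 35 (by omega), h.h35]
  h40 := by rw [hreg 40 (by omega), h.h40]
  hA := hA.trans h.hA
  hL := hL.trans h.hL
  hw := hw.trans h.hw

/-- Number of blocks of the given size. -/
def numBlocks (n a c b D : ℕ) : ℕ := (n ^ b / D + 1) * ((n ^ a / D + 1) * (n ^ c / D + 1))

/-- The registers that depend on the block size only. -/
structure Sized (a c b n D : ℕ) (s : State) : Prop where
  h11 : s.nreg 11 = D
  h22 : s.nreg 22 = numBlocks n a c b D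
  h23 : s.nreg 23 = n ^ a / D + 1
  h24 : s.nreg 24 = n ^ c / D + 1
  h25 : s.nreg 25 = D * D
  h34 : s.nreg 34 = (n + 1) ^ (a + c) * D

theorem Sized.congr {a c b n D : ℕ} {s s' : State} (h : Sized a c b n D s)
    (hreg : ∀ x, x = 11 ∨ 22 ≤ x ∧ x ≤ 25 ∨ x = 34 → s'.nreg x = s.nreg x) :
    Sized a c b n D s' where
  h11 := by rw [hreg 11 (by omega), h.h11]
  h22 := by rw [hreg 22 (by omega), h.h22]
  h23 := by rw [hreg 23 (by omega), h.h23]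
  h24 := by rw [hreg 24 (by omega), h.h24]
  h25 := by rw [hreg 25 (by omega), h.h25]
  h34 := by rw [hreg 34 (by omega), h.h34]

/-- Words are long enough for block size `D`. -/
structure Room (h n a c b d : ℕ) (τ : ℕ → ℕ) (W D : ℕ) : Prop where
  pow : 2 * (n + 1) ^ h ≤ W
  size : D ≤ (n + 1) ^ h
  mult : (D + 2) ^ d ≤ W
  total : numBlocks n a c b D * (D * D + τ D) ≤ W
  budget : (n + 1) ^ (a + c) * D ≤ W

section block

variable {K : Task} {a c b : ℕ} {p : Prog}

theorem modN_blockProg {x : ℕ} (h : (blockProg K a c b p).ModN x) :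
    x = 6 ∨ x = 20 ∨ x = 21 ∨ 26 ≤ x ∧ x ≤ 29 ∨ 36 ≤ x ∧ x ≤ 39 ∨ 50 + b ≤ x := by
  simp only [blockProg, fillRows, fillCols, Prog.ModN, modN_fillProg, modN_harvestProg] at h
  rcases h with h | h | h | h | h | h | h | h | h | h
  iterate 6 omega
  · have := Prog.modN_counted h
    omega
  iterate 3 omega

theorem modA_blockProg {x : ℕ} (h : (blockProg K a c b p).ModA x) : x = 3 ∨ 50 + b ≤ x := by
  simp only [blockProg, fillRows, fillCols, Prog.ModA, modA_fillProg, modA_harvestProg,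
    false_or, or_false] at h
  rcases h with h | h | h | h
  iterate 2 omega
  · exact .inr (Prog.modA_counted h)
  · omega

theorem modR_blockProg {x : ℕ} (h : (blockProg K a c b p).ModR x) : 50 + b ≤ x := by
  simp only [blockProg, fillRows, fillCols, Prog.ModR, modR_fillProg, modR_harvestProg,
    false_or, or_false] at h
  exact Prog.modR_counted h

theorem Ready.of_unch {n : ℕ} {A L : ℕ → ℕ} {w : ℕ → ℝ} {cap : ℕ} {s s' : State}
    (h : Ready a c b n A L w cap s) (hu : Unch (blockProg K a c b p) s s') :
    Ready a c b n A L w cap s' := by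
  refine h.congr (fun x hx => hu.nreg x fun hm => ?_) (hu.narr 0 fun hm => ?_)
    (hu.narr (10 + b) fun hm => ?_) (hu.rarr 0 fun hm => ?_)
  · have := modN_blockProg hm
    omega
  · have := modA_blockProg hm
    omega
  · have := modA_blockProg hm
    omega
  · have := modR_blockProg hm
    omega

theorem Sized.of_unch {n D : ℕ} {s s' : State} (h : Sized a c b n D s)
    (hu : Unch (blockProg K a c b p) s s') : Sized a c b n D s' := by
  refine h.congr (fun x hx => hu.nreg x fun hm => ?_)
  have := modN_blockProg hm
  omega

open Classical in
-- The true time is at most a constant times the increase `D * D + μ` of the counter, so register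
-- `20` is a faithful clock.
theorem runs_blockProg (K : Task) (a c b : ℕ) (p : Prog) : ∃ C : ℕ, ∀ {d : ℕ} {τ : ℕ → ℕ}
    {n : ℕ} {A L : ℕ → ℕ} {w : ℕ → ℝ} {cap W D m : ℕ} {s : State}, Multiplies p d τ →
    a + c + b = K.h → 2 ≤ K.h → 0 < n → 0 < D → Room K.h n a c b d τ W D →
    (∀ i < n ^ b, L i < n ^ b) → Ready a c b n A L w cap s → Sized a c b n D s →
    s.nreg 21 = m → m < numBlocks n a c b D → s.nreg 20 ≤ m * (D * D + τ D) →
    Runs W (blockProg K a c b p) s fun s' t => ∃ μ ≤ τ D, s'.nreg 20 = s.nreg 20 + (D * D + μ) ∧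
      t ≤ C * (D * D + μ) ∧ s'.nreg 21 = m + 1 ∧ ∀ r < n ^ a, ∀ q < n ^ c,
        s'.narr 3 (r + n ^ a * q) =
          if r / D = m / (n ^ c / D + 1) % (n ^ a / D + 1) ∧ q / D = m % (n ^ c / D + 1) ∧
            Wit K n a c b A L D (m / ((n ^ a / D + 1) * (n ^ c / D + 1))) r q ∧
            s.narr 3 (r + n ^ a * q) = 0
          then m / ((n ^ a / D + 1) * (n ^ c / D + 1)) + 1 else s.narr 3 (r + n ^ a * q) := by
  set f₁ := (fillStep K b (50 + b) 40 30 (rowSet a c) (offE 27 (.div (.reg 29) (.reg 11)))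
    (offE 26 (.mod (.reg 29) (.reg 11)))).passCost with hf₁
  set f₂ := (fillStep K b (50 + b + 1) 30 31 (colSet a) (offE 28 (.mod (.reg 29) (.reg 11)))
    (offE 26 (.div (.reg 29) (.reg 11)))).passCost with hf₂
  set f₃ := (harvestStep (50 + b + 2)).passCost with hf₃
  refine ⟨2 * (f₁ + f₂ + f₃ + 24) + 2 * p.passCost + 100, ?_⟩
  intro d τ n A L w cap W D m s hp hh h2 hn0 hD hR hLt hs hz h21 hm h20
  set k := m / ((n ^ a / D + 1) * (n ^ c / D + 1)) with hk
  set I := m / (n ^ c / D + 1) % (n ^ a / D + 1) with hI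
  set J := m % (n ^ c / D + 1) with hJ
  have hP : (n + 1) ^ K.h ≤ W := by have := hR.pow; omega
  have hle : ∀ i, i ≤ K.h → n ^ i ≤ (n + 1) ^ K.h := fun i hi =>
    le_trans (Nat.pow_le_pow_left (by omega) _) (Nat.pow_le_pow_right (by omega) hi)
  have hIle : I * D ≤ n ^ a := by
    have : I ≤ n ^ a / D := Nat.lt_succ_iff.1 (Nat.mod_lt _ (Nat.succ_pos _))
    exact (Nat.mul_le_mul_right _ this).trans (Nat.div_mul_le_self _ _)
  have hJle : J * D ≤ n ^ c := by
    have : J ≤ n ^ c / D := Nat.lt_succ_iff.1 (Nat.mod_lt _ (Nat.succ_pos _))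
    exact (Nat.mul_le_mul_right _ this).trans (Nat.div_mul_le_self _ _)
  have hkle : k * D ≤ n ^ b := by
    have : k < n ^ b / D + 1 := by
      refine Nat.div_lt_of_lt_mul ?_
      rw [mul_comm]
      exact hm
    exact (Nat.mul_le_mul_right _ (Nat.lt_succ_iff.1 this)).trans (Nat.div_mul_le_self _ _)
  have hDD : 0 < D * D := Nat.mul_pos hD hD
  have hR1 := hR.pow
  have hR2 := hR.size
  have ha := hle a (by omega)
  have hb := hle b (by omega)
  have hc := hle c (by omega)
  have htot : s.nreg 20 + (D * D + τ D) ≤ W := by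
    refine le_trans ?_ hR.total
    calc _ ≤ m * (D * D + τ D) + (D * D + τ D) := by omega
      _ = (m + 1) * (D * D + τ D) := by ring
      _ ≤ _ := Nat.mul_le_mul_right _ hm
  have hnum : numBlocks n a c b D ≤ W :=
    le_trans (Nat.le_mul_of_pos_right _ (by omega)) hR.total
  have hIJ : (n ^ a / D + 1) * (n ^ c / D + 1) ≤ W :=
    le_trans (Nat.le_mul_of_pos_left _ (Nat.succ_pos _)) hnum
  have hkm : k ≤ m := Nat.div_le_self _ _
  unfold blockProg
  simp only [runs_seq (p := .setN _ _), runs_setN, NExp.Fits, NExp.eval, State.nreg_setReg, h21,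
    hz.h23, hz.h24, Nat.reduceEqDiff, if_false, true_and, NExp.cost, ← hk, ← hI, ← hJ]
  refine ⟨hIJ, ?_⟩
  set s₁ := ((s.setReg 26 k).setReg 27 I).setReg 28 J with hs₁
  have h26₁ : s₁.nreg 26 = k := by simp [hs₁]
  have h27₁ : s₁.nreg 27 = I := by simp [hs₁]
  have h28₁ : s₁.nreg 28 = J := by simp [hs₁]
  have hreg₁ : ∀ x, x ≠ 26 → x ≠ 27 → x ≠ 28 → s₁.nreg x = s.nreg x := by
    intro x h1 h2 h3
    simp [hs₁, h1, h2, h3]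
  have harr₁ : s₁.narr = s.narr := rfl
  have hrarr₁ : s₁.rarr = s.rarr := rfl
  clear_value s₁
  have hs1 : Ready a c b n A L w cap s₁ := hs.congr (fun x hx => hreg₁ x (by omega) (by omega) (by omega))
    (by rw [harr₁]) (by rw [harr₁]) (by rw [hrarr₁])
  have hz1 : Sized a c b n D s₁ := hz.congr (fun x hx => hreg₁ x (by omega) (by omega) (by omega))
  have hdiv : ∀ e < D * D, e / D < D := fun e he => Nat.div_lt_of_lt_mul he
  have hmod : ∀ e : ℕ, e % D < D := fun e => Nat.mod_lt _ hD
  rw [runs_seq, fillRows]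
  refine (runs_fillProg (ac := a + c) (uv := 1) (lv := n ^ a) (Q := D * D)
    (row := fun e => I * D + e / D) (pos := fun e => k * D + e % D) hh h2 hn0 hP hs1.h0 hz1.h25
    (by omega) hs1.h40 hs1.h30 hs1.h32 hs1.h33 (by omega) (by omega) (by omega) ?_ ?_ ?_ ?_).conseq ?_
  · intro r hr
    rw [pow_add, one_mul]
    exact lt_of_lt_of_le hr (Nat.le_mul_of_pos_right _ (Nat.pow_pos hn0))
  · rw [hs1.hL]
    exact hLt
  · intro e he s' hs' h29
    have := hdiv e he
    simp only [offE, NExp.Fits, NExp.eval, h29, hs' 27 (by omega) (by omega) (by omega) (by omega),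
      hs' 11 (by omega) (by omega) (by omega) (by omega), h27₁, hz1.h11, true_and, and_true]
    constructor <;> omega
  · intro e he s' hs' h29
    have := hmod e
    simp only [offE, NExp.Fits, NExp.eval, h29, hs' 26 (by omega) (by omega) (by omega) (by omega),
      hs' 11 (by omega) (by omega) (by omega) (by omega), h26₁, hz1.h11, true_and, and_true]
    constructor <;> omega
  rintro s₂ t₂ hu₂ ⟨ht₂, hA₂⟩
  have hreg₂ : ∀ x, x ≠ 29 → x ≠ 36 → x ≠ 37 → x ≠ 6 → s₂.nreg x = s₁.nreg x := by
    intro x h1 h2 h3 h4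
    exact hu₂.nreg x fun h => by have := modN_fillProg.1 h; omega
  have harr₂ : ∀ x, x ≠ 50 + b → s₂.narr x = s₁.narr x := by
    intro x h1
    exact hu₂.narr x fun h => by have := modA_fillProg.1 h; omega
  have hrarr₂ : s₂.rarr = s₁.rarr := by
    funext x
    exact hu₂.rarr x modR_fillProg
  have hs2 : Ready a c b n A L w cap s₂ := hs1.congr
    (fun x hx => hreg₂ x (by omega) (by omega) (by omega) (by omega))
    (harr₂ _ (by omega)) (harr₂ _ (by omega)) (by rw [hrarr₂])
  have hz2 : Sized a c b n D s₂ := hz1.congr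
    (fun x hx => hreg₂ x (by omega) (by omega) (by omega) (by omega))
  rw [hs1.hA, hs1.hL] at hA₂
  rw [runs_seq, fillCols]
  refine (runs_fillProg (ac := a + c) (uv := n ^ a) (lv := n ^ c) (Q := D * D)
    (row := fun e => J * D + e % D) (pos := fun e => k * D + e / D) hh h2 hn0 hP hs2.h0 hz2.h25
    (by omega) hs2.h30 hs2.h31 hs2.h32 hs2.h33 (by omega) (by omega) (by omega) ?_ ?_ ?_ ?_).conseq ?_
  · intro r hr
    rw [pow_add]
    exact Nat.mul_lt_mul_of_pos_left hr (Nat.pow_pos hn0)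
  · rw [hs2.hL]
    exact hLt
  · intro e he s' hs' h29
    have := hmod e
    simp only [offE, NExp.Fits, NExp.eval, h29, hs' 28 (by omega) (by omega) (by omega) (by omega),
      hs' 11 (by omega) (by omega) (by omega) (by omega), hreg₂ 28 (by omega) (by omega) (by omega)
      (by omega), h28₁, hz2.h11, true_and, and_true]
    constructor <;> omega
  · intro e he s' hs' h29
    have := hdiv e he
    simp only [offE, NExp.Fits, NExp.eval, h29, hs' 26 (by omega) (by omega) (by omega) (by omega),
      hs' 11 (by omega) (by omega) (by omega) (by omega), hreg₂ 26 (by omega) (by omega) (by omega)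
      (by omega), h26₁, hz2.h11, true_and, and_true]
    constructor <;> omega
  rintro s₃ t₃ hu₃ ⟨ht₃, hB₃⟩
  have hreg₃ : ∀ x, x ≠ 29 → x ≠ 36 → x ≠ 37 → x ≠ 6 → s₃.nreg x = s₂.nreg x := by
    intro x h1 h2 h3 h4
    exact hu₃.nreg x fun h => by have := modN_fillProg.1 h; omega
  have harr₃ : ∀ x, x ≠ 50 + b + 1 → s₃.narr x = s₂.narr x := by
    intro x h1
    exact hu₃.narr x fun h => by have := modA_fillProg.1 h; omega
  have hrarr₃ : s₃.rarr = s₂.rarr := by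
    funext x
    exact hu₃.rarr x modR_fillProg
  have hs3 : Ready a c b n A L w cap s₃ := hs2.congr
    (fun x hx => hreg₃ x (by omega) (by omega) (by omega) (by omega))
    (harr₃ _ (by omega)) (harr₃ _ (by omega)) (by rw [hrarr₃])
  have hz3 : Sized a c b n D s₃ := hz2.congr
    (fun x hx => hreg₃ x (by omega) (by omega) (by omega) (by omega))
  rw [hs2.hA, hs2.hL] at hB₃
  rw [runs_seq, runs_setN, runs_seq]
  refine ⟨trivial, ?_⟩
  simp only [NExp.eval, hz3.h11, NExp.cost]
  set s₄ := s₃.setReg (50 + b) D with hs₄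
  have hreg₄ : ∀ x, x ≠ 50 + b → s₄.nreg x = s₃.nreg x := by
    intro x h1
    simp [hs₄, h1]
  have harr₄ : s₄.narr = s₃.narr := rfl
  have hrarr₄ : s₄.rarr = s₃.rarr := rfl
  have hq₄ : s₄.nreg (50 + b) = D := by simp [hs₄]
  clear_value s₄
  have h20₄ : s₄.nreg 20 = s.nreg 20 := by
    rw [hreg₄ 20 (by omega), hreg₃ 20, hreg₂ 20, hreg₁ 20] <;> omega
  have hent : ∀ x < D, ∀ y < D, x * D + y < D * D ∧ (x * D + y) / D = x ∧ (x * D + y) % D = y := by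
    intro x hx y hy
    refine ⟨?_, ?_, ?_⟩
    · calc x * D + y < (x + 1) * D := by rw [add_mul]; omega
        _ ≤ D * D := Nat.mul_le_mul_right _ hx
    · rw [mul_comm, Nat.mul_add_div hD, Nat.div_eq_of_lt hy, add_zero]
    · rw [mul_comm, Nat.mul_add_mod, Nat.mod_eq_of_lt hy]
  have hA₄ : ∀ x < D, ∀ y < D, s₄.narr (50 + b) (x * D + y) =
      if I * D + x < n ^ a ∧ k * D + y < n ^ b ∧ Valid A n K.R K.N K.h (rowSet a c)
        (I * D + x + n ^ (a + c) * L (k * D + y)) then 1 else 0 := by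
    intro x hx y hy
    obtain ⟨h1, h3, h4⟩ := hent x hx y hy
    rw [harr₄, harr₃ _ (by omega), hA₂ _ h1, h3, h4, one_mul]
  have hB₄ : ∀ x < D, ∀ y < D, s₄.narr (50 + b + 1) (x * D + y) =
      if J * D + y < n ^ c ∧ k * D + x < n ^ b ∧ Valid A n K.R K.N K.h (colSet a)
        (n ^ a * (J * D + y) + n ^ (a + c) * L (k * D + x)) then 1 else 0 := by
    intro x hx y hy
    obtain ⟨h1, h3, h4⟩ := hent x hx y hy
    rw [harr₄, hB₃ _ h1, h3, h4]
  refine (runs_multiply (T := 20) hp (by omega) hR.mult (by rw [h20₄]; omega) (by omega) hq₄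
    (fun x hx y hy => by rw [hA₄ x hx y hy]; split_ifs <;> omega)
    (fun x hx y hy => by rw [hB₄ x hx y hy]; split_ifs <;> omega)).conseq ?_
  rintro s₅ t₅ hu₅ ⟨μ, hμ, h20₅, ht₅, hC₅⟩
  have hreg₅ : ∀ x, x ≠ 20 → x < 50 + b → s₅.nreg x = s₄.nreg x := by
    intro x h1 h3
    exact hu₅.nreg x fun h => by have := Prog.modN_counted h; omega
  have harr₅ : ∀ x, x < 50 + b → s₅.narr x = s₄.narr x := by
    intro x h1
    exact hu₅.narr x fun h => by have := Prog.modA_counted h; omega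
  have hz5 : Sized a c b n D s₅ := hz3.congr (fun x hx => by
    rw [hreg₅ x (by omega) (by omega), hreg₄ x (by omega)])
  have hreg5 : ∀ x, x ≠ 20 → x ≠ 29 → x ≠ 36 → x ≠ 37 → x ≠ 6 → x < 50 + b →
      s₅.nreg x = s₁.nreg x := by
    intro x h1 h3 h4 h5 h6 h7
    rw [hreg₅ x h1 h7, hreg₄ x (by omega), hreg₃ x h3 h4 h5 h6, hreg₂ x h3 h4 h5 h6]
  have h3₅ : s₅.narr 3 = s.narr 3 := by
    rw [harr₅ 3 (by omega), harr₄, harr₃ 3 (by omega), harr₂ 3 (by omega), harr₁]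
  rw [runs_seq]
  refine (runs_harvestProg (t := 50 + b + 2) (W := W) (by omega) hz5.h11 hD hz5.h25 (by omega)
    ((hreg5 26 (by omega) (by omega) (by omega) (by omega) (by omega) (by omega)).trans h26₁)
    ((hreg5 27 (by omega) (by omega) (by omega) (by omega) (by omega) (by omega)).trans h27₁)
    ((hreg5 28 (by omega) (by omega) (by omega) (by omega) (by omega) (by omega)).trans h28₁)
    ((hreg5 30 (by omega) (by omega) (by omega) (by omega) (by omega) (by omega)).trans hs1.h30)
    ((hreg5 31 (by omega) (by omega) (by omega) (by omega) (by omega) (by omega)).trans hs1.h31)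
    (by omega) (by omega) ?_ (by omega)).conseq ?_
  · rw [← pow_add]
    exact (hle (a + c) (by omega)).trans hP
  rintro s₆ t₆ hu₆ ⟨ht₆, hH₆⟩
  have hreg₆ : ∀ x, x ≠ 29 → x ≠ 36 → x ≠ 37 → x ≠ 39 → s₆.nreg x = s₅.nreg x := by
    intro x h1 h3 h4 h5
    exact hu₆.nreg x fun h => by have := modN_harvestProg.1 h; omega
  have h20₆ : s₆.nreg 20 = s.nreg 20 + μ := by
    rw [hreg₆ 20 (by omega) (by omega) (by omega) (by omega), h20₅, h20₄]
  have h25₆ : s₆.nreg 25 = D * D := by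
    rw [hreg₆ 25 (by omega) (by omega) (by omega) (by omega), hz5.h25]
  have h21₆ : s₆.nreg 21 = m := by
    rw [hreg₆ 21 (by omega) (by omega) (by omega) (by omega), hreg5 21 (by omega) (by omega)
      (by omega) (by omega) (by omega) (by omega), hreg₁ 21 (by omega) (by omega) (by omega), h21]
  simp only [runs_seq, runs_setN, NExp.Fits, NExp.eval, State.nreg_setReg, h20₆, h25₆, h21₆,
    Nat.reduceEqDiff, if_false, if_true, true_and, NExp.cost]
  refine ⟨by omega, by omega, μ, hμ, by omega, ?_, ?_⟩
  · rw [← hf₁] at ht₂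
    rw [← hf₂] at ht₃
    rw [← hf₃] at ht₆
    have e1 : (D * D + 1) * (f₁ + 8) ≤ 2 * (D * D) * (f₁ + 8) :=
      Nat.mul_le_mul_right _ (by omega)
    have e2 : (D * D + 1) * (f₂ + 8) ≤ 2 * (D * D) * (f₂ + 8) :=
      Nat.mul_le_mul_right _ (by omega)
    have e3 : (D * D + 1) * (f₃ + 8) ≤ 2 * (D * D) * (f₃ + 8) :=
      Nat.mul_le_mul_right _ (by omega)
    have e4 : p.passCost * (μ + 1) ≤ p.passCost * (D * D + μ) :=
      Nat.mul_le_mul_left _ (by omega)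
    have e5 : 2 * (D * D) * (f₁ + 8) + 2 * (D * D) * (f₂ + 8) + 2 * (D * D) * (f₃ + 8) =
      2 * (f₁ + f₂ + f₃ + 24) * (D * D) := by ring
    have e6 : (2 * (f₁ + f₂ + f₃ + 24) + 2 * p.passCost + 100) * (D * D + μ) =
      2 * (f₁ + f₂ + f₃ + 24) * (D * D) + 2 * (f₁ + f₂ + f₃ + 24) * μ +
        p.passCost * (D * D + μ) + p.passCost * (D * D + μ) + 100 * (D * D + μ) := by ring
    have e7 : 0 ≤ 2 * (f₁ + f₂ + f₃ + 24) * μ := Nat.zero_le _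
    have e8 : 0 ≤ p.passCost * (D * D + μ) := Nat.zero_le _
    rw [e6]
    omega
  · intro r hr q hq
    simp only [State.narr_setReg]
    rw [hH₆ r hr q hq, h3₅]
    congr 1
    refine propext (and_congr_right fun hrI => and_congr_right fun hqJ => and_congr_left fun _ => ?_)
    have hr' : I * D + r % D = r := by rw [← hrI, Nat.div_add_mod']
    have hq' : J * D + q % D = q := by rw [← hqJ, Nat.div_add_mod']
    -- The summand of index `z` belongs to the inner tuple at position `k * D + z`; it is positive
    -- exactly if that tuple fits both the row and the column.
    rw [hC₅ _ (hmod r) _ (hmod q), Finset.sum_pos_iff]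
    constructor
    · rintro ⟨z, hz, hpos⟩
      have hzD := Finset.mem_range.1 hz
      rw [hA₄ _ (hmod r) _ hzD, hB₄ _ hzD _ (hmod q), hr', hq'] at hpos
      split_ifs at hpos with h1 h3
      · refine ⟨k * D + z, ?_, h1.2.1, h1.2.2, h3.2.2⟩
        rw [mul_comm, Nat.mul_add_div hD, Nat.div_eq_of_lt hzD, add_zero]
      all_goals simp at hpos
    · rintro ⟨i, hik, hib, h1, h3⟩
      have hi' : k * D + i % D = i := by rw [← hik, Nat.div_add_mod']
      refine ⟨i % D, Finset.mem_range.2 (hmod i), ?_⟩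
      rw [hA₄ _ (hmod r) _ (hmod i), hB₄ _ (hmod i) _ (hmod q), hr', hq', hi',
        if_pos ⟨hr, hib, h1⟩, if_pos ⟨hq, hib, h3⟩]
      simp

end block


/-! ### Processing all blocks of one size -/

/-- The state of array `3` after the first `m` blocks: for every pair of a row and a column tuple,
one plus the first bucket with a fitting inner tuple, or zero. -/
def BestInv (K : Task) (n a c b : ℕ) (A L : ℕ → ℕ) (D m : ℕ) (best : ℕ → ℕ) : Prop :=
  ∀ r < n ^ a, ∀ q < n ^ c,
    (∀ k, (k * (n ^ a / D + 1) + r / D) * (n ^ c / D + 1) + q / D < m → Wit K n a c b A L D k r q →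
      best (r + n ^ a * q) ≠ 0 ∧ best (r + n ^ a * q) ≤ k + 1) ∧
    (best (r + n ^ a * q) ≠ 0 → Wit K n a c b A L D (best (r + n ^ a * q) - 1) r q ∧
      ((best (r + n ^ a * q) - 1) * (n ^ a / D + 1) + r / D) * (n ^ c / D + 1) + q / D < m)

/-- Block numbers are mixed-radix numerals, and this is the uniqueness of their digits;
`index_of_block` is the converse. -/
theorem block_index {m x y k i j : ℕ} (hi : i < x) (hj : j < y) (h : (k * x + i) * y + j = m) :
    k = m / (x * y) ∧ i = m / y % x ∧ j = m % y := by
  have h1 : m / y = k * x + i := by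
    rw [← h, mul_comm, Nat.mul_add_div (by omega), Nat.div_eq_of_lt hj, add_zero]
  refine ⟨?_, ?_, ?_⟩
  · rw [mul_comm x y, ← Nat.div_div_eq_div_mul, h1, mul_comm, Nat.mul_add_div (by omega),
      Nat.div_eq_of_lt hi, add_zero]
  · rw [h1, mul_comm, Nat.mul_add_mod, Nat.mod_eq_of_lt hi]
  · rw [← h, mul_comm, Nat.mul_add_mod, Nat.mod_eq_of_lt hj]

theorem index_of_block {m x y : ℕ} (k i j : ℕ) (hk : k = m / (x * y)) (hi : i = m / y % x)
    (hj : j = m % y) : (k * x + i) * y + j = m := by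
  subst hk hi hj
  rw [mul_comm x y, ← Nat.div_div_eq_div_mul, Nat.div_add_mod', Nat.div_add_mod']

open Classical in
-- Block `m` affects only the pairs lying in its row and column block. For these, all smaller
-- buckets have been treated before, so a zero entry shows that no earlier bucket has a witness.
theorem BestInv.step {K : Task} {n a c b : ℕ} {A L : ℕ → ℕ} {D m : ℕ} {best best' : ℕ → ℕ}
    (h : BestInv K n a c b A L D m best)
    (h' : ∀ r < n ^ a, ∀ q < n ^ c, best' (r + n ^ a * q) =
      if r / D = m / (n ^ c / D + 1) % (n ^ a / D + 1) ∧ q / D = m % (n ^ c / D + 1) ∧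
        Wit K n a c b A L D (m / ((n ^ a / D + 1) * (n ^ c / D + 1))) r q ∧
        best (r + n ^ a * q) = 0
      then m / ((n ^ a / D + 1) * (n ^ c / D + 1)) + 1 else best (r + n ^ a * q)) :
    BestInv K n a c b A L D (m + 1) best' := by
  intro r hr q hq
  obtain ⟨h1, h2⟩ := h r hr q hq
  have hrD : r / D < n ^ a / D + 1 := Nat.lt_succ_of_le (Nat.div_le_div_right hr.le)
  have hqD : q / D < n ^ c / D + 1 := Nat.lt_succ_of_le (Nat.div_le_div_right hq.le)
  rw [h' r hr q hq]
  set x := n ^ a / D + 1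
  set y := n ^ c / D + 1
  set v := best (r + n ^ a * q)
  by_cases hc : r / D = m / y % x ∧ q / D = m % y ∧ Wit K n a c b A L D (m / (x * y)) r q ∧ v = 0
  · rw [if_pos hc]
    have hm := index_of_block _ _ _ rfl hc.1 hc.2.1
    refine ⟨fun k hk hw => ⟨Nat.succ_ne_zero _, ?_⟩, fun _ => ?_⟩
    · rcases Nat.lt_succ_iff_lt_or_eq.1 hk with h3 | h3
      · exact absurd hc.2.2.2 (h1 k h3 hw).1
      · rw [(block_index hrD hqD h3).1]
    · rw [Nat.add_sub_cancel]
      exact ⟨hc.2.2.1, Nat.lt_succ_of_le hm.le⟩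
  · rw [if_neg hc]
    refine ⟨fun k hk hw => ?_, fun hv => ⟨(h2 hv).1, by have := (h2 hv).2; omega⟩⟩
    rcases Nat.lt_succ_iff_lt_or_eq.1 hk with h3 | h3
    · exact h1 k h3 hw
    · obtain ⟨e1, e2, e3⟩ := block_index hrD hqD h3
      have hv : v ≠ 0 := fun hv => hc ⟨e2, e3, e1 ▸ hw, hv⟩
      refine ⟨hv, ?_⟩
      have h4 := (h2 hv).2
      -- For a fixed pair the block number increases with the bucket. A stored bucket beyond `k`
      -- would therefore have a block number of at least `m`, although that block has already been
      -- processed.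
      by_contra hlt
      have h5 : k + 1 ≤ v - 1 := by omega
      have h6 : (k * x + r / D) * y ≤ ((v - 1) * x + r / D) * y :=
        Nat.mul_le_mul_right _ (add_le_add (Nat.mul_le_mul_right _ (by omega)) le_rfl)
      omega

/-- The `k`-th power of the successor of the number in register `0`. -/
def succPowE : ℕ → NExp
  | 0 => .const 1
  | k + 1 => .mul (succPowE k) (.add (.reg 0) (.const 1))

theorem eval_succPowE (s : State) (k : ℕ) : (succPowE k).eval s = (s.nreg 0 + 1) ^ k := by
  induction k with
  | zero => rfl
  | succ k ih => simp [succPowE, NExp.eval, ih, pow_succ]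

theorem fits_succPowE {W : ℕ} {s : State} {n k : ℕ} (hn : s.nreg 0 = n) (h : (n + 1) ^ k ≤ W) :
    (succPowE k).Fits W s := by
  induction k with
  | zero => trivial
  | succ k ih =>
    have h1 : (n + 1) ^ k ≤ (n + 1) ^ (k + 1) := Nat.pow_le_pow_right (by omega) (by omega)
    have h2 : (n + 1) ^ 1 ≤ (n + 1) ^ (k + 1) := Nat.pow_le_pow_right (by omega) (by omega)
    refine ⟨ih (h1.trans h), ⟨trivial, trivial, ?_⟩, ?_⟩
    · simp only [NExp.eval, hn]
      rw [pow_one] at h2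
      omega
    · rw [eval_succPowE]
      simp only [NExp.eval, hn]
      rwa [← pow_succ]

/-- Continue with the next block, unless the time is over and the block size can be doubled. -/
def moreBlocks : BExp :=
  .and (.lt (.reg 21) (.reg 22))
    (.not (.and (.lt (.reg 34) (.reg 20)) (.not (.lt (.reg 35) (.add (.reg 11) (.reg 11))))))

noncomputable def blockLoop (K : Task) (a c b : ℕ) (p : Prog) : Prog :=
  .loop moreBlocks (blockProg K a c b p)

def clearBest : Prog := forLoop 29 33 (.putN 3 (.reg 29) (.const 0))

noncomputable def attemptProg (K : Task) (a c b : ℕ) (p : Prog) : Prog :=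
  .seq (.setN 25 (.mul (.reg 11) (.reg 11)))
    (.seq (.setN 23 (.add (.div (.reg 30) (.reg 11)) (.const 1)))
      (.seq (.setN 24 (.add (.div (.reg 31) (.reg 11)) (.const 1)))
        (.seq (.setN 22 (.mul (.add (.div (.reg 32) (.reg 11)) (.const 1))
            (.mul (.reg 23) (.reg 24))))
          (.seq (.setN 34 (.mul (succPowE (a + c)) (.reg 11)))
            (.seq (.setN 20 (.const 0))
              (.seq (.setN 21 (.const 0))
                (.seq clearBest (blockLoop K a c b p))))))))

section attempt

variable {K : Task} {a c b : ℕ} {p : Prog}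

theorem modN_attemptProg {x : ℕ} (h : (attemptProg K a c b p).ModN x) :
    x = 6 ∨ 20 ≤ x ∧ x ≤ 29 ∨ 34 = x ∨ 36 ≤ x ∧ x ≤ 39 ∨ 50 + b ≤ x := by
  simp only [attemptProg, clearBest, blockLoop, Prog.ModN, modN_forLoop, or_false] at h
  rcases h with h | h | h | h | h | h | h | h | h
  iterate 8 omega
  · have := modN_blockProg h
    omega

theorem modA_attemptProg {x : ℕ} (h : (attemptProg K a c b p).ModA x) : x = 3 ∨ 50 + b ≤ x := by
  simp only [attemptProg, clearBest, blockLoop, Prog.ModA, modA_forLoop, false_or] at h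
  rcases h with h | h
  · exact .inl h
  · exact modA_blockProg h

theorem modR_attemptProg {x : ℕ} (h : (attemptProg K a c b p).ModR x) : 50 + b ≤ x := by
  simp only [attemptProg, clearBest, blockLoop, Prog.ModR, modR_forLoop, false_or] at h
  exact modR_blockProg h

/-- What holds after the blocks have been processed, the number in register `20` being `T`. -/
structure Attempted (K : Task) (a c b n : ℕ) (A L : ℕ → ℕ) (w : ℕ → ℝ) (cap D : ℕ) (τ : ℕ → ℕ)
    (T : ℕ) (s : State) : Prop where
  ready : Ready a c b n A L w cap s
  sized : Sized a c b n D s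
  hm : s.nreg 21 ≤ numBlocks n a c b D
  time : T ≤ numBlocks n a c b D * (D * D + τ D)
  budget : cap < 2 * D ∨ T ≤ (n + 1) ^ (a + c) * D + (D * D + τ D)
  failed : s.nreg 21 < numBlocks n a c b D → (n + 1) ^ (a + c) * D < T ∧ 2 * D ≤ cap
  best : s.nreg 21 = numBlocks n a c b D →
    BestInv K n a c b A L D (numBlocks n a c b D) (s.narr 3)

/-- The clock is tested before every block, so it can pass the budget by the cost of one block at
most. Only the largest admissible block size is allowed to ignore the budget. -/
theorem runs_blockLoop (K : Task) (a c b : ℕ) (p : Prog) : ∃ C : ℕ, ∀ {d : ℕ} {τ : ℕ → ℕ}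
    {n : ℕ} {A L : ℕ → ℕ} {w : ℕ → ℝ} {cap W D : ℕ} {s : State}, Multiplies p d τ →
    a + c + b = K.h → 2 ≤ K.h → 0 < n → 0 < D → Room K.h n a c b d τ W D →
    (∀ i < n ^ b, L i < n ^ b) → Ready a c b n A L w cap s → Sized a c b n D s →
    s.nreg 21 = 0 → s.nreg 20 = 0 → (∀ y < n ^ (a + c), s.narr 3 y = 0) →
    Runs W (blockLoop K a c b p) s fun s' t => ∃ T, t ≤ C * (T + 1) ∧
      Attempted K a c b n A L w cap D τ T s' := by
  obtain ⟨C, hC⟩ := runs_blockProg K a c b p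
  refine ⟨C + moreBlocks.cost + 1, ?_⟩
  intro d τ n A L w cap W D s hp hh h2 hn0 hD hR hLt hs hz h21 h20 h3
  have hDD : 0 < D * D := Nat.mul_pos hD hD
  set per := D * D + τ D with hper
  set tot := numBlocks n a c b D with htot
  refine (runs_loop (fun s' e => Ready a c b n A L w cap s' ∧ Sized a c b n D s' ∧
    s'.nreg 21 ≤ tot ∧ s'.nreg 20 ≤ s'.nreg 21 * per ∧
    (cap < 2 * D ∨ s'.nreg 20 ≤ (n + 1) ^ (a + c) * D + per) ∧
    BestInv K n a c b A L D (s'.nreg 21) (s'.narr 3) ∧ e ≤ (C + moreBlocks.cost + 1) * s'.nreg 20)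
    (fun s' => tot - s'.nreg 21) (e := 0) ?_ ?_).mono ?_
  · rintro s₁ e ⟨hs₁, hz₁, hm, hT, hbud, hbest, he⟩
    have hsize : D + D ≤ W := by
      have := hR.pow
      have := hR.size
      omega
    refine ⟨⟨⟨trivial, trivial⟩, ⟨trivial, trivial⟩, trivial, trivial, trivial, ?_⟩, fun hb => ?_⟩
    · simpa only [NExp.eval, hz₁.h11] using hsize
    · simp only [moreBlocks, BExp.Holds, NExp.eval, hz₁.h22, hz₁.h34, hs₁.h35, hz₁.h11] at hb
      refine (hC hp hh h2 hn0 hD hR hLt hs₁ hz₁ rfl hb.1 hT).conseq ?_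
      rintro s₂ t₂ hu₂ ⟨μ, hμ, hT₂, ht₂, hm₂, hb₂⟩
      refine ⟨⟨hs₁.of_unch hu₂, hz₁.of_unch hu₂, by omega, ?_, ?_, ?_, ?_⟩, by omega⟩
      · rw [hT₂, hm₂, add_mul, one_mul]
        omega
      · by_cases h : cap < 2 * D
        · exact .inl h
        · right
          have : ¬ (n + 1) ^ (a + c) * D < s₁.nreg 20 := fun hlt => hb.2 ⟨hlt, by omega⟩
          omega
      · rw [hm₂]
        exact hbest.step hb₂
      · rw [hT₂, mul_add]
        have e1 : (C + moreBlocks.cost + 1) * (D * D + μ) =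
          C * (D * D + μ) + (moreBlocks.cost + 1) * (D * D + μ) := by ring
        -- Each block advances the clock by at least one, which pays for the loop test.
        have e2 : (moreBlocks.cost + 1) * 1 ≤ (moreBlocks.cost + 1) * (D * D + μ) :=
          Nat.mul_le_mul_left _ (by omega)
        omega
  · refine ⟨hs, hz, by omega, by omega, by omega, ?_, by omega⟩
    intro r hr q hq
    have : s.narr 3 (r + n ^ a * q) = 0 := h3 _ (add_mul_lt_pow hr hq)
    rw [this, h21]
    simp
  · rintro s₁ t₁ ⟨e, ⟨hs₁, hz₁, hm, hT, hbud, hbest, he⟩, hnb, ht⟩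
    refine ⟨s₁.nreg 20, ?_, hs₁, hz₁, hm, hT.trans (Nat.mul_le_mul_right _ hm), hbud, ?_, ?_⟩
    · rw [mul_add]
      omega
    · intro hlt
      simp only [moreBlocks, BExp.Holds, NExp.eval, hz₁.h22, hz₁.h34, hs₁.h35, hz₁.h11] at hnb
      by_contra h
      exact hnb ⟨hlt, fun h' => h ⟨h'.1, by have := h'.2; omega⟩⟩
    · intro heq
      rwa [heq] at hbest

theorem runs_attemptProg (K : Task) (a c b : ℕ) (p : Prog) : ∃ C : ℕ, ∀ {d : ℕ} {τ : ℕ → ℕ}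
    {n : ℕ} {A L : ℕ → ℕ} {w : ℕ → ℝ} {cap W D : ℕ} {s : State}, Multiplies p d τ →
    a + c + b = K.h → 2 ≤ K.h → 0 < n → 0 < D → Room K.h n a c b d τ W D →
    (∀ i < n ^ b, L i < n ^ b) → Ready a c b n A L w cap s → s.nreg 11 = D →
    Runs W (attemptProg K a c b p) s fun s' t => ∃ T, t ≤ C * (n ^ (a + c) + T + 1) ∧
      Attempted K a c b n A L w cap D τ T s' := by
  obtain ⟨C, hC⟩ := runs_blockLoop K a c b p
  refine ⟨C + (succPowE (a + c)).cost + 60, ?_⟩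
  intro d τ n A L w cap W D s hp hh h2 hn0 hD hR hLt hs h11
  have hDD : 0 < D * D := Nat.mul_pos hD hD
  have hle : ∀ i, i ≤ K.h → n ^ i ≤ (n + 1) ^ K.h := fun i hi =>
    le_trans (Nat.pow_le_pow_left (by omega) _) (Nat.pow_le_pow_right (by omega) hi)
  have hP := hR.pow
  have hone : 1 ≤ (n + 1) ^ K.h := Nat.one_le_pow _ _ (by omega)
  have hac := hle (a + c) (by omega)
  have hdiv : ∀ i, i ≤ K.h → n ^ i / D + 1 ≤ W := fun i hi => by
    have := hle i hi
    have := Nat.div_le_self (n ^ i) D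
    omega
  have hnum : numBlocks n a c b D ≤ W :=
    le_trans (Nat.le_mul_of_pos_right _ (by omega)) hR.total
  have hIJ : (n ^ a / D + 1) * (n ^ c / D + 1) ≤ W :=
    le_trans (Nat.le_mul_of_pos_left _ (Nat.succ_pos _)) hnum
  have hDDW : D * D ≤ W := by
    refine le_trans ?_ hR.total
    refine le_trans ?_ (Nat.le_mul_of_pos_left _
      (Nat.mul_pos (Nat.succ_pos _) (Nat.mul_pos (Nat.succ_pos _) (Nat.succ_pos _))))
    omega
  have hpW : (n + 1) ^ (a + c) ≤ W :=
    le_trans (Nat.pow_le_pow_right (by omega) (by omega : a + c ≤ K.h)) (by omega)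
  unfold attemptProg
  simp only [runs_seq, runs_setN, NExp.Fits, NExp.eval, State.nreg_setReg, h11, hs.h30, hs.h31,
    hs.h32, Nat.reduceEqDiff, if_false, if_true, true_and, and_true, NExp.cost, eval_succPowE, hs.h0,
    OfNat.zero_ne_ofNat]
  refine ⟨hDDW, hdiv a (by omega), hdiv c (by omega), ⟨hdiv b (by omega), hIJ, hnum⟩,
    ⟨fits_succPowE (by simp [hs.h0]) hpW, hR.budget⟩, ?_⟩
  set s₁ := (((((((s.setReg 25 (D * D)).setReg 23 (n ^ a / D + 1)).setReg 24
    (n ^ c / D + 1)).setReg 22 ((n ^ b / D + 1) * ((n ^ a / D + 1) * (n ^ c / D + 1)))).setReg 34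
    ((n + 1) ^ (a + c) * D)).setReg 20 0).setReg 21 0) with hs₁
  have hs1 : Ready a c b n A L w cap s₁ := by
    constructor <;> simp [hs₁, hs.h0, hs.h30, hs.h31, hs.h32, hs.h33, hs.h35, hs.h40, hs.hA, hs.hL,
      hs.hw]
  have hz1 : Sized a c b n D s₁ := by
    constructor <;> simp [hs₁, h11, numBlocks]
  have h20₁ : s₁.nreg 20 = 0 := by simp [hs₁]
  have h21₁ : s₁.nreg 21 = 0 := by simp [hs₁]
  clear_value s₁
  refine (runs_forLoop (fun j s' => ∀ y < j, s'.narr 3 y = 0) 3 hs1.h33 (by omega) (by omega)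
    (by simp [Prog.ModN]) (by simp [Prog.ModN]) (by simp) ?_).conseq ?_
  · intro j s' hj h29 _ ih
    rw [runs_putN]
    refine ⟨trivial, trivial, le_rfl, fun y hy => ?_⟩
    simp only [State.narr_setReg, State.narr_setCell, NExp.eval, h29, true_and]
    split_ifs with h
    · rfl
    · exact ih y (by omega)
  · rintro s₂ t₂ hu₂ ⟨ht₂, h3₂⟩
    have hreg₂ : ∀ x, x ≠ 29 → s₂.nreg x = s₁.nreg x := fun x hx =>
      hu₂.nreg x (by simpa [modN_forLoop, Prog.ModN] using hx)
    have harr₂ : ∀ x, x ≠ 3 → s₂.narr x = s₁.narr x := fun x hx =>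
      hu₂.narr x (by simpa [modA_forLoop, Prog.ModA] using hx)
    have hs2 : Ready a c b n A L w cap s₂ := hs1.congr (fun x hx => hreg₂ x (by omega))
      (harr₂ _ (by omega)) (harr₂ _ (by omega)) (hu₂.rarr 0 (by simp [modR_forLoop, Prog.ModR]))
    have hz2 : Sized a c b n D s₂ := hz1.congr (fun x hx => hreg₂ x (by omega))
    refine (hC hp hh h2 hn0 hD hR hLt hs2 hz2 (by rw [hreg₂ 21 (by omega), h21₁])
      (by rw [hreg₂ 20 (by omega), h20₁]) h3₂).mono ?_
    rintro s₃ t₃ ⟨T, ht₃, hT⟩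
    refine ⟨T, ?_, hT⟩
    generalize (succPowE (a + c)).cost = u
    have e1 : (C + u + 60) * (n ^ (a + c) + T + 1) = C * (T + 1) + C * n ^ (a + c) +
      u * (n ^ (a + c) + T + 1) + 60 * (n ^ (a + c) + T + 1) := by ring
    have e2 : u * 1 ≤ u * (n ^ (a + c) + T + 1) := Nat.mul_le_mul_left _ (by omega)
    have e3 : 0 ≤ C * n ^ (a + c) := Nat.zero_le _
    omega

end attempt


/-! ### Finding a block size -/

/-- Register `42` signals success. An attempt has failed exactly if some blocks are left. -/
noncomputable def doublingProg (K : Task) (a c b : ℕ) (p : Prog) : Prog :=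
  .loop (.eq (.reg 42) (.const 0)) (.seq (attemptProg K a c b p)
    (.ite (.lt (.reg 21) (.reg 22)) (.setN 11 (.add (.reg 11) (.reg 11))) (.setN 42 (.const 1))))

/-- The block size `D`, with a multiplication time controlled by `T`, that the doubling search yields:
either it is maximal or the time `T` is within the budget, and the next smaller block size was
rejected because the multiplication time exceeded its budget. -/
structure GoodSize (n a c b : ℕ) (τ : ℕ → ℕ) (cap C₀ D T : ℕ) : Prop where
  pos : 0 < D
  le : D ≤ cap
  time : T ≤ numBlocks n a c b D * (D * D + τ D)
  budget : cap < 2 * D ∨ T ≤ (C₀ + 1) * ((n + 1) ^ (a + c) * D)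
  prev : D = 1 ∨ ∃ D', D = 2 * D' ∧
    (n + 1) ^ (a + c) * D' < numBlocks n a c b D' * (D' * D' + τ D')

section doubling

variable {K : Task} {a c b : ℕ} {p : Prog}

theorem modN_doublingProg {x : ℕ} (h : (doublingProg K a c b p).ModN x) :
    x = 6 ∨ x = 11 ∨ 20 ≤ x ∧ x ≤ 29 ∨ 34 = x ∨ 36 ≤ x ∧ x ≤ 42 ∧ x ≠ 40 ∨ 50 + b ≤ x := by
  simp only [doublingProg, Prog.ModN] at h
  rcases h with h | h | h
  · have := modN_attemptProg h
    omega
  iterate 2 omega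

theorem modA_doublingProg {x : ℕ} (h : (doublingProg K a c b p).ModA x) : x = 3 ∨ 50 + b ≤ x := by
  simp only [doublingProg, Prog.ModA, or_false] at h
  exact modA_attemptProg h

theorem modR_doublingProg {x : ℕ} (h : (doublingProg K a c b p).ModR x) : 50 + b ≤ x := by
  simp only [doublingProg, Prog.ModR, or_false] at h
  exact modR_attemptProg h

/-- The budget `B D` is linear in `D`, so the costs of all failed attempts form a geometric sum
dominated by the budget of the final size. The rejection of the previous size is recorded for the
analysis in `GoodSize.le_rpow`. -/
theorem runs_doublingProg (K : Task) (a c b : ℕ) (p : Prog) (C₀ : ℕ) : ∃ C : ℕ, ∀ {d : ℕ}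
    {τ : ℕ → ℕ} {n : ℕ} {A L : ℕ → ℕ} {w : ℕ → ℝ} {cap W : ℕ} {s : State}, Multiplies p d τ →
    a + c + b = K.h → 2 ≤ K.h → 0 < n → 0 < cap →
    (∀ D, 0 < D → D ≤ cap → Room K.h n a c b d τ W D) →
    (∀ D, 0 < D → D ≤ cap → D * D + τ D ≤ C₀ * ((n + 1) ^ (a + c) * D)) →
    (∀ i < n ^ b, L i < n ^ b) → Ready a c b n A L w cap s → s.nreg 11 = 1 → s.nreg 42 = 0 →
    Runs W (doublingProg K a c b p) s fun s' t => ∃ D T, GoodSize n a c b τ cap C₀ D T ∧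
      t ≤ C * ((n + 1) ^ (a + c) * D + T) ∧ Ready a c b n A L w cap s' ∧ s'.nreg 11 = D ∧
      BestInv K n a c b A L D (numBlocks n a c b D) (s'.narr 3) := by
  obtain ⟨C, hC⟩ := runs_attemptProg K a c b p
  set G := C * (C₀ + 3) + 20 with hG
  refine ⟨2 * G + 4, ?_⟩
  intro d τ n A L w cap W s hp hh h2 hn0 hcap hR hper hLt hs h11 h42
  set B : ℕ → ℕ := fun D => (n + 1) ^ (a + c) * D with hB
  have hBpos : ∀ D, 0 < D → n ^ (a + c) + 1 ≤ 2 * B D := by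
    intro D hD
    have h1 : n ^ (a + c) ≤ (n + 1) ^ (a + c) := Nat.pow_le_pow_left (by omega) _
    have h3 : 1 ≤ (n + 1) ^ (a + c) := Nat.one_le_pow _ _ (by omega)
    have h4 : (n + 1) ^ (a + c) ≤ B D := Nat.le_mul_of_pos_right _ hD
    omega
  have hB1 : ∀ D, 0 < D → 1 ≤ B D := fun D hD => Nat.mul_pos (Nat.pow_pos (by omega)) hD
  refine (runs_loop (fun s' e => Ready a c b n A L w cap s' ∧
    ((s'.nreg 42 = 0 ∧ 0 < s'.nreg 11 ∧ s'.nreg 11 ≤ cap ∧ e ≤ G * B (s'.nreg 11) ∧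
        (s'.nreg 11 = 1 ∨ ∃ D', s'.nreg 11 = 2 * D' ∧
          B D' < numBlocks n a c b D' * (D' * D' + τ D'))) ∨
      (s'.nreg 42 = 1 ∧ ∃ T, GoodSize n a c b τ cap C₀ (s'.nreg 11) T ∧
        e ≤ G * B (s'.nreg 11) + G * (B (s'.nreg 11) + T) ∧
        BestInv K n a c b A L (s'.nreg 11) (numBlocks n a c b (s'.nreg 11)) (s'.narr 3))))
    -- During the search the block size grows but never exceeds `cap`; success makes the measure
    -- zero.
    (fun s' => if s'.nreg 42 = 0 then cap + 1 - s'.nreg 11 else 0) (e := 0) ?_ ?_).mono ?_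
  · rintro s₁ e ⟨hs₁, h⟩
    refine ⟨⟨trivial, trivial⟩, fun hb => ?_⟩
    simp only [BExp.Holds, NExp.eval] at hb
    obtain ⟨-, hD, hDc, he, hprev⟩ := h.resolve_right fun h => by omega
    generalize hDdef : s₁.nreg 11 = D at hD hDc he hprev
    have hRD := hR D hD hDc
    rw [runs_seq]
    refine (hC hp hh h2 hn0 hD hRD hLt hs₁ hDdef).conseq ?_
    rintro s₂ t₂ hu₂ ⟨T, ht₂, hT⟩
    have h42' : s₂.nreg 42 = 0 := by
      rw [hu₂.nreg 42 fun hm => by have := modN_attemptProg hm; omega, hb]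
    have hper' := hper D hD hDc
    have hBp := hBpos D hD
    have hB1' := hB1 D hD
    rw [runs_ite]
    simp only [BExp.Holds, NExp.eval, hT.sized.h22, BExp.cost, NExp.cost, hb, if_true]
    refine ⟨⟨trivial, trivial⟩, fun hlt => ?_, fun hlt => ?_⟩
    · obtain ⟨hf1, hf2⟩ := hT.failed hlt
      -- The last block may overshoot the budget. By `hper` it costs at most `C₀` further budgets.
      have hTle : T ≤ (C₀ + 1) * B D := by
        rcases hT.budget with h | h
        · omega
        · rw [add_mul, one_mul]
          change _ ≤ C₀ * B D at hper'
          change T ≤ B D + _ at h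
          omega
      rw [runs_setN]
      simp only [NExp.Fits, NExp.eval, NExp.cost, hT.sized.h11, State.nreg_setReg, h42',
        Nat.reduceEqDiff, if_true, if_false, true_and]
      refine ⟨?_, ⟨?_, .inl ⟨by omega, by omega, ?_, .inr ⟨D, by omega, ?_⟩⟩⟩, by omega⟩
      · have := hRD.pow
        have := hRD.size
        omega
      · exact hT.ready.congr (fun x hx => by simp; omega) rfl rfl rfl
      -- The `G * B D` spent earlier and the at most `G * B D` of this attempt together make `G * B
      -- (2 * D)`.
      · have e1 : B (D + D) = B D + B D := by simp only [hB]; ring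
        rw [e1, mul_add]
        have e2 : C * (n ^ (a + c) + T + 1) ≤ C * ((C₀ + 3) * B D) := by
          refine Nat.mul_le_mul_left _ ?_
          have : (C₀ + 3) * B D = (C₀ + 1) * B D + 2 * B D := by ring
          omega
        have e3 : G * B D = C * ((C₀ + 3) * B D) + 20 * B D := by rw [hG]; ring
        omega
      · exact lt_of_lt_of_le hf1 hT.time
    · have hmeq : s₂.nreg 21 = numBlocks n a c b D := le_antisymm hT.hm (not_lt.1 hlt)
      rw [runs_setN]
      simp only [NExp.Fits, NExp.eval, NExp.cost, hT.sized.h11, State.nreg_setReg, State.narr_setReg,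
        Nat.reduceEqDiff, if_true, if_false, true_and]
      refine ⟨⟨hT.ready.congr (fun x hx => by simp; omega) rfl rfl rfl, .inr ⟨T, ?_, ?_,
        hT.best hmeq⟩⟩, by omega⟩
      · refine ⟨hD, hDc, hT.time, hT.budget.imp id fun h => ?_, hprev⟩
        rw [add_mul, one_mul]
        omega
      · have e2 : C * (n ^ (a + c) + T + 1) ≤ C * (2 * B D + T) :=
          Nat.mul_le_mul_left _ (by omega)
        have e3 : G * (B D + T) = C * (2 * B D + T) + (C * (C₀ + 1) * B D + C * (C₀ + 2) * T +
          20 * B D + 20 * T) := by rw [hG]; ring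
        have e4 : 0 ≤ C * (C₀ + 1) * B D := Nat.zero_le _
        have e5 : 0 ≤ C * (C₀ + 2) * T := Nat.zero_le _
        omega
  · exact ⟨hs, .inl ⟨h42, by omega, by omega, by omega, .inl h11⟩⟩
  · rintro s₁ t₁ ⟨e, ⟨hs₁, h⟩, hnb, ht⟩
    simp only [BExp.Holds, NExp.eval, BExp.cost, NExp.cost] at hnb ht
    obtain ⟨-, T, hg, he, hbest⟩ := h.resolve_left fun h => hnb h.1
    refine ⟨_, T, hg, ?_, hs₁, rfl, hbest⟩
    have hB1' := hB1 _ hg.pos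
    have e1 : (2 * G + 4) * (B (s₁.nreg 11) + T) = G * B (s₁.nreg 11) +
      G * (B (s₁.nreg 11) + T) + (G * T + 4 * B (s₁.nreg 11) + 4 * T) := by ring
    change t₁ ≤ (2 * G + 4) * (B (s₁.nreg 11) + T)
    have e2 : 0 ≤ G * T := Nat.zero_le _
    omega

end doubling


/-! ### The search for one arrangement of the vertices of `H` -/

/-- On the row and inner positions the column tuple is invisible; `dig_col` is the counterpart. Thus
the entries of the two matrices speak about parts of one full tuple. -/
theorem dig_row {n a c r q z i : ℕ} (hr : r < n ^ a) (hq : q < n ^ c)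
    (hi : rowSet a c i) :
    dig n (r + n ^ a * q + n ^ (a + c) * z) i = dig n (r + n ^ (a + c) * z) i := by
  have hy : r + n ^ a * q < n ^ (a + c) := add_mul_lt_pow hr hq
  rcases hi with hi | hi
  · rw [dig_add_mul_of_lt (by omega), dig_add_mul_of_lt hi, dig_add_mul_of_lt (by omega)]
  · rw [dig_add_mul_of_le hy hi, dig_add_mul_of_le (by omega) hi]

theorem dig_col {n a c r q z i : ℕ} (hr : r < n ^ a) (hq : q < n ^ c) (hn : 0 < n)
    (hi : colSet a i) :
    dig n (r + n ^ a * q + n ^ (a + c) * z) i = dig n (n ^ a * q + n ^ (a + c) * z) i := by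
  have hy : r + n ^ a * q < n ^ (a + c) := add_mul_lt_pow hr hq
  rcases Nat.lt_or_ge i (a + c) with h | h
  · rw [dig_add_mul_of_lt h, dig_add_mul_of_lt h, dig_add_mul_of_le hr hi]
    have := dig_add_mul_of_le (n := n) (y := 0) (z := q) (Nat.pow_pos (n := a) hn) hi
    rw [← this, zero_add]
  · rw [dig_add_mul_of_le hy h, dig_add_mul_of_le (by omega) h]

/-- The correctness of the method: the bucket stored for the outer part of a valid tuple contains an
inner tuple that is also valid with it and no lighter. The scan of that bucket then finds a solution
at least as good. -/
theorem exists_better {K : Task} {n a c b : ℕ} {A L best : ℕ → ℕ} {w : ℕ → ℝ} {D : ℕ}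
    (hh : a + c + b = K.h) (hn : 0 < n)
    (hL : SortedList L (wt w n b) (n ^ b))
    (hbest : BestInv K n a c b A L D (numBlocks n a c b D) best) {x : ℕ} (hx : x < n ^ K.h)
    (hv : Valid A n K.R K.N K.h (fun _ => True) x) :
    ∃ p < n ^ b, best (x % n ^ (a + c)) ≠ 0 ∧ p / D = best (x % n ^ (a + c)) - 1 ∧
      Valid A n K.R K.N K.h (fun _ => True) (x % n ^ (a + c) + n ^ (a + c) * L p) ∧
      wt w n K.h x ≤ wt w n K.h (x % n ^ (a + c) + n ^ (a + c) * L p) := by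
  have hpos : ∀ i, 0 < n ^ i := fun i => Nat.pow_pos hn
  set y := x % n ^ (a + c) with hy
  have hylt : y < n ^ (a + c) := Nat.mod_lt _ (hpos _)
  have hz : x / n ^ (a + c) < n ^ b := by
    refine Nat.div_lt_of_lt_mul ?_
    rwa [← pow_add, hh]
  set z := x / n ^ (a + c) with hzdef
  have hxy : x = y + n ^ (a + c) * z := by
    rw [hy, hzdef, Nat.mod_add_div]
  set r := y % n ^ a with hrdef
  set q := y / n ^ a with hqdef
  have hr : r < n ^ a := Nat.mod_lt _ (hpos _)
  have hq : q < n ^ c := by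
    refine Nat.div_lt_of_lt_mul ?_
    rwa [← pow_add]
  have hyr : y = r + n ^ a * q := by rw [hrdef, hqdef, Nat.mod_add_div]
  have hrac : r < n ^ (a + c) := lt_of_le_of_lt (by rw [hyr]; omega) hylt
  obtain ⟨p, hp, hLp⟩ := hL.cover z hz
  have hw : Wit K n a c b A L D (p / D) r q := by
    refine ⟨p, rfl, hp, ?_, ?_⟩
    · refine hv.congr (fun _ _ _ => trivial) fun i _ hi => ?_
      rw [hxy, hyr, hLp, dig_row hr hq hi]
    · refine hv.congr (fun _ _ _ => trivial) fun i _ hi => ?_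
      rw [hxy, hyr, hLp, dig_col hr hq hn hi]
  have hidx : (p / D * (n ^ a / D + 1) + r / D) * (n ^ c / D + 1) + q / D <
      numBlocks n a c b D := by
    have h1 : p / D + 1 ≤ n ^ b / D + 1 := Nat.succ_le_succ (Nat.div_le_div_right hp.le)
    have h2 : r / D < n ^ a / D + 1 := Nat.lt_succ_of_le (Nat.div_le_div_right hr.le)
    have h3 : q / D < n ^ c / D + 1 := Nat.lt_succ_of_le (Nat.div_le_div_right hq.le)
    rw [numBlocks, ← mul_assoc]
    have h4 : p / D * (n ^ a / D + 1) + r / D + 1 ≤ (n ^ b / D + 1) * (n ^ a / D + 1) := by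
      refine le_trans ?_ (Nat.mul_le_mul_right _ h1)
      rw [add_mul (p / D)]
      omega
    refine lt_of_lt_of_le ?_ (Nat.mul_le_mul_right _ h4)
    rw [add_mul _ 1]
    omega
  obtain ⟨hb1, hb2⟩ := hbest r hr q hq
  rw [← hyr] at hb1 hb2
  obtain ⟨hne, hle⟩ := hb1 _ hidx hw
  obtain ⟨⟨p', hp'D, hp', hrow, hcol⟩, -⟩ := hb2 hne
  have hwit : ∃ p₁ < n ^ b, p₁ / D = best y - 1 ∧ Valid A n K.R K.N K.h (rowSet a c)
      (r + n ^ (a + c) * L p₁) ∧ Valid A n K.R K.N K.h (colSet a) (n ^ a * q + n ^ (a + c) * L p₁) ∧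
      wt w n b z ≤ wt w n b (L p₁) := by
    -- If the stored bucket is the one of `p`, then `p` itself will do. Otherwise it is strictly
    -- earlier, and every witness in it precedes `p` in the sorted list, so it is no lighter.
    by_cases h : p / D = best y - 1
    · obtain ⟨p₂, hp₂, h1, h2, h3⟩ := hw
      refine ⟨p, hp, h, ?_, ?_, by rw [hLp]⟩
      · refine hv.congr (fun _ _ _ => trivial) fun i _ hi => ?_
        rw [hxy, hyr, hLp, dig_row hr hq hi]
      · refine hv.congr (fun _ _ _ => trivial) fun i _ hi => ?_
        rw [hxy, hyr, hLp, dig_col hr hq hn hi]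
    · refine ⟨p', hp', hp'D, hrow, hcol, ?_⟩
      have hlt : p' < p := by
        by_contra hge
        have := Nat.div_le_div_right (c := D) (not_lt.1 hge)
        omega
      have := hL.sorted p' p hlt hp
      rwa [hLp] at this
  obtain ⟨p₁, hp₁, hp₁D, hrow₁, hcol₁, hwt⟩ := hwit
  refine ⟨p₁, hp₁, hne, hp₁D, ?_, ?_⟩
  · intro i hi j hj _ _ hij
    -- Pairs within the row and inner positions are guaranteed by the first matrix, pairs within the
    -- column and inner positions by the second. A remaining pair joins a row to a column position,
    -- so both digits are outer and the validity of `x` applies.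
    by_cases h1 : rowSet a c i ∧ rowSet a c j
    · have := hrow₁ i hi j hj h1.1 h1.2 hij
      rwa [← dig_row hr hq h1.1, ← dig_row hr hq h1.2, ← hyr] at this
    by_cases h2 : colSet a i ∧ colSet a j
    · have := hcol₁ i hi j hj h2.1 h2.2 hij
      rwa [← dig_col hr hq hn h2.1, ← dig_col hr hq hn h2.2, ← hyr] at this
    simp only [rowSet, colSet] at h1 h2
    have := hv i hi j hj trivial trivial hij
    rw [hxy, dig_add_mul_of_lt (i := i) (by omega), dig_add_mul_of_lt (i := j) (by omega)] at this
    rwa [dig_add_mul_of_lt (i := i) (by omega), dig_add_mul_of_lt (i := j) (by omega)]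
  · rw [hxy, ← hh, wt_add_mul hylt, wt_add_mul hylt]
    linarith

def setupProg (a c b e : ℕ) : Prog :=
  .seq (.setN 30 (powE a)) (.seq (.setN 31 (powE c)) (.seq (.setN 32 (powE b))
    (.seq (.setN 33 (powE (a + c))) (.seq (.setN 35 (succPowE e)) (.seq (.setN 40 (.const 1))
      (.seq (.setN 11 (.const 1)) (.setN 42 (.const 0))))))))

noncomputable def coreProg (K : Task) (a c b e : ℕ) (p : Prog) : Prog :=
  .seq (sortProg b) (.seq (setupProg a c b e)
    (.seq (doublingProg K a c b p) (scanProg K (a + c) b)))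

theorem modN_setupProg {a c b e x : ℕ} (h : (setupProg a c b e).ModN x) :
    x = 11 ∨ 30 ≤ x ∧ x ≤ 42 := by
  simp only [setupProg, Prog.ModN] at h
  omega

theorem modN_coreProg_zero {K : Task} {a c b e : ℕ} {p : Prog} :
    ¬ (coreProg K a c b e p).ModN 0 := by
  rintro (h | h | h | h)
  · have := modN_sortProg h
    omega
  · have := modN_setupProg h
    omega
  · have := modN_doublingProg h
    omega
  · have := modN_scanProg h
    omega

theorem modA_coreProg_zero {K : Task} {a c b e : ℕ} {p : Prog} :
    ¬ (coreProg K a c b e p).ModA 0 := by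
  rintro (h | h | h | h)
  · have := modA_sortProg h
    omega
  · simp [setupProg, Prog.ModA] at h
  · have := modA_doublingProg h
    omega
  · have := modA_scanProg h
    omega

theorem modR_coreProg_zero {K : Task} {a c b e : ℕ} {p : Prog} :
    ¬ (coreProg K a c b e p).ModR 0 := by
  rintro (h | h | h | h)
  · exact modR_sortProg h
  · simp [setupProg, Prog.ModR] at h
  · have := modR_doublingProg h
    omega
  · exact modR_scanProg h

/-- Not every valid tuple is entered into the table literally. The conclusion `Entered` asks only
for an entry that is at least as heavy in the same slot, and this needs slots that do not depend on
the inner tuple. -/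
theorem runs_coreProg (K : Task) (a c b e : ℕ) (p : Prog) (C₀ : ℕ) : ∃ C : ℕ, ∀ {d : ℕ}
    {τ : ℕ → ℕ} {n m : ℕ} {A : ℕ → ℕ} {P : ℕ → (ℕ → ℕ) → Prop} {slot : NExp → ℕ → ℕ}
    {w : ℕ → ℝ} {W : ℕ} {s : State}, Multiplies p d τ → K.Correct W n m A P slot →
    a + c + b = K.h → e ≤ K.h → b + 1 ≤ K.h → 0 < n →
    (∀ f ∈ K.slots, ∀ y < n ^ (a + c), ∀ z < n ^ b, ∀ z' < n ^ b,
      slot f (y + n ^ (a + c) * z) = slot f (y + n ^ (a + c) * z')) →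
    (∀ D, 0 < D → D ≤ (n + 1) ^ e → Room K.h n a c b d τ W D) →
    (∀ D, 0 < D → D ≤ (n + 1) ^ e → D * D + τ D ≤ C₀ * ((n + 1) ^ (a + c) * D)) →
    s.nreg 0 = n → s.narr 0 = A → s.rarr 0 = w → TableInv K.h m P s →
    Runs W (coreProg K a c b e p) s fun s' t =>
      (∃ D T, GoodSize n a c b τ ((n + 1) ^ e) C₀ D T ∧
        t ≤ C * ((n + 1) ^ (b + 1) + ((n + 1) ^ (a + c) * D + T))) ∧
      TableInv K.h m P s' ∧ Improves K.h w s s' ∧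
      ∀ x < n ^ K.h, Entered K n A w slot s' x := by
  obtain ⟨C₁, h₁⟩ := runs_sortProg b
  obtain ⟨C₂, h₂⟩ := runs_doublingProg K a c b p C₀
  obtain ⟨C₃, h₃⟩ := runs_scanProg K (a + c) b
  refine ⟨C₁ + C₂ + 4 * C₃ + (setupProg a c b e).passCost, ?_⟩
  intro d τ n m A P slot w W s hp hK hh he hb hn0 hslot hR hper hn hA hw ht
  have hcap : 0 < (n + 1) ^ e := Nat.pow_pos (by omega)
  have hP : 2 * (n + 1) ^ K.h ≤ W := (hR 1 (by omega) hcap).pow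
  have hle : ∀ i, i ≤ K.h → (n + 1) ^ i ≤ W := fun i hi =>
    le_trans (Nat.pow_le_pow_right (by omega) hi) (by omega)
  rw [coreProg, runs_seq]
  refine (h₁ hn (hle _ hb)).conseq ?_
  rintro s₁ t₁ hu₁ ⟨ht₁, hL₁⟩
  have hn₁ : s₁.nreg 0 = n := by
    rw [hu₁.nreg 0 fun h => by have := modN_sortProg h; omega, hn]
  have harr₁ : ∀ x < 10, s₁.narr x = s.narr x := fun x hx =>
    hu₁.narr x fun h => by have := modA_sortProg h; omega
  have hr₁ : s₁.rarr 0 = w := by rw [hu₁.rarr 0 modR_sortProg, hw]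
  rw [hw] at hL₁
  generalize hLdef : s₁.narr (10 + b) = L at hL₁
  rw [runs_seq]
  refine (Runs.timed (Q := fun s₂ => Ready a c b n A L w ((n + 1) ^ e) s₂ ∧ s₂.nreg 11 = 1 ∧
    s₂.nreg 42 = 0) (by simp [setupProg, Prog.LoopFree]) ?_).conseq ?_
  · unfold setupProg
    simp only [runs_seq, runs_setN, eval_powE, eval_succPowE, State.nreg_setReg, hn₁, NExp.Fits,
      NExp.eval, OfNat.zero_ne_ofNat, if_false, true_and]
    refine ⟨fits_powE hn₁ (hle a (by omega)), fits_powE (by simpa using hn₁) (hle c (by omega)),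
      fits_powE (by simpa using hn₁) (hle b (by omega)),
      fits_powE (by simpa using hn₁) (hle (a + c) (by omega)),
      fits_succPowE (by simpa using hn₁) (hle e he), ?_, by simp, by simp⟩
    constructor <;> simp [hn₁, hLdef, hr₁, harr₁ 0 (by omega), hA]
  rintro s₂ t₂ hu₂ ⟨ht₂, hs₂, h11₂, h42₂⟩
  have harr₂ : ∀ x, s₂.narr x = s₁.narr x := fun x => hu₂.narr x (by simp [setupProg, Prog.ModA])
  rw [runs_seq]
  refine (h₂ hp hh hK.two_le hn0 hcap hR hper hL₁.lt hs₂ h11₂ h42₂).conseq ?_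
  rintro s₃ t₃ hu₃ ⟨D, T, hg, ht₃, hs₃, h11₃, hbest⟩
  have harr₃ : ∀ x, x = 1 ∨ x = 2 → s₃.narr x = s.narr x := fun x hx => by
    rw [hu₃.narr x fun h => by have := modA_doublingProg h; omega, harr₂, harr₁ x (by omega)]
  have hpos : ∀ i, 0 < n ^ i := fun i => Nat.pow_pos hn0
  have hpw : ∀ i, i ≤ K.h → n ^ i ≤ (n + 1) ^ K.h := fun i hi =>
    le_trans (Nat.pow_le_pow_left (by omega) _) (Nat.pow_le_pow_right (by omega) hi)
  refine (h₃ hK hh hn0 hs₃.h0 h11₃ hs₃.hA hs₃.hw ?_ ?_ ?_ ?_).mono ?_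
  · have := hpw b (by omega)
    have := (hR D hg.pos hg.le).size
    omega
  · intro y hy hne
    have hr : y % n ^ a < n ^ a := Nat.mod_lt _ (hpos _)
    have hq : y / n ^ a < n ^ c := by
      refine Nat.div_lt_of_lt_mul ?_
      rwa [← pow_add]
    obtain ⟨-, h⟩ := hbest _ hr _ hq
    rw [Nat.mod_add_div] at h
    obtain ⟨⟨i, hiD, hi, -⟩, -⟩ := h hne
    rw [← hiD]
    exact lt_of_le_of_lt (Nat.div_mul_le_self _ _) hi
  · rw [hs₃.hL]
    exact hL₁.lt
  · exact ht.congr (harr₃ 1 (by omega)) (harr₃ 2 (by omega))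
  · rintro s₄ t₄ ⟨ht₄, hT₄, hI₄, hE₄⟩
    refine ⟨⟨D, T, hg, ?_⟩, hT₄,
      (Improves.of_eq (harr₃ 1 (by omega)) (harr₃ 2 (by omega))).trans hI₄, ?_⟩
    · have e1 : (n ^ (a + c) + 1) * (D + 1) ≤ 4 * ((n + 1) ^ (a + c) * D) := by
        have h1 : n ^ (a + c) ≤ (n + 1) ^ (a + c) := Nat.pow_le_pow_left (by omega) _
        have h2 : 1 ≤ (n + 1) ^ (a + c) := Nat.one_le_pow _ _ (by omega)
        have h3 := hg.pos
        calc _ ≤ (2 * (n + 1) ^ (a + c)) * (2 * D) := Nat.mul_le_mul (by omega) (by omega)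
          _ = _ := by ring
      have e2 : C₃ * ((n ^ (a + c) + 1) * (D + 1)) ≤ 4 * C₃ * ((n + 1) ^ (a + c) * D) := by
        calc _ ≤ C₃ * (4 * ((n + 1) ^ (a + c) * D)) := Nat.mul_le_mul_left _ e1
          _ = _ := by ring
      have e3 : 1 ≤ (n + 1) ^ (b + 1) := Nat.one_le_pow _ _ (by omega)
      have e4 : (setupProg a c b e).passCost * 1 ≤
        (setupProg a c b e).passCost * (n + 1) ^ (b + 1) := Nat.mul_le_mul_left _ e3
      generalize (n + 1) ^ (a + c) * D = X at *
      generalize (n + 1) ^ (b + 1) = Y at *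
      generalize (setupProg a c b e).passCost = u at *
      have e5 : (C₁ + C₂ + 4 * C₃ + u) * (Y + (X + T)) = C₁ * Y + C₂ * (X + T) + 4 * C₃ * X + u * Y +
        (C₁ * (X + T) + C₂ * Y + 4 * C₃ * (Y + T) + u * (X + T)) := by ring
      have e6 : 0 ≤ C₁ * (X + T) + C₂ * Y + 4 * C₃ * (Y + T) + u * (X + T) := Nat.zero_le _
      omega
    · intro x hx hv f hf
      obtain ⟨i, hi, hne, hiD, hvi, hwt⟩ := exists_better hh hn0 hL₁ hbest hx hv
      set y := x % n ^ (a + c) with hy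
      have hylt : y < n ^ (a + c) := Nat.mod_lt _ (hpos _)
      have hz : x / n ^ (a + c) < n ^ b := by
        refine Nat.div_lt_of_lt_mul ?_
        rwa [← pow_add, hh]
      have hxy : x = y + n ^ (a + c) * (x / n ^ (a + c)) := by rw [hy, Nat.mod_add_div]
      have hDi : (s₃.narr 3 y - 1) * D + i % D = i := by rw [← hiD, Nat.div_add_mod']
      have := hE₄ y hylt hne (i % D) (Nat.mod_lt _ hg.pos) (by rwa [hDi])
      rw [hDi, hs₃.hL] at this
      obtain ⟨hf1, hf2⟩ := this hvi f hf
      -- The better tuple has the same outer part as `x` and so competes for the same slot.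
      have hsl : slot f (y + n ^ (a + c) * L i) = slot f x := by
        conv_rhs => rw [hxy]
        exact hslot f hf y hylt _ (hL₁.lt i hi) _ hz
      rw [hsl] at hf1 hf2
      exact ⟨hf1, hwt.trans hf2⟩


/-! ### The complete algorithm -/

noncomputable def coreList (a c b e : ℕ) (p : Prog) : List Task → Prog
  | [] => .skip
  | K :: l => .seq (coreProg K a c b e p) (coreList a c b e p l)

theorem runs_coreList (h a c b e : ℕ) (p : Prog) (C₀ : ℕ) (l : List Task) (hl : ∀ K ∈ l, K.h = h) :
    ∃ C : ℕ, ∀ {d : ℕ} {τ : ℕ → ℕ} {n m X : ℕ} {A : ℕ → ℕ} {P : ℕ → (ℕ → ℕ) → Prop}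
    {slot : NExp → ℕ → ℕ} {w : ℕ → ℝ} {W : ℕ} {s : State}, Multiplies p d τ →
    (∀ K ∈ l, K.Correct W n m A P slot) →
    a + c + b = h → e ≤ h → b + 1 ≤ h → 0 < n →
    (∀ K ∈ l, ∀ f ∈ K.slots, ∀ y < n ^ (a + c), ∀ z < n ^ b, ∀ z' < n ^ b,
      slot f (y + n ^ (a + c) * z) = slot f (y + n ^ (a + c) * z')) →
    (∀ D, 0 < D → D ≤ (n + 1) ^ e → Room h n a c b d τ W D) →
    (∀ D, 0 < D → D ≤ (n + 1) ^ e → D * D + τ D ≤ C₀ * ((n + 1) ^ (a + c) * D)) →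
    (∀ D T, GoodSize n a c b τ ((n + 1) ^ e) C₀ D T →
      (n + 1) ^ (b + 1) + ((n + 1) ^ (a + c) * D + T) ≤ X) →
    s.nreg 0 = n → s.narr 0 = A → s.rarr 0 = w → TableInv h m P s →
    Runs W (coreList a c b e p l) s fun s' t => t ≤ C * X + 1 ∧ TableInv h m P s' ∧
      Improves h w s s' ∧ ∀ K ∈ l, ∀ x < n ^ h, Entered K n A w slot s' x := by
  induction l with
  | nil =>
    refine ⟨0, ?_⟩
    intro d τ n m X A P slot w W s _ _ _ _ _ _ _ _ _ _ _ _ _ ht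
    exact runs_skip.2 ⟨by omega, ht, .of_eq rfl rfl, by simp⟩
  | cons K l ih =>
    obtain ⟨C₁, h₁⟩ := runs_coreProg K a c b e p C₀
    obtain ⟨C₂, h₂⟩ := ih fun K hK => hl K (List.mem_cons_of_mem _ hK)
    refine ⟨C₁ + C₂, ?_⟩
    intro d τ n m X A P slot w W s hp hK hh he hb hn0 hslot hR hper hX hn hA hw ht
    have hKh := hl K List.mem_cons_self
    rw [coreList, runs_seq]
    rw [← hKh] at hh he hb hR ht
    refine (h₁ hp (hK K List.mem_cons_self) hh he hb hn0 (hslot K List.mem_cons_self) hR hper hn hA hw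
      ht).conseq ?_
    rintro s₁ t₁ hu₁ ⟨⟨D, T, hg, ht₁⟩, hT₁, hI₁, hE₁⟩
    rw [hKh] at hh he hb hR hT₁ hI₁ hE₁
    refine (h₂ hp (fun K hK' => hK K (List.mem_cons_of_mem _ hK')) hh he hb hn0
      (fun K hK' => hslot K (List.mem_cons_of_mem _ hK')) hR hper hX
      ((hu₁.nreg 0 modN_coreProg_zero).trans hn) ((hu₁.narr 0 modA_coreProg_zero).trans hA)
      ((hu₁.rarr 0 modR_coreProg_zero).trans hw) hT₁).mono ?_
    rintro s₂ t₂ ⟨ht₂, hT₂, hI₂, hE₂⟩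
    refine ⟨?_, hT₂, hI₁.trans hI₂, fun K' hK' x hx => ?_⟩
    · have : C₁ * ((n + 1) ^ (b + 1) + ((n + 1) ^ (a + c) * D + T)) ≤ C₁ * X :=
        Nat.mul_le_mul_left _ (hX D T hg)
      rw [add_mul]
      omega
    · rcases List.mem_cons.1 hK' with rfl | hK'
      · refine (hE₁ x hx).mono ?_
        rwa [hKh]
      · exact hE₂ K' hK' x hx

/-- The table gets `n * n + 1` slots, one more than there are pairs, so that slot `0` is cleared
even for the empty graph. In that case the search is skipped. -/
noncomputable def mainProg (a c b e : ℕ) (p : Prog) (l : List Task) : Prog :=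
  .seq (.setN 43 (.add (.mul (.reg 0) (.reg 0)) (.const 1)))
    (.seq (forLoop 44 43 (.putN 1 (.reg 44) (.const 0)))
      (.ite (.lt (.const 0) (.reg 0)) (coreList a c b e p l) .skip))

theorem runs_mainProg (h a c b e : ℕ) (p : Prog) (C₀ : ℕ) (l : List Task) (hl : ∀ K ∈ l, K.h = h) :
    ∃ C : ℕ, ∀ {d : ℕ} {τ : ℕ → ℕ} {n X : ℕ} {A : ℕ → ℕ} {P : ℕ → (ℕ → ℕ) → Prop}
    {slot : NExp → ℕ → ℕ} {w : ℕ → ℝ} {W : ℕ} {s : State}, Multiplies p d τ →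
    (0 < n → ∀ K ∈ l, K.Correct W n (n * n + 1) A P slot) →
    a + c + b = h → e ≤ h → b + 1 ≤ h → n * n + 1 ≤ W →
    (∀ K ∈ l, ∀ f ∈ K.slots, ∀ y < n ^ (a + c), ∀ z < n ^ b, ∀ z' < n ^ b,
      slot f (y + n ^ (a + c) * z) = slot f (y + n ^ (a + c) * z')) →
    (∀ D, 0 < D → D ≤ (n + 1) ^ e → Room h n a c b d τ W D) →
    (∀ D, 0 < D → D ≤ (n + 1) ^ e → D * D + τ D ≤ C₀ * ((n + 1) ^ (a + c) * D)) →
    (∀ D T, GoodSize n a c b τ ((n + 1) ^ e) C₀ D T →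
      (n + 1) ^ (b + 1) + ((n + 1) ^ (a + c) * D + T) ≤ X) →
    s.nreg 0 = n → s.narr 0 = A → s.rarr 0 = w →
    Runs W (mainProg a c b e p l) s fun s' t => t ≤ C * (X + (n + 1) ^ 2) ∧
      TableInv h (n * n + 1) P s' ∧
      (0 < n → ∀ K ∈ l, ∀ x < n ^ h, Entered K n A w slot s' x) := by
  obtain ⟨C, hC⟩ := runs_coreList h a c b e p C₀ l hl
  refine ⟨C + 100, ?_⟩
  intro d τ n X A P slot w W s hp hK hh he hb hnW hslot hR hper hX hn hA hw
  unfold mainProg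
  simp only [runs_seq, runs_setN, NExp.Fits, NExp.eval, hn, true_and, NExp.cost]
  refine ⟨⟨by omega, by omega⟩, ?_⟩
  have hsq : n * n + 1 ≤ (n + 1) ^ 2 := by nlinarith
  refine (runs_forLoop (fun j s' => ∀ I < j, s'.narr 1 I = 0) 3 (s := s.setReg 43 (n * n + 1))
    (L := n * n + 1) (by simp) hnW (by omega) (by simp [Prog.ModN]) (by simp [Prog.ModN])
    (by simp) ?_).conseq ?_
  · intro j s' hj h29 _ ih
    rw [runs_putN]
    refine ⟨trivial, trivial, le_rfl, fun y hy => ?_⟩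
    simp only [State.narr_setReg, State.narr_setCell, NExp.eval, h29, true_and]
    split_ifs with h
    · rfl
    · exact ih y (by omega)
  rintro s₁ t₁ hu₁ ⟨ht₁, h1₁⟩
  have hn₁ : s₁.nreg 0 = n := by
    rw [hu₁.nreg 0 (by simp [modN_forLoop, Prog.ModN])]
    simpa using hn
  have hA₁ : s₁.narr 0 = A := by
    rw [hu₁.narr 0 (by simp [modA_forLoop, Prog.ModA])]
    simpa using hA
  have hw₁ : s₁.rarr 0 = w := by
    rw [hu₁.rarr 0 (by simp [modR_forLoop, Prog.ModR])]
    simpa using hw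
  have hT₁ : TableInv h (n * n + 1) P s₁ := fun I hI => .inl (h1₁ I hI)
  rw [runs_ite]
  refine ⟨⟨trivial, trivial⟩, fun hb0 => ?_, fun hb0 => ?_⟩
  · simp only [BExp.Holds, NExp.eval, hn₁] at hb0
    refine (hC hp (hK hb0) hh he hb hb0 hslot hR hper hX hn₁ hA₁ hw₁ hT₁).mono ?_
    rintro s₂ t₂ ⟨ht₂, hT₂, hI₂, hE₂⟩
    refine ⟨?_, hT₂, fun _ => hE₂⟩
    have e1 : (C + 100) * (X + (n + 1) ^ 2) = C * X + 100 * (n + 1) ^ 2 +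
      (C * (n + 1) ^ 2 + 100 * X) := by ring
    have e2 : 0 ≤ C * (n + 1) ^ 2 + 100 * X := Nat.zero_le _
    simp only [BExp.cost, NExp.cost]
    omega
  · simp only [BExp.Holds, NExp.eval, hn₁] at hb0
    refine runs_skip.2 ⟨?_, hT₁, fun h => absurd h hb0⟩
    have e1 : (C + 100) * (X + (n + 1) ^ 2) = 100 * (n + 1) ^ 2 +
      (C * (X + (n + 1) ^ 2) + 100 * X) := by ring
    have e2 : 0 ≤ C * (X + (n + 1) ^ 2) + 100 * X := Nat.zero_le _
    simp only [BExp.cost, NExp.cost]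
    omega

/-! ### The tasks -/

/-- A permutation that maps `i` to `0` and `j` to `1`. -/
def arrange (i j : ℕ) : Equiv.Perm ℕ :=
  (Equiv.swap 0 i).trans (Equiv.swap 1 (Equiv.swap 0 i j))

theorem swap_lt {h x y z : ℕ} (hx : x < h) (hy : y < h) (hz : z < h) : Equiv.swap x y z < h := by
  rw [Equiv.swap_apply_def]
  split_ifs <;> assumption

theorem arrange_lt {h i j x : ℕ} (hh : 2 ≤ h) (hi : i < h) (hj : j < h) (hx : x < h) :
    arrange i j x < h :=
  swap_lt (by omega) (swap_lt (by omega) hi hj) (swap_lt (by omega) hi hx)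

theorem arrange_symm_lt {h i j x : ℕ} (hh : 2 ≤ h) (hi : i < h) (hj : j < h) (hx : x < h) :
    (arrange i j).symm x < h := by
  simp only [arrange, Equiv.symm_trans_apply, Equiv.symm_swap]
  exact swap_lt (by omega) hi (swap_lt (by omega) (swap_lt (by omega) hi hj) hx)

theorem arrange_left {i j : ℕ} (hij : i ≠ j) : arrange i j i = 0 := by
  simp only [arrange, Equiv.trans_apply, Equiv.swap_apply_right]
  refine Equiv.swap_apply_of_ne_of_ne (by omega) fun h => hij ?_
  have := (Equiv.swap 0 i).injective ((Equiv.swap_apply_right 0 i).trans h)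
  exact this

theorem arrange_right {i j : ℕ} : arrange i j j = 1 := by
  simp [arrange]

/-- The value of an expression that depends on the input size and on the tuple code only. -/
def slotVal (n : ℕ) (e : NExp) (x : ℕ) : ℕ :=
  e.eval ⟨fun r => if r = 0 then n else if r = 6 then x else 0, fun _ _ => 0, fun _ => 0,
    fun _ _ => 0⟩

/-- The slot of the vertices at positions `i` and `j`. -/
def pairE (i j : ℕ) : NExp := .add (.mul (digE i (.reg 6)) (.reg 0)) (digE j (.reg 6))

theorem slotVal_pairE (n i j x : ℕ) : slotVal n (pairE i j) x = dig n x i * n + dig n x j := by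
  simp [slotVal, pairE, NExp.eval, eval_digE]

/-- The task for the arrangement `ρ` of the vertices. -/
def arrangedTask (h : ℕ) (R N : ℕ → ℕ → Prop) (slots : List NExp) (ρ : Equiv.Perm ℕ) : Task where
  h := h
  σ := ρ
  R p q := R (ρ.symm p) (ρ.symm q)
  N p q := N (ρ.symm p) (ρ.symm q)
  slots := slots

/-- `f` is a placement of the vertices of `H` that satisfies all conditions. -/
def IsPlacement (A : ℕ → ℕ) (n h : ℕ) (R N : ℕ → ℕ → Prop) (f : ℕ → ℕ) : Prop :=
  (∀ i < h, f i < n) ∧ ∀ i < h, ∀ j < h, i ≠ j → Compat A n R N i j (f i) (f j)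

theorem IsPlacement.congr {A : ℕ → ℕ} {n h : ℕ} {R N : ℕ → ℕ → Prop} {f g : ℕ → ℕ}
    (hf : IsPlacement A n h R N f) (hfg : ∀ i < h, f i = g i) : IsPlacement A n h R N g := by
  refine ⟨fun i hi => hfg i hi ▸ hf.1 i hi, fun i hi j hj hij => ?_⟩
  rw [← hfg i hi, ← hfg j hj]
  exact hf.2 i hi j hj hij

theorem sum_range_perm {h : ℕ} {ρ : Equiv.Perm ℕ} (hρ : ∀ i < h, ρ i < h)
    (hρ' : ∀ i < h, ρ.symm i < h) (g : ℕ → ℝ) :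
    ∑ i ∈ Finset.range h, g (ρ i) = ∑ i ∈ Finset.range h, g i := by
  refine Finset.sum_bij' (fun i _ => ρ i) (fun i _ => ρ.symm i) ?_ ?_ ?_ ?_ ?_ <;>
    simp +contextual [hρ, hρ']

theorem Valid.isPlacement {A : ℕ → ℕ} {n h : ℕ} {R N : ℕ → ℕ → Prop} {slots : List NExp}
    {ρ : Equiv.Perm ℕ} (hn : 0 < n) (hρ : ∀ i < h, ρ i < h) {x : ℕ}
    (hx : Valid A n (arrangedTask h R N slots ρ).R (arrangedTask h R N slots ρ).N h
      (fun _ => True) x) : IsPlacement A n h R N fun i => dig n x (ρ i) := by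
  refine ⟨fun i _ => dig_lt hn _ _, fun i hi j hj hij => ?_⟩
  have := hx (ρ i) (hρ i hi) (ρ j) (hρ j hj) trivial trivial (ρ.injective.ne hij)
  simpa [arrangedTask, Compat] using this

/-- Every placement is the arrangement of some valid tuple. -/
theorem IsPlacement.exists_valid {A : ℕ → ℕ} {n h : ℕ} {R N : ℕ → ℕ → Prop} {slots : List NExp}
    {ρ : Equiv.Perm ℕ} (hn : 0 < n) (hρ' : ∀ i < h, ρ.symm i < h) {f : ℕ → ℕ}
    (hf : IsPlacement A n h R N f) :
    ∃ x < n ^ h, Valid A n (arrangedTask h R N slots ρ).R (arrangedTask h R N slots ρ).N h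
      (fun _ => True) x ∧ ∀ i < h, dig n x i = f (ρ.symm i) := by
  obtain ⟨x, hx, hd⟩ := exists_code (n := n) (fun i => if f (ρ.symm i) < n then f (ρ.symm i) else 0)
    (fun i => by split_ifs <;> assumption) h
  have hd' : ∀ i < h, dig n x i = f (ρ.symm i) := fun i hi => by
    rw [hd i hi, if_pos (hf.1 _ (hρ' i hi))]
  refine ⟨x, hx, fun i hi j hj _ _ hij => ?_, hd'⟩
  rw [hd' i hi, hd' j hj]
  exact hf.2 _ (hρ' i hi) _ (hρ' j hj) (ρ.symm.injective.ne hij)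


/-! ### All pairs of vertices, and single solutions -/

/-- The tasks for the all-pairs problem: any two vertices of `H` take the positions `0` and `1`. -/
def pairTasks (h : ℕ) (R N : ℕ → ℕ → Prop) : List Task :=
  ((List.range h ×ˢ List.range h).filter fun ij => ij.1 ≠ ij.2).map fun ij =>
    arrangedTask h R N [pairE 0 1, pairE 0 0] (arrange ij.1 ij.2)

/-- The task for finding one solution. -/
def singleTasks (h : ℕ) (R N : ℕ → ℕ → Prop) : List Task :=
  [arrangedTask h R N [.const 0] (Equiv.refl ℕ)]

/-- The placement `f` contains the two vertices that belong to the slot `I`. -/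
def PairPred (A : ℕ → ℕ) (n h : ℕ) (R N : ℕ → ℕ → Prop) (I : ℕ) (f : ℕ → ℕ) : Prop :=
  IsPlacement A n h R N f ∧ ∃ i < h, ∃ j < h, I = f i * n + f j

theorem mem_pairTasks {h : ℕ} {R N : ℕ → ℕ → Prop} {K : Task} : K ∈ pairTasks h R N ↔
    ∃ i < h, ∃ j < h, i ≠ j ∧ arrangedTask h R N [pairE 0 1, pairE 0 0] (arrange i j) = K := by
  simp only [pairTasks, List.mem_map, List.mem_filter, List.mem_product, List.mem_range,
    Prod.exists, decide_eq_true_eq]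
  constructor
  · rintro ⟨i, j, ⟨⟨hi, hj⟩, hij⟩, h⟩
    exact ⟨i, hi, j, hj, hij, h⟩
  · rintro ⟨i, hi, j, hj, hij, h⟩
    exact ⟨i, j, ⟨⟨hi, hj⟩, hij⟩, h⟩

theorem correct_pairTasks {h n W : ℕ} {A : ℕ → ℕ} {R N : ℕ → ℕ → Prop} (hh : 2 ≤ h) (hn : 0 < n)
    (hW : (n * n + 1) * h ≤ W) (hP : (n + 1) ^ h ≤ W) :
    ∀ K ∈ pairTasks h R N, K.Correct W n (n * n + 1) A (PairPred A n h R N) (slotVal n) := by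
  intro K hK
  obtain ⟨i, hi, j, hj, hij, rfl⟩ := mem_pairTasks.1 hK
  have hsq : (n + 1) ^ 2 ≤ W := le_trans (Nat.pow_le_pow_right (by omega) hh) hP
  have hlt : ∀ x k, dig n x 0 * n + dig n x k < n * n + 1 := by
    intro x k
    have h1 := dig_lt hn x 0
    have h2 := dig_lt hn x k
    nlinarith
  refine ⟨hh, sum_range_perm (fun k hk => arrange_lt hh hi hj hk)
    (fun k hk => arrange_symm_lt hh hi hj hk), fun k hk => arrange_lt hh hi hj hk, ?_, hW, hP, ?_, ?_⟩
  · rintro I f g hfg ⟨h1, k, hk, l, hl, h2⟩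
    exact ⟨h1.congr hfg, k, hk, l, hl, by rw [← hfg k hk, ← hfg l hl, h2]⟩
  · have key : ∀ k < 2, ∀ x s, s.nreg 0 = n → s.nreg 6 = x →
        (pairE 0 k).Fits W s ∧ (pairE 0 k).eval s = slotVal n (pairE 0 k) x := by
      intro k hk x s hn0 h6
      have hd : ∀ k < 2, (digE k (.reg 6)).Fits W s := fun k hk => fits_digE hn0
        (le_trans (Nat.pow_le_pow_right (by omega) (by omega : k ≤ h)) hP) trivial
      have h1 := dig_lt hn x 0
      have h2 := dig_lt hn x k
      rw [slotVal_pairE]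
      refine ⟨⟨⟨hd 0 (by omega), trivial, ?_⟩, hd k hk, ?_⟩, ?_⟩ <;>
        simp only [NExp.eval, pairE, eval_digE, h6, hn0] <;> nlinarith
    intro f hf x s _ hn0 h6
    simp only [arrangedTask, List.mem_cons, List.not_mem_nil, or_false] at hf
    rcases hf with rfl | rfl
    · exact key 1 (by omega) x s hn0 h6
    · exact key 0 (by omega) x s hn0 h6
  · intro f hf x _ hv
    have hpl : IsPlacement A n h R N fun k => dig n x (arrange i j k) :=
      hv.isPlacement hn (fun k hk => arrange_lt hh hi hj hk)
    simp only [arrangedTask, List.mem_cons, List.not_mem_nil, or_false] at hf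
    rcases hf with rfl | rfl
    · rw [slotVal_pairE]
      exact ⟨hlt x 1, hpl, i, hi, j, hj, by
        change _ = dig n x (arrange i j i) * n + dig n x (arrange i j j)
        rw [arrange_left hij, arrange_right]⟩
    · rw [slotVal_pairE]
      exact ⟨hlt x 0, hpl, i, hi, i, hi, by
        change _ = dig n x (arrange i j i) * n + dig n x (arrange i j i)
        rw [arrange_left hij]⟩

theorem correct_singleTasks {h n W : ℕ} {A : ℕ → ℕ} {R N : ℕ → ℕ → Prop} (hh : 2 ≤ h) (hn : 0 < n)
    (hW : (n * n + 1) * h ≤ W) (hP : (n + 1) ^ h ≤ W) :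
    ∀ K ∈ singleTasks h R N,
      K.Correct W n (n * n + 1) A (fun _ => IsPlacement A n h R N) (slotVal n) := by
  intro K hK
  obtain rfl := List.mem_singleton.1 hK
  refine ⟨hh, fun _ => rfl, fun _ h => h, fun _ _ _ h1 h2 => h2.congr h1, hW, hP, ?_, ?_⟩
  · intro f hf x s _ _ _
    obtain rfl := List.mem_singleton.1 hf
    exact ⟨trivial, rfl⟩
  · intro f hf x _ hv
    obtain rfl := List.mem_singleton.1 hf
    exact ⟨Nat.succ_pos _, hv.isPlacement hn fun _ h => h⟩

theorem slot_pairTasks {h n ac b : ℕ} {R N : ℕ → ℕ → Prop} (hac : 2 ≤ ac) :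
    ∀ K ∈ pairTasks h R N, ∀ f ∈ K.slots, ∀ y < n ^ ac, ∀ z < n ^ b, ∀ z' < n ^ b,
      slotVal n f (y + n ^ ac * z) = slotVal n f (y + n ^ ac * z') := by
  intro K hK f hf y _ z _ z' _
  obtain ⟨i, -, j, -, -, rfl⟩ := mem_pairTasks.1 hK
  simp only [arrangedTask, List.mem_cons, List.not_mem_nil, or_false] at hf
  rcases hf with rfl | rfl <;>
    simp only [slotVal_pairE, dig_add_mul_of_lt (show 0 < ac by omega),
      dig_add_mul_of_lt (show 1 < ac by omega)]

theorem slot_singleTasks {h n ac b : ℕ} {R N : ℕ → ℕ → Prop} :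
    ∀ K ∈ singleTasks h R N, ∀ f ∈ K.slots, ∀ y < n ^ ac, ∀ z < n ^ b, ∀ z' < n ^ b,
      slotVal n f (y + n ^ ac * z) = slotVal n f (y + n ^ ac * z') := by
  intro K hK f hf y _ z _ z' _
  obtain rfl := List.mem_singleton.1 hK
  obtain rfl := List.mem_singleton.1 hf
  rfl

/-- The task whose arrangement sends `i` to `0` and `j` to `1` produces a tuple with `f i` and `f j`
as its first two digits, and the arrangement preserves the weight. The slots of the form `(u, u)`
are served by the second slot expression, `pairE 0 0`. -/
theorem beats_pairTasks {h n : ℕ} {A : ℕ → ℕ} {R N : ℕ → ℕ → Prop} {w : ℕ → ℝ} {s : State}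
    (hh : 2 ≤ h) (hn : 0 < n)
    (hE : ∀ K ∈ pairTasks h R N, ∀ x < n ^ h, Entered K n A w (slotVal n) s x) {f : ℕ → ℕ}
    (hf : IsPlacement A n h R N f) {i j : ℕ} (hi : i < h) (hj : j < h) :
    Beats h w s (f i * n + f j) (∑ k ∈ Finset.range h, w (f k)) := by
  have key : ∀ i < h, ∀ j < h, i ≠ j →
      Beats h w s (f i * n + f j) (∑ k ∈ Finset.range h, w (f k)) ∧
      Beats h w s (f i * n + f i) (∑ k ∈ Finset.range h, w (f k)) := by
    intro i hi j hj hij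
    have hsym : ∀ k < h, (arrange i j).symm k < h := fun k hk => arrange_symm_lt hh hi hj hk
    obtain ⟨x, hx, hv, hd⟩ := hf.exists_valid (slots := [pairE 0 1, pairE 0 0]) hn hsym
    have hwt : wt w n h x = ∑ k ∈ Finset.range h, w (f k) := by
      unfold wt
      rw [Finset.sum_congr rfl fun k hk => by rw [hd k (Finset.mem_range.1 hk)]]
      exact sum_range_perm (ρ := (arrange i j).symm) hsym
        (fun k hk => arrange_lt hh hi hj hk) fun k => w (f k)
    have h0 : dig n x 0 = f i := by
      rw [hd 0 (by omega), ← arrange_left hij, Equiv.symm_apply_apply]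
    have h1 : dig n x 1 = f j := by
      rw [hd 1 (by omega), ← arrange_right (i := i) (j := j), Equiv.symm_apply_apply]
    have := hE _ (mem_pairTasks.2 ⟨i, hi, j, hj, hij, rfl⟩) x hx hv
    constructor
    · have := this (pairE 0 1) (by simp [arrangedTask])
      rw [slotVal_pairE, h0, h1] at this
      rw [← hwt]
      exact this
    · have := this (pairE 0 0) (by simp [arrangedTask])
      rw [slotVal_pairE, h0] at this
      rw [← hwt]
      exact this
  by_cases hij : i = j
  · subst hij
    -- A diagonal slot still needs a second vertex of `H` to select a task; since `h ≥ 2`, vertex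
    -- `1` or vertex `0` is available.
    by_cases hi0 : i = 0
    · exact (key i hi 1 (by omega) (by omega)).2
    · exact (key i hi 0 (by omega) hi0).2
  · exact (key i hi j hj hij).1

theorem beats_singleTasks {h n : ℕ} {A : ℕ → ℕ} {R N : ℕ → ℕ → Prop} {w : ℕ → ℝ} {s : State}
    (hn : 0 < n)
    (hE : ∀ K ∈ singleTasks h R N, ∀ x < n ^ h, Entered K n A w (slotVal n) s x) {f : ℕ → ℕ}
    (hf : IsPlacement A n h R N f) : Beats h w s 0 (∑ k ∈ Finset.range h, w (f k)) := by
  obtain ⟨x, hx, hv, hd⟩ := hf.exists_valid (ρ := Equiv.refl ℕ) (slots := [.const 0]) hn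
    fun _ h => h
  have hwt : wt w n h x = ∑ k ∈ Finset.range h, w (f k) :=
    Finset.sum_congr rfl fun k hk => by rw [hd k (Finset.mem_range.1 hk)]; rfl
  have := hE _ (List.mem_singleton.2 rfl) x hx hv (.const 0) (by simp [arrangedTask])
  rw [← hwt]
  exact this

/-! ### From tables to answers -/

/-- A placement, as a function on natural numbers. -/
def extend {h n : ℕ} (φ : Fin h → Fin n) (i : ℕ) : ℕ := if hi : i < h then φ ⟨i, hi⟩ else 0

theorem extend_val {h n : ℕ} (φ : Fin h → Fin n) (i : Fin h) : extend φ i = φ i := by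
  simp [extend]

theorem sum_extend {h n : ℕ} (φ : Fin h → Fin n) {w : ℕ → ℝ} {w' : Fin n → ℝ}
    (hw : ∀ u : Fin n, w u = w' u) :
    ∑ k ∈ Finset.range h, w (extend φ k) = ∑ i, w' (φ i) := by
  rw [← Fin.sum_univ_eq_sum_range (fun k => w (extend φ k))]
  exact Finset.sum_congr rfl fun i _ => by rw [extend_val, hw]

/-- `TableInv` is soundness (every entry is a solution) and `Beats` is completeness (every solution
is matched by an entry at least as heavy); together they give optimality, and flag `0` only if there
is no solution. -/
theorem findsMax_of_table {h n : ℕ} {w : ℕ → ℝ} {w' : Fin n → ℝ} (hw : ∀ u : Fin n, w u = w' u)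
    {P : (Fin h → Fin n) → Prop} {Q : ℕ → (ℕ → ℕ) → Prop} {s : State} {m I : ℕ}
    (hQ : ∀ φ, P φ ↔ Q I (extend φ)) (hlt : ∀ f, Q I f → ∀ i < h, f i < n)
    (hcongr : ∀ f g, (∀ i < h, f i = g i) → Q I f → Q I g) (hT : TableInv h m Q s) (hI : I < m)
    (hB : ∀ φ : Fin h → Fin n, P φ → Beats h w s I (∑ k ∈ Finset.range h, w (extend φ k))) :
    FindsMax P w' (s.narr 1 I) fun i => s.narr 2 (I * h + i) := by
  rcases hT I hI with h0 | ⟨h1, hq⟩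
  · refine .inr ⟨h0, fun φ hφ => ?_⟩
    have := (hB φ hφ).1
    omega
  · refine .inl ⟨h1, ?_⟩
    have hlt' := hlt _ hq
    let φ : Fin h → Fin n := fun i => ⟨s.narr 2 (I * h + i), hlt' i i.2⟩
    have hφ : ∀ i < h, s.narr 2 (I * h + i) = extend φ i := fun i hi => by
      simp [extend, hi, φ]
    refine ⟨φ, (hQ φ).2 (hcongr _ _ hφ hq), fun ψ hψ => ?_, fun i => rfl⟩
    have := (hB ψ hψ).2
    have e : ∑ i ∈ Finset.range h, w (s.narr 2 (I * h + i)) =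
        ∑ i ∈ Finset.range h, w (extend φ i) :=
      Finset.sum_congr rfl fun k hk => by rw [hφ k (Finset.mem_range.1 hk)]
    rw [sum_extend ψ hw, e, sum_extend φ hw] at this
    exact this

/-- A relation between vertices of `H` as a relation between natural numbers. -/
def liftRel {h : ℕ} (r : Fin h → Fin h → Prop) (i j : ℕ) : Prop :=
  ∃ (hi : i < h) (hj : j < h), r ⟨i, hi⟩ ⟨j, hj⟩

theorem isPlacement_extend {h : ℕ} {x : WGraph} {s : State} (hx : x.Input s)
    {R N : Fin h → Fin h → Prop} {φ : Fin h → Fin x.n} :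
    IsPlacement (s.narr 0) x.n h (liftRel R) (liftRel N) (extend φ) ↔
      ∀ i j, i ≠ j → φ i ≠ φ j ∧ (R i j → x.G.Adj (φ i) (φ j)) ∧
        (N i j → ¬ x.G.Adj (φ i) (φ j)) := by
  classical
  have hadj : ∀ u v : Fin x.n, s.narr 0 (u * x.n + v) = 1 ↔ x.G.Adj u v := by
    intro u v
    rw [hx.2.1 u v]
    split_ifs with h <;> simp [h]
  constructor
  · rintro ⟨-, h⟩ i j hij
    obtain ⟨h1, h2, h3⟩ := h i i.2 j j.2 fun e => hij (Fin.ext e)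
    rw [extend_val, extend_val] at h1 h2 h3
    refine ⟨fun e => h1 (by rw [e]), fun hr => ?_, fun hr => ?_⟩
    · exact (hadj _ _).1 (h2 ⟨i.2, j.2, hr⟩)
    · exact fun ha => h3 ⟨i.2, j.2, hr⟩ ((hadj _ _).2 ha)
  · intro h
    refine ⟨fun i hi => by simp [extend, hi], fun i hi j hj hij => ?_⟩
    obtain ⟨h1, h2, h3⟩ := h ⟨i, hi⟩ ⟨j, hj⟩ (by simpa using hij)
    simp only [extend, hi, hj, dif_pos]
    refine ⟨fun e => h1 (Fin.ext e), ?_, ?_⟩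
    · rintro ⟨_, _, hr⟩
      exact (hadj _ _).2 (h2 hr)
    · rintro ⟨_, _, hr⟩ ha
      exact h3 hr ((hadj _ _).1 ha)

theorem isInducedCopy_iff {h n : ℕ} {H : SimpleGraph (Fin h)} {G : SimpleGraph (Fin n)}
    {φ : Fin h → Fin n} : IsInducedCopy H G φ ↔ ∀ i j, i ≠ j → φ i ≠ φ j ∧
      (H.Adj i j → G.Adj (φ i) (φ j)) ∧ (¬ H.Adj i j → ¬ G.Adj (φ i) (φ j)) := by
  constructor
  · rintro ⟨f, rfl⟩ i j hij
    exact ⟨f.injective.ne hij, f.map_adj_iff.2, mt f.map_adj_iff.1⟩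
  · intro hφ
    have hinj : Function.Injective φ := fun i j hij => by
      by_contra h
      exact (hφ i j h).1 hij
    refine ⟨⟨⟨φ, hinj⟩, fun {i j} => ?_⟩, rfl⟩
    by_cases hij : i = j
    · subst hij
      simp
    · exact ⟨fun h => by_contra fun h' => (hφ i j hij).2.2 h' h, (hφ i j hij).2.1⟩

/-- The vacuous third clause gives this the shape of `isInducedCopy_iff`, with the empty relation
for the forbidden adjacencies. -/
theorem isSubgraphCopy_iff {h n : ℕ} {H : SimpleGraph (Fin h)} {G : SimpleGraph (Fin n)}
    {φ : Fin h → Fin n} : IsSubgraphCopy H G φ ↔ ∀ i j, i ≠ j → φ i ≠ φ j ∧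
      (H.Adj i j → G.Adj (φ i) (φ j)) ∧ (False → ¬ G.Adj (φ i) (φ j)) := by
  constructor
  · rintro ⟨f, rfl⟩ i j hij
    exact ⟨f.injective.ne hij, fun h => f.toHom.map_adj h, False.elim⟩
  · intro hφ
    have hinj : Function.Injective φ := fun i j hij => by
      by_contra h
      exact (hφ i j h).1 hij
    exact ⟨⟨⟨φ, fun {i j} h => (hφ i j h.ne).2.1 h⟩, hinj⟩, rfl⟩

/-! ### Choosing the parameters -/

theorem sq_add_le_rpow {ω κ : ℝ} {τ : ℕ → ℕ} (h2 : 2 ≤ ω) (h3 : ω ≤ 3) (hκ : 0 ≤ κ)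
    (hτ : ∀ D : ℕ, (τ D : ℝ) ≤ κ * ((D : ℝ) + 1) ^ ω) {D : ℕ} (hD : 0 < D) :
    ((D * D + τ D : ℕ) : ℝ) ≤ (1 + 8 * κ) * (D : ℝ) ^ ω := by
  have hD1 : (1 : ℝ) ≤ D := by exact_mod_cast hD
  have e1 : (D : ℝ) * D ≤ (D : ℝ) ^ ω := by
    calc (D : ℝ) * D = (D : ℝ) ^ (2 : ℝ) := by rw [Real.rpow_two]; ring
      _ ≤ _ := Real.rpow_le_rpow_of_exponent_le hD1 h2
  have e2 : ((D : ℝ) + 1) ^ ω ≤ 8 * (D : ℝ) ^ ω := by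
    calc ((D : ℝ) + 1) ^ ω ≤ (2 * (D : ℝ)) ^ ω :=
          Real.rpow_le_rpow (by positivity) (by linarith) (by linarith)
      _ = (2 : ℝ) ^ ω * (D : ℝ) ^ ω := Real.mul_rpow (by norm_num) (by positivity)
      _ ≤ 8 * (D : ℝ) ^ ω := by
          gcongr
          calc (2 : ℝ) ^ ω ≤ (2 : ℝ) ^ (3 : ℝ) :=
                Real.rpow_le_rpow_of_exponent_le (by norm_num) h3
            _ = 8 := by norm_num
  have e3 := hτ D
  have e4 := mul_le_mul_of_nonneg_left e2 hκ
  push_cast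
  nlinarith

/-- Rounding up the number of blocks costs a factor of two only because `D` does not exceed the side
of the matrix; hence the cap on block sizes. -/
theorem div_add_one_le {n D x e : ℕ} (hD : 0 < D) (he : D ≤ (n + 1) ^ e) (hx : e ≤ x) :
    ((n ^ x / D + 1 : ℕ) : ℝ) ≤ 2 * ((n : ℝ) + 1) ^ x / D := by
  have hD0 : (0 : ℝ) < D := by exact_mod_cast hD
  have h1 : n ^ x / D * D ≤ (n + 1) ^ x :=
    le_trans (Nat.div_mul_le_self _ _) (Nat.pow_le_pow_left (by omega) _)
  have h2 : D ≤ (n + 1) ^ x := he.trans (Nat.pow_le_pow_right (by omega) hx)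
  rw [le_div_iff₀ hD0]
  have : (n ^ x / D + 1) * D ≤ 2 * (n + 1) ^ x := by nlinarith
  exact_mod_cast this

/-- The factor `8` comes from rounding in the three directions, and `1 + 8 * κ` from `D * D` plus `κ
* (D + 1) ^ ω`, where `(D + 1) ^ ω ≤ 2 ^ 3 * D ^ ω`. -/
theorem numBlocks_mul_le {ω κ : ℝ} {τ : ℕ → ℕ} (h2 : 2 ≤ ω) (h3 : ω ≤ 3) (hκ : 0 ≤ κ)
    (hτ : ∀ D : ℕ, (τ D : ℝ) ≤ κ * ((D : ℝ) + 1) ^ ω) {n a c b e D : ℕ} (hea : e ≤ a)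
    (hec : e ≤ c) (heb : e ≤ b) (hD : 0 < D) (he : D ≤ (n + 1) ^ e) :
    ((numBlocks n a c b D * (D * D + τ D) : ℕ) : ℝ) ≤
      8 * (1 + 8 * κ) * (((n : ℝ) + 1) ^ (a + c + b) * (D : ℝ) ^ (ω - 3)) := by
  have hD0 : (0 : ℝ) < D := by exact_mod_cast hD
  have e1 := sq_add_le_rpow h2 h3 hκ hτ hD
  have ea := div_add_one_le hD he hea
  have eb := div_add_one_le hD he heb
  have ec := div_add_one_le hD he hec
  rw [Nat.cast_mul, numBlocks, Nat.cast_mul, Nat.cast_mul]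
  calc _ ≤ 2 * ((n : ℝ) + 1) ^ b / D * (2 * ((n : ℝ) + 1) ^ a / D * (2 * ((n : ℝ) + 1) ^ c / D)) *
        ((1 + 8 * κ) * (D : ℝ) ^ ω) := by gcongr
    _ = _ := by
        rw [Real.rpow_sub hD0, show (D : ℝ) ^ (3 : ℝ) = (D : ℝ) ^ 3 by norm_cast]
        field_simp
        ring

/-- The multiplication time does not increase with `D`, up to constants, so any size that is at
least half of the ideal `(n + 1) ^ μ` is good enough. The loss is `2 ^ (3 - ω) ≤ 2`. -/
theorem numBlocks_mul_le_of_le {ω κ : ℝ} {τ : ℕ → ℕ} (h2 : 2 ≤ ω) (h3 : ω ≤ 3) (hκ : 0 ≤ κ)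
    (hτ : ∀ D : ℕ, (τ D : ℝ) ≤ κ * ((D : ℝ) + 1) ^ ω) {n a c b e D : ℕ} (hea : e ≤ a)
    (hec : e ≤ c) (heb : e ≤ b) (hD : 0 < D) (he : D ≤ (n + 1) ^ e) {μ θ : ℝ}
    (hθ : ((a + c + b : ℕ) : ℝ) - (3 - ω) * μ ≤ θ) (hμ : ((n : ℝ) + 1) ^ μ ≤ 2 * D) :
    ((numBlocks n a c b D * (D * D + τ D) : ℕ) : ℝ) ≤
      16 * (1 + 8 * κ) * ((n : ℝ) + 1) ^ θ := by
  have hM : (1 : ℝ) ≤ (n : ℝ) + 1 := by linarith [Nat.cast_nonneg (α := ℝ) n]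
  have hM0 : (0 : ℝ) < (n : ℝ) + 1 := by linarith
  refine (numBlocks_mul_le h2 h3 hκ hτ hea hec heb hD he).trans ?_
  have e1 : (D : ℝ) ^ (ω - 3) ≤ 2 * ((n : ℝ) + 1) ^ (-((3 - ω) * μ)) := by
    calc (D : ℝ) ^ (ω - 3) ≤ (((n : ℝ) + 1) ^ μ / 2) ^ (ω - 3) :=
          Real.rpow_le_rpow_of_nonpos (by positivity) (by linarith) (by linarith)
      _ = ((n : ℝ) + 1) ^ (-((3 - ω) * μ)) / 2 ^ (ω - 3) := by
          rw [Real.div_rpow (by positivity) (by norm_num), ← Real.rpow_mul hM0.le]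
          ring_nf
      _ = 2 ^ (3 - ω) * ((n : ℝ) + 1) ^ (-((3 - ω) * μ)) := by
          rw [show ω - 3 = -(3 - ω) by ring, Real.rpow_neg (by norm_num : (0 : ℝ) ≤ 2), div_inv_eq_mul,
            mul_comm]
      _ ≤ 2 * ((n : ℝ) + 1) ^ (-((3 - ω) * μ)) := by
          gcongr
          calc (2 : ℝ) ^ (3 - ω) ≤ (2 : ℝ) ^ (1 : ℝ) :=
                Real.rpow_le_rpow_of_exponent_le (by norm_num) (by linarith)
            _ = 2 := by norm_num
  have e2 : ((n : ℝ) + 1) ^ (a + c + b) * ((n : ℝ) + 1) ^ (-((3 - ω) * μ)) ≤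
      ((n : ℝ) + 1) ^ θ := by
    rw [← Real.rpow_natCast, ← Real.rpow_add hM0]
    exact Real.rpow_le_rpow_of_exponent_le hM (by linarith)
  have e3 := mul_le_mul_of_nonneg_left e1
    (show 0 ≤ ((n : ℝ) + 1) ^ (a + c + b) by positivity)
  have e4 : ((n : ℝ) + 1) ^ (a + c + b) * (D : ℝ) ^ (ω - 3) ≤ 2 * ((n : ℝ) + 1) ^ θ := by
    linarith
  have := mul_le_mul_of_nonneg_left e4 (show 0 ≤ 8 * (1 + 8 * κ) by positivity)
  linarith

/-- Compare the size found with the ideal one. If it is not much larger, the scan is cheap and the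
multiplication is either within budget or already efficient. If it is larger, the multiplication is
cheap, and the rejection of half the size bounds the scan. -/
theorem GoodSize.le_rpow {ω κ : ℝ} {τ : ℕ → ℕ} (h2 : 2 ≤ ω) (h3 : ω ≤ 3) (hκ : 0 ≤ κ)
    (hτ : ∀ D : ℕ, (τ D : ℝ) ≤ κ * ((D : ℝ) + 1) ^ ω) {n a c b e C₀ D T : ℕ} (hea : e ≤ a)
    (hec : e ≤ c) (heb : e ≤ b) {μ θ : ℝ} (hμ0 : 0 ≤ μ) (hμ : μ ≤ e)
    (hθ : ((a + c + b : ℕ) : ℝ) - (3 - ω) * μ ≤ θ) (hθ' : ((a + c : ℕ) : ℝ) + μ ≤ θ)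
    (hG : GoodSize n a c b τ ((n + 1) ^ e) C₀ D T) :
    (((n + 1) ^ (a + c) * D + T : ℕ) : ℝ) ≤
      (2 * (C₀ + 1) + 2 + 3 * (16 * (1 + 8 * κ))) * ((n : ℝ) + 1) ^ θ := by
  have hM : (1 : ℝ) ≤ (n : ℝ) + 1 := by linarith [Nat.cast_nonneg (α := ℝ) n]
  have hM0 : (0 : ℝ) < (n : ℝ) + 1 := by linarith
  set V := ((n : ℝ) + 1) ^ θ with hV
  have hV0 : 0 ≤ V := by positivity
  have hκV : 0 ≤ κ * V := by positivity
  have hC₀V : 0 ≤ (C₀ : ℝ) * V := by positivity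
  have hμe : ((n : ℝ) + 1) ^ μ ≤ (((n + 1) ^ e : ℕ) : ℝ) := by
    push_cast
    rw [← Real.rpow_natCast]
    exact Real.rpow_le_rpow_of_exponent_le hM hμ
  have htime : ((n : ℝ) + 1) ^ μ ≤ 2 * D → (T : ℝ) ≤ 16 * (1 + 8 * κ) * V := fun hle =>
    le_trans (by exact_mod_cast hG.time)
      (numBlocks_mul_le_of_le h2 h3 hκ hτ hea hec heb hG.pos hG.le hθ hle)
  rw [Nat.cast_add, Nat.cast_mul]
  rcases le_total (D : ℝ) (2 * ((n : ℝ) + 1) ^ μ) with hle | hle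
  · have e1 : (((n + 1) ^ (a + c) : ℕ) : ℝ) * D ≤ 2 * V := by
      have : (((n + 1) ^ (a + c) : ℕ) : ℝ) * ((n : ℝ) + 1) ^ μ ≤ V := by
        push_cast
        rw [← Real.rpow_natCast, ← Real.rpow_add hM0]
        exact Real.rpow_le_rpow_of_exponent_le hM hθ'
      have := mul_le_mul_of_nonneg_left hle
        (Nat.cast_nonneg (α := ℝ) ((n + 1) ^ (a + c)))
      linarith
    -- If the budget gives no bound, then `D` is more than half of the cap `(n + 1) ^ e`, which is
    -- at least `(n + 1) ^ μ`.
    rcases hG.budget with hb | hb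
    · have e2 := htime (hμe.trans (by exact_mod_cast hb.le))
      linarith
    · have e2 : (T : ℝ) ≤ (C₀ + 1) * ((((n + 1) ^ (a + c) : ℕ) : ℝ) * D) := by exact_mod_cast hb
      have e3 := mul_le_mul_of_nonneg_left e1 (show (0 : ℝ) ≤ C₀ + 1 by positivity)
      linarith
  · have hμ1 : 1 ≤ ((n : ℝ) + 1) ^ μ := Real.one_le_rpow hM hμ0
    have e1 := htime (by linarith)
    -- Here `D` is at least `2`, so it arose by doubling. The rejected `D'` is still at least `(n +
    -- 1) ^ μ`, and its budget was smaller than a multiplication time that is itself small.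
    rcases hG.prev with h1 | ⟨D', rfl, hD'⟩
    · rw [h1, Nat.cast_one] at hle
      linarith
    · have hpos := hG.pos
      have hle' := hG.le
      push_cast at hle
      have e2 := numBlocks_mul_le_of_le h2 h3 hκ hτ (n := n) hea hec heb (D := D') (by omega)
        (by omega) hθ (by linarith)
      have e3 : (((n + 1) ^ (a + c) : ℕ) : ℝ) * D' ≤ 16 * (1 + 8 * κ) * V :=
        le_trans (by exact_mod_cast hD'.le) e2
      push_cast at e3 ⊢
      linarith

/-- An exponent of `n + 2` that bounds all the words that occur. -/
def wordExp (h d C₀ : ℕ) : ℕ := 3 * h + 5 + C₀ + (h + 2) * d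

/-- Constants such as `h` and `C₀` are absorbed into the exponent, since the base is at least `2`.
-/
theorem le_two_pow_mul {n k : ℕ} : k ≤ (n + 2) ^ k :=
  (Nat.lt_two_pow_self).le.trans (Nat.pow_le_pow_left (by omega) k)

theorem table_le {n h d C₀ : ℕ} : (n * n + 1) * h ≤ (n + 2) ^ wordExp h d C₀ := by
  calc (n * n + 1) * h ≤ (n + 2) ^ 2 * (n + 2) ^ h :=
        Nat.mul_le_mul (by nlinarith) le_two_pow_mul
    _ = (n + 2) ^ (2 + h) := (pow_add _ _ _).symm
    _ ≤ _ := Nat.pow_le_pow_right (by omega) (by unfold wordExp; nlinarith [Nat.zero_le ((h + 2) * d)])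

theorem sq_succ_le {n h d C₀ : ℕ} : n * n + 1 ≤ (n + 2) ^ wordExp h d C₀ := by
  calc n * n + 1 ≤ (n + 2) ^ 2 := by nlinarith
    _ ≤ _ := Nat.pow_le_pow_right (by omega) (by unfold wordExp; nlinarith [Nat.zero_le ((h + 2) * d)])

theorem room_wordExp {ω κ : ℝ} {τ : ℕ → ℕ} (h2 : 2 ≤ ω) (h3 : ω ≤ 3) (hκ : 0 ≤ κ)
    (hτ : ∀ D : ℕ, (τ D : ℝ) ≤ κ * ((D : ℝ) + 1) ^ ω) {n h a c b e d C₀ D : ℕ} (hea : e ≤ a)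
    (hec : e ≤ c) (heb : e ≤ b) (hh : a + c + b = h) (hC₀ : 1 + 8 * κ ≤ C₀) (hD : 0 < D)
    (he : D ≤ (n + 1) ^ e) : Room h n a c b d τ ((n + 2) ^ wordExp h d C₀) D := by
  have hstep : ∀ k, (n + 1) ^ k ≤ (n + 2) ^ k := fun k => Nat.pow_le_pow_left (by omega) k
  have heh : e ≤ h := by omega
  have hDe : D ≤ (n + 2) ^ e := he.trans (hstep e)
  have hw : ∀ k, k ≤ wordExp h d C₀ → (n + 2) ^ k ≤ (n + 2) ^ wordExp h d C₀ :=
    fun k hk => Nat.pow_le_pow_right (by omega) hk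
  have hW0 : 0 ≤ (h + 2) * d := Nat.zero_le _
  constructor
  · calc 2 * (n + 1) ^ h ≤ (n + 2) * (n + 2) ^ h := Nat.mul_le_mul (by omega) (hstep h)
      _ = (n + 2) ^ (h + 1) := by ring
      _ ≤ _ := hw _ (by unfold wordExp; omega)
  · exact he.trans (Nat.pow_le_pow_right (by omega) heh)
  · have h1 : D + 2 ≤ (n + 2) ^ (h + 2) := by
      calc D + 2 ≤ (n + 2) ^ e * 4 := by
            have : 1 ≤ (n + 2) ^ e := Nat.one_le_pow _ _ (by omega)
            omega
        _ ≤ (n + 2) ^ e * (n + 2) ^ 2 := Nat.mul_le_mul le_rfl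
            (by simpa using Nat.pow_le_pow_left (show 2 ≤ n + 2 by omega) 2)
        _ = (n + 2) ^ (e + 2) := (pow_add _ _ _).symm
        _ ≤ _ := Nat.pow_le_pow_right (by omega) (by omega)
    calc (D + 2) ^ d ≤ ((n + 2) ^ (h + 2)) ^ d := Nat.pow_le_pow_left h1 d
      _ = (n + 2) ^ ((h + 2) * d) := (pow_mul _ _ _).symm
      _ ≤ _ := hw _ (by unfold wordExp; omega)
  · have h1 := numBlocks_mul_le h2 h3 hκ hτ hea hec heb hD he
    have hD1 : (1 : ℝ) ≤ D := by exact_mod_cast hD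
    have h4 : (D : ℝ) ^ (ω - 3) ≤ 1 := Real.rpow_le_one_of_one_le_of_nonpos hD1 (by linarith)
    have h5 : numBlocks n a c b D * (D * D + τ D) ≤ 8 * C₀ * (n + 1) ^ h := by
      have : ((numBlocks n a c b D * (D * D + τ D) : ℕ) : ℝ) ≤ 8 * C₀ * ((n : ℝ) + 1) ^ h := by
        refine h1.trans ?_
        rw [hh]
        calc _ ≤ 8 * (C₀ : ℝ) * (((n : ℝ) + 1) ^ h * 1) := by gcongr
          _ = _ := by ring
      exact_mod_cast this
    calc _ ≤ 8 * C₀ * (n + 1) ^ h := h5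
      _ ≤ (n + 2) ^ 3 * (n + 2) ^ C₀ * (n + 2) ^ h :=
          Nat.mul_le_mul (Nat.mul_le_mul
            (by simpa using Nat.pow_le_pow_left (show 2 ≤ n + 2 by omega) 3) le_two_pow_mul) (hstep h)
      _ = (n + 2) ^ (3 + C₀ + h) := by rw [pow_add, pow_add]
      _ ≤ _ := hw _ (by unfold wordExp; omega)
  · calc (n + 1) ^ (a + c) * D ≤ (n + 2) ^ (a + c) * (n + 2) ^ e := Nat.mul_le_mul (hstep _) hDe
      _ = (n + 2) ^ (a + c + e) := (pow_add _ _ _).symm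
      _ ≤ _ := hw _ (by unfold wordExp; omega)

/-- As `ω ≤ 3`, one block costs `O(D ^ 3)`, and `D ^ 2` is at most `(n + 1) ^ (a + c)`. So
overshooting the budget by one block is harmless. -/
theorem sq_add_le_mul {ω κ : ℝ} {τ : ℕ → ℕ} (h2 : 2 ≤ ω) (h3 : ω ≤ 3) (hκ : 0 ≤ κ)
    (hτ : ∀ D : ℕ, (τ D : ℝ) ≤ κ * ((D : ℝ) + 1) ^ ω) {n a c e C₀ D : ℕ} (hea : e ≤ a)
    (hec : e ≤ c) (hC₀ : 1 + 8 * κ ≤ C₀) (hD : 0 < D) (he : D ≤ (n + 1) ^ e) :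
    D * D + τ D ≤ C₀ * ((n + 1) ^ (a + c) * D) := by
  have hD1 : (1 : ℝ) ≤ D := by exact_mod_cast hD
  have h1 := sq_add_le_rpow h2 h3 hκ hτ hD
  have h4 : (D : ℝ) ^ ω ≤ (D : ℝ) ^ 3 := by
    rw [← Real.rpow_natCast]
    exact Real.rpow_le_rpow_of_exponent_le hD1 (by exact_mod_cast h3)
  have h5 : D * D + τ D ≤ C₀ * D ^ 3 := by
    have : ((D * D + τ D : ℕ) : ℝ) ≤ C₀ * (D : ℝ) ^ 3 :=
      h1.trans (mul_le_mul hC₀ h4 (by positivity) (by positivity))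
    exact_mod_cast this
  have h6 : D * D ≤ (n + 1) ^ (a + c) := by
    calc D * D ≤ (n + 1) ^ e * (n + 1) ^ e := Nat.mul_le_mul he he
      _ = (n + 1) ^ (e + e) := (pow_add _ _ _).symm
      _ ≤ _ := Nat.pow_le_pow_right (by omega) (by omega)
  calc D * D + τ D ≤ C₀ * D ^ 3 := h5
    _ = C₀ * (D * D * D) := by ring
    _ ≤ _ := Nat.mul_le_mul le_rfl (Nat.mul_le_mul h6 le_rfl)


/-! ### Time bounds for the subgraph problems from a multiplication algorithm and a plan. -/

theorem SolvableInTime.mono {I : Type} {size : I → ℕ} {input output : I → State → Prop}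
    {τ τ' : ℝ} (h : SolvableInTime size input output τ) (hτ : τ ≤ τ') :
    SolvableInTime size input output τ' := by
  obtain ⟨p, d, C, hp⟩ := h
  -- The given constant may be negative.
  refine ⟨p, d, |C|, fun x s hx => ?_⟩
  obtain ⟨s', k, h1, h2, h3⟩ := hp x s hx
  refine ⟨s', k, h1, h2, h3.trans ?_⟩
  have hM : (1 : ℝ) ≤ (size x : ℝ) + 1 := by linarith [Nat.cast_nonneg (α := ℝ) (size x)]
  exact mul_le_mul (le_abs_self C) (Real.rpow_le_rpow_of_exponent_le hM hτ)
    (by positivity) (abs_nonneg C)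

theorem exists_multiplies {ω : ℝ} (hM : MatMulInTime ω) : ∃ (p : Prog) (d : ℕ) (κ : ℝ)
    (τ : ℕ → ℕ), 0 ≤ κ ∧ (∀ D : ℕ, (τ D : ℝ) ≤ κ * ((D : ℝ) + 1) ^ ω) ∧ Multiplies p d τ := by
  obtain ⟨p, d, C, hp⟩ := hM
  refine ⟨p, d, |C|, fun D => ⌊|C| * ((D : ℝ) + 1) ^ ω⌋₊, abs_nonneg C,
    fun D => Nat.floor_le (by positivity), fun x s hx => ?_⟩
  obtain ⟨s', k, h1, h2, h3⟩ := hp x s hx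
  refine ⟨s', k, h1, h2, Nat.le_floor (h3.trans ?_)⟩
  exact mul_le_mul_of_nonneg_right (le_abs_self C) (by positivity)

/-- The time bound for the algorithm with the parameters `b` and `μ`. -/
def planExp (ω : ℝ) (h b : ℕ) (μ : ℝ) : ℝ := max ((h : ℝ) - b + μ) (h - (3 - ω) * μ)

/-- Parameters for the algorithm: `b` vertices are enumerated in an order by weight, and blocks of
side `n ^ μ` are multiplied. -/
structure IsPlan (h b : ℕ) (μ : ℝ) : Prop where
  pos : 1 ≤ b
  le : b + 2 ≤ h
  nonneg : 0 ≤ μ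
  le_left : μ ≤ b
  le_right : μ ≤ ((h - b) / 2 : ℕ)

theorem IsPlan.two_le {ω : ℝ} {h b : ℕ} {μ : ℝ} (hp : IsPlan h b μ) : 2 ≤ planExp ω h b μ := by
  refine le_max_of_le_left ?_
  have h1 : (b : ℝ) + 2 ≤ h := by exact_mod_cast hp.le
  linarith [hp.nonneg]

/-- Sorting is never the bottleneck: since `3 - ω ≤ 1` and `μ ≤ (h - b) / 2`, the multiplication
exponent is at least `b + (h - b) / 2`. This is where `2 ≤ ω` is needed. -/
theorem IsPlan.add_one_le {ω : ℝ} {h b : ℕ} {μ : ℝ} (hp : IsPlan h b μ) (h2 : 2 ≤ ω) :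
    (b : ℝ) + 1 ≤ planExp ω h b μ := by
  refine le_max_of_le_right ?_
  have h1 : (b : ℝ) + 2 ≤ h := by exact_mod_cast hp.le
  have h3 : 2 * (((h - b) / 2 : ℕ) : ℝ) ≤ h - b := by
    rw [← Nat.cast_sub (by linarith [hp.le])]
    exact_mod_cast Nat.mul_div_le (h - b) 2
  nlinarith [hp.nonneg, hp.le_right]

/-- The `h - b` outer positions are halved, the rows getting the larger part. The cap exponent `e =
min b c` is then at most each of `a`, `b`, `c`, while `μ ≤ e` keeps the ideal block size within
reach. -/
theorem solvable_of_tasks {ω : ℝ} (hM : MatMulInTime ω) (h2 : 2 ≤ ω) (h3 : ω ≤ 3) {h b : ℕ}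
    {μ : ℝ} (hp : IsPlan h b μ) {l : List Task} (hl : ∀ K ∈ l, K.h = h)
    {P : (ℕ → ℕ) → ℕ → ℕ → (ℕ → ℕ) → Prop}
    (hK : ∀ {n W A}, 0 < n → (n * n + 1) * h ≤ W → (n + 1) ^ h ≤ W →
      ∀ K ∈ l, K.Correct W n (n * n + 1) A (P A n) (slotVal n))
    (hslot : ∀ {n ac}, 2 ≤ ac → ∀ K ∈ l, ∀ f ∈ K.slots, ∀ y < n ^ ac, ∀ z < n ^ b, ∀ z' < n ^ b,
      slotVal n f (y + n ^ ac * z) = slotVal n f (y + n ^ ac * z'))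
    {output : WGraph → State → Prop}
    (hout : ∀ {x : WGraph} {s s' : State}, x.Input s →
      TableInv h (x.n * x.n + 1) (P (s.narr 0) x.n) s' →
      (0 < x.n → ∀ K ∈ l, ∀ y < x.n ^ h,
        Entered K x.n (s.narr 0) (s.rarr 0) (slotVal x.n) s' y) → output x s') :
    SolvableInTime WGraph.n WGraph.Input output (planExp ω h b μ) := by
  obtain ⟨p, d, κ, τ, hκ, hτ, hmul⟩ := exists_multiplies hM
  obtain ⟨C₀, hC₀⟩ := exists_nat_ge (1 + 8 * κ)
  have hbh := hp.le
  have hb1 := hp.pos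
  set c := (h - b) / 2 with hc
  set a := h - b - c with ha
  set e := min b c with he
  have hea : e ≤ a := by omega
  have hec : e ≤ c := by omega
  have heb : e ≤ b := by omega
  have hh : a + c + b = h := by omega
  have hμe : μ ≤ e := by
    rw [he, Nat.cast_min]
    exact le_min hp.le_left hp.le_right
  obtain ⟨C, hC⟩ := runs_mainProg h a c b e p C₀ l hl
  set θ := planExp ω h b μ with hθ
  set κ' := 2 * ((C₀ : ℝ) + 1) + 2 + 3 * (16 * (1 + 8 * κ)) with hκ'
  have hκ0 : 0 ≤ κ' := by positivity
  refine ⟨mainProg a c b e p l, wordExp h d C₀, C * (κ' + 2), fun x s hx => ?_⟩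
  set n := x.n with hn
  have hMn : (1 : ℝ) ≤ (n : ℝ) + 1 := by linarith [Nat.cast_nonneg (α := ℝ) n]
  have hM0 : (0 : ℝ) < (n : ℝ) + 1 := by linarith
  have hpow : ∀ k : ℕ, (k : ℝ) ≤ θ → ((n : ℝ) + 1) ^ k ≤ ((n : ℝ) + 1) ^ θ := fun k hk => by
    rw [← Real.rpow_natCast]
    exact Real.rpow_le_rpow_of_exponent_le hMn hk
  have hac : ((a + c : ℕ) : ℝ) = h - b := by
    rw [← hh]
    push_cast
    ring
  have hroom := fun D hD0 hD =>
    room_wordExp (d := d) (D := D) h2 h3 hκ hτ (n := n) hea hec heb hh hC₀ hD0 hD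
  -- The `κ'` pays for the products and the scan, the `+ 1` for sorting; clearing the table, which
  -- takes `(n + 1) ^ 2`, accounts for the `+ 2` in the final constant.
  have hrun := hC (X := ⌊(κ' + 1) * ((n : ℝ) + 1) ^ θ⌋₊) (A := s.narr 0) (P := P (s.narr 0) n)
    (slot := slotVal n) (w := s.rarr 0) (W := (n + 2) ^ wordExp h d C₀) (s := s) (n := n) hmul
    (fun hn0 => hK hn0 table_le
      (le_trans (by omega) (hroom 1 one_pos (Nat.one_le_pow _ _ (by omega))).pow)) hh (by omega)
    (by omega) sq_succ_le (hslot (by omega)) hroom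
    (fun D hD0 hD => sq_add_le_mul h2 h3 hκ hτ hea hec hC₀ hD0 hD)
    (fun D T hG => Nat.le_floor ?_) hx.1 rfl rfl
  · obtain ⟨s', k, hexec, hk, hT, hE⟩ := hrun
    refine ⟨s', k, hexec, hout hx hT hE, ?_⟩
    have h1 : (k : ℝ) ≤ C * (⌊(κ' + 1) * ((n : ℝ) + 1) ^ θ⌋₊ + ((n : ℝ) + 1) ^ 2) := by
      exact_mod_cast hk
    refine h1.trans ?_
    rw [mul_assoc]
    refine mul_le_mul_of_nonneg_left ?_ (Nat.cast_nonneg C)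
    have h4 := Nat.floor_le (show 0 ≤ (κ' + 1) * ((n : ℝ) + 1) ^ θ by positivity)
    have h5 := hpow 2 (by exact_mod_cast hp.two_le)
    linarith
  · have h4 := hG.le_rpow h2 h3 hκ hτ hea hec heb (μ := μ) (θ := θ) hp.nonneg hμe
      (by rw [hh]; exact le_max_right _ _) (by rw [hac]; exact le_max_left _ _)
    have h5 := hpow (b + 1) (by push_cast; exact hp.add_one_le h2)
    rw [Nat.cast_add]
    push_cast at h4 h5 ⊢
    linarith

theorem solvable_pairs {ω : ℝ} (hM : MatMulInTime ω) (h2 : 2 ≤ ω) (h3 : ω ≤ 3) {h b : ℕ}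
    {μ : ℝ} (hp : IsPlan h b μ) (H : SimpleGraph (Fin h)) :
    SolvableInTime WGraph.n WGraph.Input (AllPairsOutput H) (planExp ω h b μ) := by
  have hbh := hp.le
  set R := liftRel H.Adj
  set N := liftRel fun i j => ¬ H.Adj i j
  refine solvable_of_tasks hM h2 h3 hp (l := pairTasks h R N) (fun K hK => ?_)
    (P := fun A n => PairPred A n h R N)
    (fun hn hW hP => correct_pairTasks (by omega) hn hW hP) (fun hac => slot_pairTasks hac) ?_
  · obtain ⟨i, -, j, -, -, rfl⟩ := mem_pairTasks.1 hK
    rfl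
  · intro x s s' hx hT hE u v
    have hn : 0 < x.n := u.pos
    have hcopy : ∀ φ : Fin h → Fin x.n,
        IsInducedCopy H x.G φ ↔ IsPlacement (s.narr 0) x.n h R N (extend φ) := fun φ =>
      isInducedCopy_iff.trans (isPlacement_extend hx).symm
    have hrange : ∀ (φ : Fin h → Fin x.n) (u : Fin x.n), u ∈ Set.range φ ↔
        ∃ i < h, extend φ i = u := by
      intro φ u
      constructor
      · rintro ⟨i, rfl⟩
        exact ⟨i, i.2, extend_val φ i⟩
      · rintro ⟨i, hi, hu⟩
        exact ⟨⟨i, hi⟩, Fin.ext (by rw [← hu, ← extend_val φ ⟨i, hi⟩])⟩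
    have hlt : ∀ f, PairPred (s.narr 0) x.n h R N (u * x.n + v) f → ∀ i < h, f i < x.n :=
      fun f hf => hf.1.1
    refine findsMax_of_table (Q := PairPred (s.narr 0) x.n h R N) hx.2.2 (fun φ => ?_) hlt ?_ hT
      ?_ ?_
    · rw [hcopy, hrange, hrange, PairPred]
      refine and_congr_right fun hpl => ?_
      constructor
      · rintro ⟨⟨i, hi, hu⟩, j, hj, hv⟩
        exact ⟨i, hi, j, hj, by rw [hu, hv]⟩
      · rintro ⟨i, hi, j, hj, hij⟩
        have hj' := hpl.1 j hj
        have hi' := hpl.1 i hi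
        -- The slot number `u * n + v` determines `u` and `v` as quotient and remainder.
        have hmod := congrArg (· % x.n) hij
        have hdiv := congrArg (· / x.n) hij
        simp only [Nat.mul_add_mod_of_lt, hj', v.2] at hmod
        simp only [mul_comm _ x.n, Nat.mul_add_div hn, Nat.div_eq_of_lt hj',
          Nat.div_eq_of_lt v.2, add_zero] at hdiv
        exact ⟨⟨i, hi, hdiv.symm⟩, j, hj, hmod.symm⟩
    · rintro f g hfg ⟨h1, i, hi, j, hj, hI⟩
      exact ⟨h1.congr hfg, i, hi, j, hj, by rw [hI, hfg i hi, hfg j hj]⟩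
    · have := u.2
      have := v.2
      nlinarith
    · rintro φ ⟨hφ, hu, hv⟩
      obtain ⟨i, hi, hu⟩ := (hrange φ u).1 hu
      obtain ⟨j, hj, hv⟩ := (hrange φ v).1 hv
      rw [← hu, ← hv]
      exact beats_pairTasks (by omega) hn (hE hn) ((hcopy φ).1 hφ) hi hj

theorem solvable_single {ω : ℝ} (hM : MatMulInTime ω) (h2 : 2 ≤ ω) (h3 : ω ≤ 3) {h b : ℕ}
    {μ : ℝ} (hp : IsPlan h b μ) {R N : Fin h → Fin h → Prop}
    {P : (x : WGraph) → (Fin h → Fin x.n) → Prop}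
    (hP : ∀ x (φ : Fin h → Fin x.n), P x φ ↔ ∀ i j, i ≠ j → φ i ≠ φ j ∧
      (R i j → x.G.Adj (φ i) (φ j)) ∧ (N i j → ¬ x.G.Adj (φ i) (φ j))) :
    SolvableInTime WGraph.n WGraph.Input
      (fun x s => FindsMax (P x) x.w (s.narr 1 0) (s.narr 2)) (planExp ω h b μ) := by
  have hbh := hp.le
  refine solvable_of_tasks hM h2 h3 hp (l := singleTasks h (liftRel R) (liftRel N))
    (fun K hK => ?_) (P := fun A n _ => IsPlacement A n h (liftRel R) (liftRel N))
    (fun hn hW hP => correct_singleTasks (by omega) hn hW hP) (fun _ => slot_singleTasks) ?_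
  · obtain rfl := List.mem_singleton.1 hK
    rfl
  · intro x s s' hx hT hE
    have hcopy : ∀ φ : Fin h → Fin x.n,
        P x φ ↔ IsPlacement (s.narr 0) x.n h (liftRel R) (liftRel N) (extend φ) := fun φ =>
      (hP x φ).trans (isPlacement_extend hx).symm
    have key := findsMax_of_table (I := 0)
      (Q := fun _ => IsPlacement (s.narr 0) x.n h (liftRel R) (liftRel N)) hx.2.2 hcopy
      (fun f hf => hf.1) (fun f g hfg hf => hf.congr hfg) hT (Nat.succ_pos _) ?_
    · simpa only [Nat.zero_mul, Nat.zero_add] using key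
    · intro φ hφ
      have hn : 0 < x.n := (φ ⟨0, by omega⟩).pos
      exact beats_singleTasks hn (hE hn) ((hcopy φ).1 hφ)

theorem maxHSubgraphInTime_of_isPlan {ω : ℝ} (hM : MatMulInTime ω) (h2 : 2 ≤ ω) (h3 : ω ≤ 3)
    {h b : ℕ} {μ θ : ℝ} (hp : IsPlan h b μ) (hθ : planExp ω h b μ ≤ θ) (H : SimpleGraph (Fin h)) :
    MaxHSubgraphInTime H θ :=
  ⟨(solvable_pairs hM h2 h3 hp H).mono hθ,
    (solvable_single hM h2 h3 hp fun _ _ => isInducedCopy_iff).mono hθ,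
    (solvable_single hM h2 h3 hp (N := fun _ _ => False) fun _ _ => isSubgraphCopy_iff).mono hθ⟩


/-! ### Bounds for the exponent of matrix multiplication -/

/-- Add the product of two entries to register `4`; the row and the column are given by register `1`,
the inner index by register `2`. -/
def mulAddStep : Prog :=
  .setN 4 (.add (.reg 4) (.mul (.get 0 (.add (.mul (.div (.reg 1) (.reg 0)) (.reg 0)) (.reg 2)))
    (.get 1 (.add (.mul (.reg 2) (.reg 0)) (.mod (.reg 1) (.reg 0))))))

/-- The standard algorithm for matrix multiplication. -/
def naiveMul : Prog :=
  .seq (.setN 5 (.mul (.reg 0) (.reg 0)))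
    (forLoop 1 5 (.seq (.setN 4 (.const 0))
      (.seq (forLoop 2 0 mulAddStep) (.putN 2 (.reg 1) (.reg 4)))))

theorem runs_mulAdd {W n e : ℕ} {s : State} (hn0 : 0 < n) (hW : n * n + n ≤ W) (hn : s.nreg 0 = n)
    (h1 : s.nreg 1 = e) (he : e < n * n) (h4 : s.nreg 4 = 0)
    (hA : ∀ i < n, ∀ j < n, s.narr 0 (i * n + j) ≤ 1)
    (hB : ∀ i < n, ∀ j < n, s.narr 1 (i * n + j) ≤ 1) :
    Runs W (forLoop 2 0 mulAddStep) s fun s' k => k ≤ (n + 1) * (mulAddStep.passCost + 8) ∧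
      s'.nreg 4 = ∑ k ∈ Finset.range n, s.narr 0 (e / n * n + k) * s.narr 1 (k * n + e % n) := by
  have hq : e / n < n := Nat.div_lt_of_lt_mul he
  have hr : e % n < n := Nat.mod_lt _ hn0
  have hle : ∀ k < n, s.narr 0 (e / n * n + k) * s.narr 1 (k * n + e % n) ≤ 1 := fun k hk =>
    Nat.mul_le_mul (hA _ hq k hk) (hB k hk _ hr)
  refine runs_forLoop (fun j s' => s'.nreg 4 =
    ∑ k ∈ Finset.range j, s.narr 0 (e / n * n + k) * s.narr 1 (k * n + e % n))
    _ hn (by omega) (by omega) (by simp [mulAddStep, Prog.ModN]) (by simp [mulAddStep, Prog.ModN])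
    (by simp [h4]) ?_
  intro j s' hj h2 hu ih
  have hmod : ∀ x, (forLoop 2 0 mulAddStep).ModN x → x = 2 ∨ x = 4 := by
    intro x
    rw [modN_forLoop]
    simp only [mulAddStep, Prog.ModN]
    tauto
  have hn' : s'.nreg 0 = n := by rw [hu.nreg 0 fun h => by have := hmod 0 h; omega, hn]
  have h1' : s'.nreg 1 = e := by rw [hu.nreg 1 fun h => by have := hmod 1 h; omega, h1]
  have ha : ∀ a, s'.narr a = s.narr a := fun a => hu.narr a fun h => by
    rw [modA_forLoop] at h
    simp [mulAddStep, Prog.ModA] at h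
  -- The entries are 0 or 1, so partial sums stay below the word bound.
  have hsum : ∑ k ∈ Finset.range j, s.narr 0 (e / n * n + k) * s.narr 1 (k * n + e % n) ≤ j := by
    calc _ ≤ ∑ k ∈ Finset.range j, 1 :=
          Finset.sum_le_sum fun k hk => hle k (by have := Finset.mem_range.1 hk; omega)
      _ = j := by simp
  refine Runs.timed (by simp [mulAddStep, Prog.LoopFree]) ?_
  unfold mulAddStep
  rw [runs_setN]
  simp only [NExp.Fits, NExp.eval, hn', h1', h2, ih, ha, true_and, and_true, State.nreg_setReg,
    Nat.reduceEqDiff, if_true, if_false]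
  have := hle j hj
  have h5 : (e / n + 1) * n ≤ n * n := Nat.mul_le_mul_right n hq
  have h6 : (j + 1) * n ≤ n * n := Nat.mul_le_mul_right n hj
  rw [add_one_mul] at h5 h6
  refine ⟨⟨⟨⟨?_, ?_⟩, ⟨?_, ?_⟩, ?_⟩, ?_⟩, (Finset.sum_range_succ _ _).symm⟩ <;> omega

/-- This shows that `3` is an admissible exponent, so the infimum is over a nonempty set and is at
most `3`. -/
theorem multiplies_naive : ∃ C : ℕ, Multiplies naiveMul 2 fun n => C * (n + 1) ^ 3 := by
  refine ⟨mulAddStep.passCost + 25, fun x s hx => ?_⟩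
  obtain ⟨hn, hA, hB⟩ := hx
  set n := x.n with hnx
  have hA' : ∀ i < n, ∀ j < n, s.narr 0 (i * n + j) ≤ 1 := fun i hi j hj =>
    (hA ⟨i, hi⟩ ⟨j, hj⟩).le.trans (x.A_le_one _ _)
  have hB' : ∀ i < n, ∀ j < n, s.narr 1 (i * n + j) ≤ 1 := fun i hi j hj =>
    (hB ⟨i, hi⟩ ⟨j, hj⟩).le.trans (x.B_le_one _ _)
  have hW : n * n + n ≤ (n + 2) ^ 2 := by nlinarith
  set t := mulAddStep.passCost
  have key : Runs ((n + 2) ^ 2) naiveMul s fun s' k =>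
      k ≤ 4 + (n * n + 1) * (5 + (n + 1) * (t + 8) + 8) ∧ ∀ e < n * n, s'.narr 2 e =
        ∑ k ∈ Finset.range n, s.narr 0 (e / n * n + k) * s.narr 1 (k * n + e % n) := by
    unfold naiveMul
    rw [runs_seq, runs_setN]
    simp only [NExp.Fits, NExp.eval, hn, true_and]
    refine ⟨by omega, Runs.mono (runs_forLoop (fun e s' => ∀ e' < e, s'.narr 2 e' =
        ∑ k ∈ Finset.range n, s.narr 0 (e' / n * n + k) * s.narr 1 (k * n + e' % n))
      (5 + (n + 1) * (t + 8)) (L := n * n) (by simp) (by omega) (by omega)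
      (by simp [Prog.ModN, modN_forLoop, mulAddStep]) (by simp [Prog.ModN, modN_forLoop, mulAddStep])
      (by simp) ?_) ?_⟩
    · intro e s' he h1 hu ih
      have hn0 : 0 < n := Nat.pos_of_ne_zero fun h => by simp [h] at he
      have hn' : s'.nreg 0 = n := by
        rw [hu.nreg 0 (by simp [Prog.ModN, modN_forLoop, mulAddStep])]
        simp [hn]
      have ha : ∀ a, a ≠ 2 → s'.narr a = s.narr a := fun a ha => by
        rw [hu.narr a (by simp [Prog.ModA, modA_forLoop, mulAddStep, ha])]
        rfl
      rw [runs_seq, runs_setN, runs_seq]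
      refine ⟨trivial, (runs_mulAdd (s := s'.setReg 4 0) hn0 hW (by simp [hn']) (by simp [h1]) he
        (by simp) (by simpa [ha] using hA') (by simpa [ha] using hB')).conseq ?_⟩
      rintro s₂ k hu₂ ⟨hk, h4⟩
      rw [runs_putN]
      have h1₂ : s₂.nreg 1 = e := by
        rw [hu₂.nreg 1 (by simp [Prog.ModN, modN_forLoop, mulAddStep])]
        simp [h1]
      have ha₂ : s₂.narr 2 = s'.narr 2 := by
        rw [hu₂.narr 2 (by simp [Prog.ModA, modA_forLoop, mulAddStep])]
        rfl
      refine ⟨trivial, trivial, by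
        change k ≤ (n + 1) * (t + 8) at hk
        simp only [NExp.cost]
        omega, fun e' he' => ?_⟩
      simp only [State.narr_setReg, State.narr_setCell, NExp.eval, h1₂, true_and]
      by_cases h : e' = e
      · rw [if_pos h, h4, h]
        simp [ha]
      · rw [if_neg h, ha₂, ih e' (by omega)]
    · rintro s' k ⟨hk, h⟩
      refine ⟨?_, h⟩
      simp only [NExp.cost]
      omega
  obtain ⟨s', k, hexec, hk, h⟩ := key
  refine ⟨s', k, hexec, fun i j => ?_, hk.trans ?_⟩
  · have hn0 : 0 < n := i.pos
    rw [h _ (by have := i.2; have := j.2; nlinarith), Matrix.mul_apply,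
      ← Fin.sum_univ_eq_sum_range
        (fun k => s.narr 0 ((i * n + j) / n * n + k) * s.narr 1 (k * n + (i * n + j) % n))]
    have e1 : ((i : ℕ) * n + j) / n = i := by
      rw [mul_comm, Nat.mul_add_div hn0, Nat.div_eq_of_lt j.2, add_zero]
    have e2 : ((i : ℕ) * n + j) % n = j := by
      rw [mul_comm, Nat.mul_add_mod, Nat.mod_eq_of_lt j.2]
    rw [e1, e2]
    exact Finset.sum_congr rfl fun k _ => by rw [hA, hB]
  · nlinarith [Nat.zero_le n, Nat.zero_le t, Nat.zero_le (n * t), Nat.zero_le (n * n * t),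
      Nat.zero_le (n * n), Nat.zero_le (n * n * n), Nat.zero_le (n * n * n * t)]

theorem matMulInTime_three : MatMulInTime 3 := by
  obtain ⟨C, hC⟩ := multiplies_naive
  refine ⟨naiveMul, 2, C, fun x s hx => ?_⟩
  obtain ⟨s', k, h1, h2, h3⟩ := hC x s hx
  refine ⟨s', k, h1, h2, ?_⟩
  have : (k : ℝ) ≤ C * ((x.n : ℝ) + 1) ^ 3 := by exact_mod_cast h3
  exact this.trans_eq (by norm_cast)

/-! ### The lower bound for the exponent of matrix multiplication. -/

theorem Exec.exists_finset {W : ℕ} {p : Prog} {s s' : State} {k : ℕ} (h : Exec W p s s' k)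
    (a : ℕ) : ∃ F : Finset ℕ, F.card ≤ k ∧ ∀ j ∉ F, s'.narr a j = s.narr a j := by
  have hcomp : ∀ {s₁ s₂ s₃ : State} {k l m : ℕ}, k + l ≤ m →
      (∃ F : Finset ℕ, F.card ≤ k ∧ ∀ j ∉ F, s₂.narr a j = s₁.narr a j) →
      (∃ F : Finset ℕ, F.card ≤ l ∧ ∀ j ∉ F, s₃.narr a j = s₂.narr a j) →
      ∃ F : Finset ℕ, F.card ≤ m ∧ ∀ j ∉ F, s₃.narr a j = s₁.narr a j := by
    rintro s₁ s₂ s₃ k l m hm ⟨F, hF, h1⟩ ⟨G, hG, h2⟩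
    refine ⟨F ∪ G, (Finset.card_union_le F G).trans (by omega), fun j hj => ?_⟩
    rw [Finset.mem_union, not_or] at hj
    rw [h2 j hj.2, h1 j hj.1]
  induction h with
  | skip | setN | setR | putR | loopDone => exact ⟨∅, by simp, fun _ _ => rfl⟩
  | putN s b i e =>
    refine ⟨{i.eval s}, by simp, fun j hj => ?_⟩
    rw [Finset.mem_singleton] at hj
    simp [updArr_apply, hj]
  | seq _ _ ih₁ ih₂ => exact hcomp le_rfl ih₁ ih₂
  | iteTrue _ _ _ ih | iteFalse _ _ _ ih =>
    obtain ⟨F, hF, h⟩ := ih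
    exact ⟨F, by omega, h⟩
  | loopStep _ _ _ _ ih₁ ih₂ => exact hcomp (by omega) ih₁ ih₂

/-- A correct program must work for every initial content of the output array. If that array is full
of ones and the matrices are zero, all `n ^ 2` output cells have to be overwritten, and `k` steps
change at most `k` cells. -/
theorem two_le_of_matMulInTime {ω : ℝ} (h : MatMulInTime ω) : 2 ≤ ω := by
  obtain ⟨p, d, C, hp⟩ := h
  have key : ∀ n : ℕ, (n : ℝ) ^ 2 ≤ C * ((n : ℝ) + 1) ^ ω := by
    intro n
    let x : MatPair := ⟨n, 0, 0, by simp, by simp⟩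
    let s : State := ⟨fun _ => n, fun a _ => if a = 2 then 1 else 0, fun _ => 0, fun _ _ => 0⟩
    obtain ⟨s', k, hexec, hout, hk⟩ := hp x s ⟨rfl, fun _ _ => rfl, fun _ _ => rfl⟩
    obtain ⟨F, hF, hF'⟩ := hexec.exists_finset 2
    have hsub : Finset.range (n * n) ⊆ F := by
      intro m hm
      by_contra hmF
      have hm' := Finset.mem_range.1 hm
      have hn0 : 0 < n := Nat.pos_of_ne_zero fun h => by simp [h] at hm'
      have h1 := hout ⟨m / n, Nat.div_lt_of_lt_mul hm'⟩ ⟨m % n, Nat.mod_lt _ hn0⟩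
      have h2 : m / n * x.n + m % n = m := Nat.div_add_mod' m n
      simp only [h2, hF' m hmF] at h1
      simp [s, x] at h1
    have hcard := (Finset.card_le_card hsub).trans hF
    rw [Finset.card_range] at hcard
    have h3 : ((n * n : ℕ) : ℝ) ≤ k := by exact_mod_cast hcard
    rw [pow_two]
    push_cast at h3
    exact h3.trans hk
  by_contra! hω
  have hlim : Filter.Tendsto (fun n : ℕ => ((n : ℝ) + 1) ^ (2 - ω)) Filter.atTop Filter.atTop :=
    (tendsto_rpow_atTop (by linarith)).comp
      (Filter.tendsto_atTop_add_const_right _ 1 tendsto_natCast_atTop_atTop)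
  -- The `4` comes from `(n + 1) ^ 2 ≤ 4 * n ^ 2`, valid for `n ≥ 1`.
  obtain ⟨n, hn, hn1⟩ := ((hlim.eventually_gt_atTop (4 * C)).and
    (Filter.eventually_ge_atTop 1)).exists
  have hn1' : (1 : ℝ) ≤ n := by exact_mod_cast hn1
  have h1 : ((n : ℝ) + 1) ^ (2 : ℝ) ≤ 4 * (n : ℝ) ^ 2 := by
    rw [Real.rpow_two]
    nlinarith
  have h2 : ((n : ℝ) + 1) ^ (2 : ℝ) = ((n : ℝ) + 1) ^ (2 - ω) * ((n : ℝ) + 1) ^ ω := by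
    rw [← Real.rpow_add (by positivity)]
    ring_nf
  have h3 : 0 < ((n : ℝ) + 1) ^ ω := by positivity
  have h4 := mul_lt_mul_of_pos_right hn h3
  linarith [key n]

theorem bddBelow_matMulInTime : BddBelow {τ : ℝ | MatMulInTime τ} :=
  ⟨2, fun _ h => two_le_of_matMulInTime h⟩

theorem matMulExponent_le_three : matMulExponent ≤ 3 :=
  csInf_le bddBelow_matMulInTime matMulInTime_three


/-! ### The exponent `t(ω, h)` -/

theorem halfRest_eq {h b : ℕ} (hb : b ≤ h) : halfRest h b = ((h - b) / 2 : ℕ) := by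
  unfold halfRest
  rw [Int.floor_eq_iff, ← Nat.cast_sub hb]
  have h1 : 2 * ((h - b) / 2) ≤ h - b := Nat.mul_div_le _ _
  have h2 : h - b < 2 * ((h - b) / 2) + 2 := by omega
  have h1' : 2 * (((h - b) / 2 : ℕ) : ℝ) ≤ (h - b : ℕ) := by exact_mod_cast h1
  have h2' : ((h - b : ℕ) : ℝ) < 2 * (((h - b) / 2 : ℕ) : ℝ) + 2 := by exact_mod_cast h2
  rw [Int.cast_natCast]
  constructor <;> linarith

theorem le_of_halfRest_nonneg {h b : ℕ} (hb : 0 ≤ halfRest h b) : b ≤ h := by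
  have h1 : (0 : ℝ) ≤ ((h : ℝ) - b) / 2 := by
    have := Int.floor_le (((h : ℝ) - b) / 2)
    have h2 : (0 : ℝ) ≤ (halfRest h b : ℝ) := by exact_mod_cast hb
    exact h2.trans this
  have : (b : ℝ) ≤ h := by linarith
  exact_mod_cast this

theorem add_two_le_of_mem {ω : ℝ} (h3 : ω ≤ 3) {h b : ℕ} (hb0 : 1 ≤ b)
    (hb : (b : ℝ) / (4 - ω) ≤ halfRest h b) : b + 2 ≤ h := by
  have h4 : (0 : ℝ) < b := by exact_mod_cast hb0
  have h5 : 0 < (b : ℝ) / (4 - ω) := div_pos h4 (by linarith)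
  have h6 : 0 < halfRest h b := by exact_mod_cast h5.trans_le hb
  have h7 := le_of_halfRest_nonneg h6.le
  rw [halfRest_eq h7] at h6
  omega

theorem one_mem_bOne {ω : ℝ} (h3 : ω ≤ 3) {h : ℕ} (hh : 3 ≤ h) :
    ((1 : ℕ) : ℝ) / (4 - ω) ≤ halfRest h 1 := by
  rw [halfRest_eq (by omega)]
  have h1 : 1 ≤ (h - 1) / 2 := by omega
  have h2 : (1 : ℝ) ≤ ((h - 1) / 2 : ℕ) := by exact_mod_cast h1
  rw [Nat.cast_one, Int.cast_natCast]
  exact ((div_le_one (by linarith)).2 (by linarith)).trans h2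

/-- Boundedness is what makes `bOne` a true maximum, as `sSup` of an unbounded set of naturals is
`0`. -/
theorem bddAbove_bOne {ω : ℝ} (h3 : ω ≤ 3) {h : ℕ} :
    BddAbove {b : ℕ | (b : ℝ) / (4 - ω) ≤ halfRest h b} := by
  refine ⟨h, fun b hb => ?_⟩
  rcases Nat.eq_zero_or_pos b with rfl | h0
  · exact Nat.zero_le h
  · have := add_two_le_of_mem h3 h0 hb
    omega

theorem one_le_bOne {ω : ℝ} (h3 : ω ≤ 3) {h : ℕ} (hh : 3 ≤ h) : 1 ≤ bOne ω h :=
  le_csSup (bddAbove_bOne h3) (one_mem_bOne h3 hh)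

theorem bOne_mem {ω : ℝ} (h3 : ω ≤ 3) {h : ℕ} (hh : 3 ≤ h) :
    (bOne ω h : ℝ) / (4 - ω) ≤ halfRest h (bOne ω h) :=
  Nat.sSup_mem ⟨1, one_mem_bOne h3 hh⟩ (bddAbove_bOne h3)

/-- For `μ = b / (4 - ω)` one has `b = (4 - ω) * μ`, so `h - b + μ = h - (3 - ω) * μ` and both terms
of `planExp` coincide. The condition `μ ≤ b` holds because `4 - ω ≥ 1`. -/
theorem exists_isPlan_sOne {ω : ℝ} (h3 : ω ≤ 3) {h : ℕ} (hh : 3 ≤ h) :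
    ∃ b μ, IsPlan h b μ ∧ planExp ω h b μ ≤ sOne ω h := by
  have h1 := one_le_bOne h3 hh
  have hm := bOne_mem h3 hh
  have hle := add_two_le_of_mem h3 h1 hm
  have h4 : 0 < 4 - ω := by linarith
  refine ⟨bOne ω h, bOne ω h / (4 - ω), ⟨h1, hle, by positivity, ?_, ?_⟩, ?_⟩
  · exact div_le_self (by positivity) (by linarith)
  · rw [halfRest_eq (by omega), Int.cast_natCast] at hm
    exact hm
  · refine max_le le_rfl (le_of_eq ?_)
    unfold sOne
    field_simp
    ring

/-- The infimum is over a finite nonempty set (`b = h - 2` is admissible), so it is attained; the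
plan uses the largest `μ` allowed by the outer part. -/
theorem exists_isPlan_sTwo {ω : ℝ} {h : ℕ} (hh : 3 ≤ h) :
    ∃ b μ, IsPlan h b μ ∧ planExp ω h b μ ≤ sTwo ω h := by
  set S := {x : ℝ | ∃ b : ℕ, halfRest h b ≤ b ∧ (b : ℤ) ≤ (h : ℤ) - 2 ∧ x = sTwoAt ω h b}
  have hfin : S.Finite := by
    refine ((Set.finite_Iic h).image (sTwoAt ω h)).subset ?_
    rintro x ⟨b, -, hb, rfl⟩
    exact ⟨b, by rw [Set.mem_Iic]; omega, rfl⟩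
  have hne : S.Nonempty := by
    refine ⟨_, h - 2, ?_, by omega, rfl⟩
    rw [halfRest_eq (by omega)]
    omega
  obtain ⟨b, h1, h2, h4⟩ := hne.csInf_mem hfin
  rw [halfRest_eq (by omega)] at h1
  refine ⟨b, ((h - b) / 2 : ℕ), ⟨by omega, by omega, by positivity, by exact_mod_cast h1, le_rfl⟩, ?_⟩
  rw [sTwo, h4, sTwoAt, planExp, halfRest_eq (by omega), Int.cast_natCast]

theorem exists_isPlan {ω : ℝ} (h3 : ω ≤ 3) {h : ℕ} (hh : 3 ≤ h) :
    ∃ b μ, IsPlan h b μ ∧ planExp ω h b μ ≤ tExp ω h := by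
  rcases min_choice (sOne ω h) (sTwo ω h) with h1 | h1
  · rw [tExp, h1]
    exact exists_isPlan_sOne h3 hh
  · rw [tExp, h1]
    exact exists_isPlan_sTwo hh

theorem tExp_three {ω : ℝ} (h3 : ω ≤ 3) : tExp ω 3 = 2 + 1 / (4 - ω) := by
  have hb : bOne ω 3 = 1 := by
    have h1 := one_le_bOne h3 le_rfl
    have h2 := add_two_le_of_mem h3 h1 (bOne_mem h3 le_rfl)
    omega
  have h1 : sOne ω 3 = 2 + 1 / (4 - ω) := by
    rw [sOne, hb]
    push_cast
    ring
  have h2 : 3 ≤ sTwo ω 3 := by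
    refine le_csInf ⟨_, 1, ?_, by norm_num, rfl⟩ ?_
    · rw [halfRest_eq (by omega)]
    · rintro x ⟨b, h4, h5, rfl⟩
      have hb1 : b = 1 := by
        rw [halfRest_eq (by omega)] at h4
        omega
      subst hb1
      refine le_max_of_le_left ?_
      rw [halfRest_eq (by omega)]
      norm_num
  have h4 : 1 / (4 - ω) ≤ 1 := (div_le_one (by linarith)).2 (by linarith)
  rw [tExp, h1, min_eq_left (by linarith)]

/-! ### Passing to the infimum of the exponents. -/

theorem planExp_le_add {ω ω' : ℝ} {h b : ℕ} {μ ε : ℝ} (hμ : 0 ≤ μ) (hε : 0 < ε)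
    (hω : ω ≤ ω' + ε / (μ + 1)) : planExp ω h b μ ≤ planExp ω' h b μ + ε := by
  -- With the plan fixed, the exponent grows with `ω` at rate at most `μ`; the `+ 1` covers `μ = 0`.
  have h1 : ε / (μ + 1) * μ ≤ ε := by
    rw [div_mul_eq_mul_div, div_le_iff₀ (by linarith)]
    nlinarith
  have h2 := mul_le_mul_of_nonneg_right hω hμ
  refine max_le ?_ ?_
  · linarith [le_max_left ((h : ℝ) - b + μ) (h - (3 - ω') * μ), planExp.eq_def ω' h b μ]
  · have := le_max_right ((h : ℝ) - b + μ) (h - (3 - ω') * μ)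
    rw [← planExp] at this
    linarith

theorem exists_matMulInTime_lt {δ : ℝ} (hδ : 0 < δ) :
    ∃ ω, MatMulInTime ω ∧ ω ≤ 3 ∧ ω ≤ matMulExponent + δ := by
  obtain ⟨ω, hω, hlt⟩ := exists_lt_of_csInf_lt ⟨3, matMulInTime_three⟩
    (show sInf {τ : ℝ | MatMulInTime τ} < matMulExponent + δ by
      change matMulExponent < _
      linarith)
  -- An exponent above `3` is replaced by `3`, since the analysis needs `ω ≤ 3`.
  rcases le_total ω 3 with h | h
  · exact ⟨ω, hω, h, hlt.le⟩
  · exact ⟨3, matMulInTime_three, le_rfl, h.trans hlt.le⟩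

end WordRAM

theorem theorem1 (h : ℕ) (hh : 3 ≤ h) (H : SimpleGraph (Fin h)) :
    (∀ ω : ℝ, ω ≤ 3 → MatMulInTime ω → MaxHSubgraphInTime H (tExp ω h)) ∧
      (∀ ε : ℝ, 0 < ε → MaxHSubgraphInTime H (tExp matMulExponent h + ε)) ∧
      (∀ ω : ℝ, ω ≤ 3 → tExp ω 3 = 2 + 1 / (4 - ω)) := by
  refine ⟨fun ω h3 hM => ?_, fun ε hε => ?_, fun ω h3 => WordRAM.tExp_three h3⟩
  · obtain ⟨b, μ, hp, hle⟩ := WordRAM.exists_isPlan h3 hh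
    exact WordRAM.maxHSubgraphInTime_of_isPlan hM (WordRAM.two_le_of_matMulInTime hM) h3 hp hle H
  -- The plan is chosen for the infimum itself, which need not be an admissible exponent; `IsPlan`
  -- does not involve `ω`, so the plan remains valid for the nearby exponent that is used.
  · obtain ⟨b, μ, hp, hle⟩ := WordRAM.exists_isPlan WordRAM.matMulExponent_le_three hh
    have hμ := hp.nonneg
    obtain ⟨ω, hM, h3, hω⟩ := WordRAM.exists_matMulInTime_lt
      (show 0 < ε / (μ + 1) by positivity)
    exact WordRAM.maxHSubgraphInTime_of_isPlan hM (WordRAM.two_le_of_matMulInTime hM) h3 hp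
      ((WordRAM.planExp_le_add hμ hε hω).trans (by linarith)) H
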